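/- **Proposition (evolution equations for the constraints).** Repeated capital indices $I,J,\dots\in\{1,2,3\}$ and repeated small indices $i,j,\dots\in\{1,2,3\}$ are summed; Greek indices run over $0,\dots,3$; round, square and angular brackets around two indices denote symmetrization, antisymmetrization (both with factor $\tfrac12$) and trace-free symmetrization. *Setting.* Let $\mathfrak a>0$, $\rho>0$, $\alpha=\frac{\mathfrak a+1}{\rho+2/3}$, $\beta=\frac1{6\rho}+1$, $V\in C^\infty(\mathbb R)$. Let $S$ be a smooth 3-manifold with a global smooth frame $\{E_i\}$ and dual frame $\{\eta^i\}$; extend them to $M=(T-\delta,T+\delta)\times S$, $0<\delta\le T$, so that $E_i$ is tangent to the slices and $[\partial_t,E_i]=0$. Let $u=(e_I^i,\omega^I_i,N,\Sigma_{IJ},\Gamma_{IJK},N_I,\theta,\varphi_t,\varphi_I,\varphi)$ be smooth functions on $M$; write $e_I=e_I^iE_i$, $\omega^I=\omega^I_i\eta^i$, $k_{IJ}=\Sigma_{IJ}+\frac13\theta\delta_{IJ}$ and $\mathcal M_I=Ne_Jk_{JI}-N\Gamma_{JJK}k_{KI}-N\Gamma_{JIK}k_{JK}-Ne_I\theta-\varphi_t\varphi_I$.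 Suppose that $u$ solves the modified system $$\begin{aligned} \partial_te_I^i&=-Nk_{IJ}e_J^i,\qquad \partial_t\omega^I_i=Nk_{IJ}\omega^J_i,\qquad \partial_tN=(\mathfrak a+1)\big(N\theta-\tfrac1t\big)N,\\ \partial_t\Sigma_{IJ}&=-N\theta\Sigma_{IJ}-Ne_K\Gamma_{\langle IJ\rangle K}+Ne_{\langle I|}\Gamma_{K|J\rangle K}+Ne_{\langle I}N_{J\rangle}-N\Gamma_{\langle IJ\rangle L}\Gamma_{KLK}\\ &\quad+N\Gamma_{K\langle I|L}\Gamma_{L|J\rangle K}+NN_{\langle I}N_{J\rangle}-N\Gamma_{\langle IJ\rangle K}N_K+N\varphi_{\langle I}\varphi_{J\rangle},\\ \partial_t\Gamma_{IJK}&=-Nk_{IL}\Gamma_{LJK}+Ne_Jk_{KI}-Ne_Kk_{JI}+Nk_{KL}\Gamma_{JLI}-Nk_{JL}\Gamma_{KLI}-Nk_{IL}\Gamma_{JKL}\\ &\quad+Nk_{IL}\Gamma_{KJL}+NN_Jk_{IK}-NN_Kk_{IJ}+\tfrac23\delta_{IJ}Ne_K\Sigma_{LL}-\tfrac23\delta_{IK}Ne_J\Sigma_{LL}+\delta_{IK}\mathcal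 M_J-\delta_{IJ}\mathcal M_K,\\ \partial_tN_I&=(\mathfrak a+1)Ne_I\theta+(\mathfrak a+1)N\theta N_I-Nk_{IJ}N_J-\tfrac13\alpha Ne_I\Sigma_{JJ}+\alpha\mathcal M_I,\\ \partial_t\theta&=-2Ne_K\Gamma_{IIK}+Ne_IN_I-N\theta^2-N\Gamma_{IIL}\Gamma_{KLK}+N\Gamma_{KIL}\Gamma_{LIK}+NN_IN_I-N\Gamma_{IIK}N_K+N\varphi_I\varphi_I\\ &\quad+3NV\circ\varphi+\beta\big(2Ne_K\Gamma_{IIK}+N\Gamma_{IIL}\Gamma_{KLK}-N\Gamma_{KIL}\Gamma_{LIK}+N\theta^2-Nk_{IJ}k_{IJ}\\ &\quad-\tfrac1N\varphi_t^2-N\varphi_I\varphi_I-2NV\circ\varphi\big),\\ \partial_t\varphi_t&=N^2e_I\varphi_I-N\theta\varphi_t+(\mathfrak a+1)\big(N\theta-\tfrac1t\big)\varphi_t-N^2\Gamma_{IIK}\varphi_K+N^2\varphi_IN_I-N^2V'\circ\varphi,\\ \partial_t\varphi_I&=e_I\varphi_t-Nk_{IJ}\varphi_J,\qquad \partial_t\varphi=\varphi_t,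 \end{aligned}$$ and that at $t=T$: $e_I^i\omega^J_i=\delta_I^J$, $N>0$, $\Sigma_{IJ}=\Sigma_{JI}$, $\Sigma_{II}=0$, $\Gamma_{IJK}=-\Gamma_{IKJ}$ and $\varphi_I=e_I\varphi$. (The Einstein constraints, $N_I=e_I(\ln N)$ and vanishing torsion are not assumed at $t=T$.) *Constraint quantities.* Let $e_0=\frac1N\partial_t$, $g=-N^2dt\otimes dt+\omega^I\otimes\omega^I$, and let $D$ be the connection with $D_{e_0}e_0=e_I(\ln N)e_I$, $D_{e_0}e_I=e_I(\ln N)e_0$, $D_{e_I}e_0=k_{IJ}e_J$, $D_{e_I}e_J=k_{IJ}e_0+\Gamma_{IJK}e_K$. Put $C(X,Y)=[X,Y]-D_XY+D_YX$, $C_{IJK}=g(C(e_I,e_J),e_K)$, $\mathcal N_I=e_I(\ln N)-N_I$, $$\widehat R_{\alpha\beta\mu\nu}=g\big(D_{e_\alpha}D_{e_\beta}e_\mu-D_{e_\beta}D_{e_\alpha}e_\mu-D_{D_{e_\alpha}e_\beta-D_{e_\beta}e_\alpha}e_\mu,\,e_\nu\big),\qquad \widehat R_{\alpha\beta}=\widehat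 R_{\gamma\alpha\beta}{}^{\gamma},$$ $$E_{\alpha\beta}=\widehat R_{\alpha\beta}-e_\alpha(\varphi)e_\beta(\varphi)-(V\circ\varphi)g_{\alpha\beta}.$$ *Conclusion.* The variables $v=(C_{IJK},\mathcal N_I,e_I\mathcal N_J,e_I\mathcal N_I,E_{00},E_{I0},E_{[IJ]})$ satisfy on $M$ $$\begin{aligned} e_0C_{IJK}&=L,\qquad e_0\mathcal N_I=L,\qquad e_0e_I\mathcal N_J=-\alpha e_IE_{J0}+L,\qquad e_0e_I\mathcal N_I=-\alpha e_IE_{I0}+L,\\ e_0E_{I0}&=\big(\tfrac23+\rho\big)e_IE_{00}-\tfrac12e_Ke_K\mathcal N_I-\tfrac16(1+6\rho)e_Ie_K\mathcal N_K+e_KE_{[IK]}+L,\\ e_0E_{00}&=\big(\tfrac1{3\rho}-\alpha\big)e_KE_{K0}+L,\qquad e_0E_{[IJ]}=\tfrac12\big(e_JE_{I0}-e_IE_{J0}\big)+L, \end{aligned}$$ where each $L$ is linear and homogeneous in $E_{00},E_{I0},E_{[IJ]},C_{IJK},\mathcal N_I,e_I\mathcal N_J$, with coefficients depending only on the solution,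 $\mathfrak a$ and $\rho$: they are polynomials, which depend only on $\mathfrak a$ and $\rho$, in the iterated derivatives along $e_0,\dots,e_3$ of the components of $u$, of $1/N$, $1/t$ and $V^{(n)}\circ\varphi$, and of the structure functions $\eta^k([E_i,E_j])$ of the reference frame. Moreover, if $0<\rho<\frac{2}{9\mathfrak a+6}$, then this system, which can be written $\partial_tv=A^iE_iv+Bv$ (where the term $e_KE_{[IK]}$ contributes to $A^i$ through $\tfrac12 e_K(E_{[IK]}-E_{[KI]})$), is a linear homogeneous symmetrizable hyperbolic system: $A^i$ and $B$ are smooth on $M$, and there are a smooth symmetric matrix function $A^0$ on $M$ and a constant $c>0$ such that $A^0\ge c\,\mathrm{Id}$ and $A^0A^i$ is symmetric for every $i$. -/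

import Mathlib

open scoped Manifold ContDiff

noncomputable section

namespace EinsteinScalar

/-- The model with corners of the spacetime `ℝ × S`, where `S` is a smooth 3-manifold. -/
abbrev stModel : ModelWithCorners ℝ (ℝ × EuclideanSpace ℝ (Fin 3))
    (ModelProd ℝ (EuclideanSpace ℝ (Fin 3))) :=
  (𝓘(ℝ, ℝ)).prod (𝓡 3)

/-- The Kronecker delta. -/
def kd (I J : Fin 3) : ℝ := if I = J then 1 else 0

/-- Trace-free symmetrization `A_{⟨IJ⟩}` of an array. -/
def tfs (A : Fin 3 → Fin 3 → ℝ) (I J : Fin 3) : ℝ :=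
  (A I J + A J I) / 2 - (∑ K, A K K) / 3 * kd I J

section Spacetime

variable {S : Type*} [TopologicalSpace S] [ChartedSpace (EuclideanSpace ℝ (Fin 3)) S]

variable (S) in
/-- A global smooth frame `E_1, E_2, E_3` of the tangent bundle of `S`. The dual frame is
`η^i = (basis x).coord i`. -/
structure RefFrame [IsManifold (𝓡 3) ∞ S] where
  basis : ∀ x : S, Module.Basis (Fin 3) ℝ (TangentSpace (𝓡 3) x)
  smooth : ∀ i, ContMDiff (𝓡 3) (𝓡 3).tangent ∞
    (fun x => (⟨x, basis x i⟩ : TangentBundle (𝓡 3) S))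

/-- Vector fields on the spacetime `ℝ × S`. -/
abbrev VField (S : Type*) [TopologicalSpace S] [ChartedSpace (EuclideanSpace ℝ (Fin 3)) S] :=
  ∀ p : ℝ × S, TangentSpace stModel p

/-- The derivative `X f` of a function along a vector field. -/
def dirD (X : VField S) (f : ℝ × S → ℝ) : ℝ × S → ℝ :=
  fun p => mfderiv stModel 𝓘(ℝ, ℝ) f p (X p)

/-- The vector field `∂_t`. -/
def dt : VField S := fun p => ((1 : ℝ), (0 : TangentSpace (𝓡 3) p.2))

/-- The slab `(T - δ, T + δ) × S`. -/
def slab (S : Type*) (T δ : ℝ) : Set (ℝ × S) := Set.Ioo (T - δ) (T + δ) ×ˢ Set.univ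

/-- Smoothness of a function on the slab `(T - δ, T + δ) × S`. -/
def SmoothOn (T δ : ℝ) (f : ℝ × S → ℝ) : Prop :=
  ContMDiffOn stModel 𝓘(ℝ, ℝ) ∞ f (slab S T δ)

/-- The unknowns of the modified system: `e_I^i`, `ω^I_i`, `N`, `Σ_{IJ}`, `Γ_{IJK}`, `N_I`, `θ`,
`φ_t`, `φ_I`, `φ`. -/
structure Unknowns (S : Type*) where
  e : Fin 3 → Fin 3 → ℝ × S → ℝ
  om : Fin 3 → Fin 3 → ℝ × S → ℝ
  N : ℝ × S → ℝ
  shear : Fin 3 → Fin 3 → ℝ × S → ℝ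
  Gam : Fin 3 → Fin 3 → Fin 3 → ℝ × S → ℝ
  dN : Fin 3 → ℝ × S → ℝ
  theta : ℝ × S → ℝ
  phit : ℝ × S → ℝ
  dphi : Fin 3 → ℝ × S → ℝ
  phi : ℝ × S → ℝ

/-- `k_{IJ} = Σ_{IJ} + (1/3) θ δ_{IJ}`. -/
def Unknowns.k (u : Unknowns S) (I J : Fin 3) : ℝ × S → ℝ :=
  fun p => u.shear I J p + u.theta p / 3 * kd I J

/-- The parameter `α = (𝔞 + 1) / (ρ + 2/3)`. -/
def alpha (a ρ : ℝ) : ℝ := (a + 1) / (ρ + 2 / 3)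

/-- The parameter `β = 1 / (6ρ) + 1`. -/
def beta (ρ : ℝ) : ℝ := 1 / (6 * ρ) + 1

variable [IsManifold (𝓡 3) ∞ S]

/-- `E_i` as a vector field on `ℝ × S`, tangent to the slices and commuting with `∂_t`. -/
def RefFrame.vf (E : RefFrame S) (i : Fin 3) : VField S := fun p => ((0 : ℝ), E.basis p.2 i)

/-- The structure functions `γ_{ij}^k = η^k([E_i, E_j])` of the reference frame. -/
def RefFrame.struc (E : RefFrame S) (i j k : Fin 3) : ℝ × S → ℝ :=
  fun p => (E.basis p.2).coord k
    (mfderiv stModel (𝓡 3) Prod.snd p (VectorField.mlieBracket stModel (E.vf i) (E.vf j) p))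

variable (E : RefFrame S) (u : Unknowns S)

/-- `e_I = e_I^i E_i`. -/
def eS (I : Fin 3) : VField S := fun p => ∑ i, u.e I i p • E.vf i p

/-- `e_0 = (1/N) ∂_t`. -/
def e0 : VField S := fun p => (u.N p)⁻¹ • dt p

/-- The frame `e_0, e_1, e_2, e_3`. -/
def fr (α : Fin 4) : VField S := Fin.cases (motive := fun _ => VField S) (e0 u) (eS E u) α

/-- The one form `dt`. -/
def dtForm (p : ℝ × S) (v : TangentSpace stModel p) : ℝ :=
  mfderiv stModel 𝓘(ℝ, ℝ) (Prod.fst : ℝ × S → ℝ) p v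

/-- The one form `ω^I = ω^I_i η^i`. -/
def omForm (I : Fin 3) (p : ℝ × S) (v : TangentSpace stModel p) : ℝ :=
  ∑ i, u.om I i p * (E.basis p.2).coord i (mfderiv stModel (𝓡 3) Prod.snd p v)

/-- The metric `g = - N² dt ⊗ dt + ω^I ⊗ ω^I`. -/
def metric (p : ℝ × S) (v w : TangentSpace stModel p) : ℝ :=
  -(u.N p) ^ 2 * dtForm p v * dtForm p w + ∑ I, omForm E u I p v * omForm E u I p w

/-- The coframe dual to `e_0, e_1, e_2, e_3`, that is `N dt, ω^1, ω^2, ω^3`. -/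
def cofr (α : Fin 4) (p : ℝ × S) (v : TangentSpace stModel p) : ℝ :=
  Fin.cases (motive := fun _ => ℝ) (u.N p * dtForm p v) (fun I => omForm E u I p v) α

/-! ### The modified system -/

/-- `N` times the momentum constraint quantity,
`N e_J k_{JI} - N Γ_{JJK} k_{KI} - N Γ_{JIK} k_{JK} - N e_I θ - φ_t φ_I`. -/
def momC (I : Fin 3) (p : ℝ × S) : ℝ :=
  u.N p * (∑ J, dirD (eS E u J) (u.k J I) p)
    - u.N p * (∑ J, ∑ K, u.Gam J J K p * u.k K I p)
    - u.N p * (∑ J, ∑ K, u.Gam J I K p * u.k J K p)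
    - u.N p * dirD (eS E u I) u.theta p - u.phit p * u.dphi I p

/-- `u` is a smooth solution of the modified system on `(T - δ, T + δ) × S` with
parameters `a`, `ρ` and potential `V`. -/
structure IsModifiedSolution (a ρ : ℝ) (V : ℝ → ℝ) (T δ : ℝ) : Prop where
  smooth_e : ∀ I i, SmoothOn T δ (u.e I i)
  smooth_om : ∀ I i, SmoothOn T δ (u.om I i)
  smooth_N : SmoothOn T δ u.N
  smooth_shear : ∀ I J, SmoothOn T δ (u.shear I J)
  smooth_Gam : ∀ I J K, SmoothOn T δ (u.Gam I J K)
  smooth_dN : ∀ I, SmoothOn T δ (u.dN I)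
  smooth_theta : SmoothOn T δ u.theta
  smooth_phit : SmoothOn T δ u.phit
  smooth_dphi : ∀ I, SmoothOn T δ (u.dphi I)
  smooth_phi : SmoothOn T δ u.phi
  eq_e : ∀ p ∈ slab S T δ, ∀ I i,
    dirD dt (u.e I i) p = -u.N p * ∑ J, u.k I J p * u.e J i p
  eq_om : ∀ p ∈ slab S T δ, ∀ I i,
    dirD dt (u.om I i) p = u.N p * ∑ J, u.k I J p * u.om J i p
  eq_N : ∀ p ∈ slab S T δ,
    dirD dt u.N p = (a + 1) * (u.N p * u.theta p - 1 / p.1) * u.N p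
  eq_shear : ∀ p ∈ slab S T δ, ∀ I J,
    dirD dt (u.shear I J) p =
      -u.N p * u.theta p * u.shear I J p
      - u.N p * tfs (fun I J => ∑ K, dirD (eS E u K) (u.Gam I J K) p) I J
      + u.N p * tfs (fun I J => ∑ K, dirD (eS E u I) (u.Gam K J K) p) I J
      + u.N p * tfs (fun I J => dirD (eS E u I) (u.dN J) p) I J
      - u.N p * tfs (fun I J => ∑ K, ∑ L, u.Gam I J L p * u.Gam K L K p) I J
      + u.N p * tfs (fun I J => ∑ K, ∑ L, u.Gam K I L p * u.Gam L J K p) I J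
      + u.N p * tfs (fun I J => u.dN I p * u.dN J p) I J
      - u.N p * tfs (fun I J => ∑ K, u.Gam I J K p * u.dN K p) I J
      + u.N p * tfs (fun I J => u.dphi I p * u.dphi J p) I J
  eq_Gam : ∀ p ∈ slab S T δ, ∀ I J K,
    dirD dt (u.Gam I J K) p =
      -u.N p * (∑ L, u.k I L p * u.Gam L J K p)
      + u.N p * dirD (eS E u J) (u.k K I) p - u.N p * dirD (eS E u K) (u.k J I) p
      + u.N p * (∑ L, u.k K L p * u.Gam J L I p) - u.N p * (∑ L, u.k J L p * u.Gam K L I p)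
      - u.N p * (∑ L, u.k I L p * u.Gam J K L p) + u.N p * (∑ L, u.k I L p * u.Gam K J L p)
      + u.N p * u.dN J p * u.k I K p - u.N p * u.dN K p * u.k I J p
      + 2 / 3 * kd I J * u.N p * (∑ L, dirD (eS E u K) (u.shear L L) p)
      - 2 / 3 * kd I K * u.N p * (∑ L, dirD (eS E u J) (u.shear L L) p)
      + kd I K * momC E u J p - kd I J * momC E u K p
  eq_dN : ∀ p ∈ slab S T δ, ∀ I,
    dirD dt (u.dN I) p =
      (a + 1) * u.N p * dirD (eS E u I) u.theta p + (a + 1) * u.N p * u.theta p * u.dN I p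
      - u.N p * (∑ J, u.k I J p * u.dN J p)
      - 1 / 3 * alpha a ρ * u.N p * (∑ J, dirD (eS E u I) (u.shear J J) p)
      + alpha a ρ * momC E u I p
  eq_theta : ∀ p ∈ slab S T δ,
    dirD dt u.theta p =
      -2 * u.N p * (∑ I, ∑ K, dirD (eS E u K) (u.Gam I I K) p)
      + u.N p * (∑ I, dirD (eS E u I) (u.dN I) p) - u.N p * u.theta p ^ 2
      - u.N p * (∑ I, ∑ K, ∑ L, u.Gam I I L p * u.Gam K L K p)
      + u.N p * (∑ I, ∑ K, ∑ L, u.Gam K I L p * u.Gam L I K p)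
      + u.N p * (∑ I, u.dN I p * u.dN I p)
      - u.N p * (∑ I, ∑ K, u.Gam I I K p * u.dN K p)
      + u.N p * (∑ I, u.dphi I p * u.dphi I p) + 3 * u.N p * V (u.phi p)
      + beta ρ * (2 * u.N p * (∑ I, ∑ K, dirD (eS E u K) (u.Gam I I K) p)
        + u.N p * (∑ I, ∑ K, ∑ L, u.Gam I I L p * u.Gam K L K p)
        - u.N p * (∑ I, ∑ K, ∑ L, u.Gam K I L p * u.Gam L I K p)
        + u.N p * u.theta p ^ 2 - u.N p * (∑ I, ∑ J, u.k I J p * u.k I J p)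
        - 1 / u.N p * u.phit p ^ 2 - u.N p * (∑ I, u.dphi I p * u.dphi I p)
        - 2 * u.N p * V (u.phi p))
  eq_phit : ∀ p ∈ slab S T δ,
    dirD dt u.phit p =
      u.N p ^ 2 * (∑ I, dirD (eS E u I) (u.dphi I) p) - u.N p * u.theta p * u.phit p
      + (a + 1) * (u.N p * u.theta p - 1 / p.1) * u.phit p
      - u.N p ^ 2 * (∑ I, ∑ K, u.Gam I I K p * u.dphi K p)
      + u.N p ^ 2 * (∑ I, u.dphi I p * u.dN I p) - u.N p ^ 2 * deriv V (u.phi p)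
  eq_dphi : ∀ p ∈ slab S T δ, ∀ I,
    dirD dt (u.dphi I) p =
      dirD (eS E u I) u.phit p - u.N p * (∑ J, u.k I J p * u.dphi J p)
  eq_phi : ∀ p ∈ slab S T δ, dirD dt u.phi p = u.phit p

/-- The algebraic properties at `t = T` of the data induced by geometric initial data: `{ω^I}` is
dual to `{e_I}`, `N > 0`, `Σ_{IJ}` is symmetric and trace-free, `Γ_{IJK}` is antisymmetric in `J`
and `K`, and `φ_I = e_I φ`. The Einstein constraint equations, `N_I = e_I (ln N)` and the vanishing
of the torsion are not required. -/
structure HasAdmissibleData (T : ℝ) : Prop where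
  dual : ∀ x : S, ∀ I J, ∑ i, u.e I i (T, x) * u.om J i (T, x) = kd I J
  lapse_pos : ∀ x : S, 0 < u.N (T, x)
  shear_symm : ∀ x : S, ∀ I J, u.shear I J (T, x) = u.shear J I (T, x)
  shear_trace : ∀ x : S, ∑ I, u.shear I I (T, x) = 0
  Gam_antisymm : ∀ x : S, ∀ I J K, u.Gam I J K (T, x) = -u.Gam I K J (T, x)
  dphi_eq : ∀ x : S, ∀ I, u.dphi I (T, x) = dirD (eS E u I) u.phi (T, x)

/-! ### The connection with torsion and the constraint quantities -/

/-- `e_I (ln N)`. -/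
def dLog (I : Fin 3) : ℝ × S → ℝ := dirD (eS E u I) (fun q => Real.log (u.N q))

/-- The vector fields `D_{e_α} e_β`:
`D_{e_0} e_0 = e_I(ln N) e_I`, `D_{e_0} e_I = e_I(ln N) e_0`,
`D_{e_I} e_0 = k_{IJ} e_J`, `D_{e_I} e_J = k_{IJ} e_0 + Γ_{IJK} e_K`. -/
def connFr (α β : Fin 4) : VField S := fun p =>
  Fin.cases (motive := fun _ => TangentSpace stModel p)
    (Fin.cases (motive := fun _ => TangentSpace stModel p)
      (∑ I, dLog E u I p • eS E u I p)
      (fun I => dLog E u I p • e0 u p) β)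
    (fun I => Fin.cases (motive := fun _ => TangentSpace stModel p)
      (∑ J, u.k I J p • eS E u J p)
      (fun J => u.k I J p • e0 u p + ∑ K, u.Gam I J K p • eS E u K p) β) α

/-- The connection `D`: for `Y = Y^β e_β` and `X = X^α e_α`,
`D_X Y = X(Y^β) e_β + X^α Y^β D_{e_α} e_β`. -/
def conn (X Y : VField S) : VField S := fun p =>
  (∑ β, dirD X (fun q => cofr E u β q (Y q)) p • fr E u β p)
    + ∑ α, ∑ β, (cofr E u α p (X p) * cofr E u β p (Y p)) • connFr E u α β p

/-- The torsion `C(X, Y) = [X, Y] - D_X Y + D_Y X`. -/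
def torsion (X Y : VField S) : VField S := fun p =>
  VectorField.mlieBracket stModel X Y p - conn E u X Y p + conn E u Y X p

/-- `C_{IJK} = g(C(e_I, e_J), e_K)`. -/
def torsC (I J K : Fin 3) : ℝ × S → ℝ := fun p =>
  metric E u p (torsion E u (eS E u I) (eS E u J) p) (eS E u K p)

/-- `𝒩_I = e_I(ln N) - N_I`. -/
def lapC (I : Fin 3) : ℝ × S → ℝ := fun p => dLog E u I p - u.dN I p

/-- The modified curvature
`R̂_{αβμν} = g(D_{e_α} D_{e_β} e_μ - D_{e_β} D_{e_α} e_μ - D_{D_{e_α} e_β - D_{e_β} e_α} e_μ, e_ν)`.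
-/
def curvH (α β μ ν : Fin 4) : ℝ × S → ℝ := fun p =>
  metric E u p
    (conn E u (fr E u α) (conn E u (fr E u β) (fr E u μ)) p
      - conn E u (fr E u β) (conn E u (fr E u α) (fr E u μ)) p
      - conn E u (fun q => conn E u (fr E u α) (fr E u β) q - conn E u (fr E u β) (fr E u α) q)
          (fr E u μ) p)
    (fr E u ν p)

/-- The components `g^{αα}` of the inverse metric in the orthonormal frame. -/
def sgn (α : Fin 4) : ℝ := if α = 0 then -1 else 1

/-- `R̂_{αβ} = R̂_{γαβ}{}^γ`. -/
def ricH (α β : Fin 4) : ℝ × S → ℝ := fun p => ∑ γ, sgn γ * curvH E u γ α β γ p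

/-- `E_{αβ} = R̂_{αβ} - e_α(φ) e_β(φ) - (V ∘ φ) g_{αβ}`. -/
def errT (V : ℝ → ℝ) (α β : Fin 4) : ℝ × S → ℝ := fun p =>
  ricH E u α β p - dirD (fr E u α) u.phi p * dirD (fr E u β) u.phi p
    - V (u.phi p) * metric E u p (fr E u α p) (fr E u β p)

/-- `E_{[IJ]} = (1/2)(E_{IJ} - E_{JI})`. -/
def errA (V : ℝ → ℝ) (I J : Fin 3) : ℝ × S → ℝ := fun p =>
  (errT E u V I.succ J.succ p - errT E u V J.succ I.succ p) / 2

end Spacetime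

/-- Labels of the constraint variables
`(C_{IJK}, 𝒩_I, e_I 𝒩_J, e_I 𝒩_I, E_{00}, E_{I0}, E_{[IJ]})`, in this order. -/
inductive CVar : Type
  | tors (I J K : Fin 3)
  | lap (I : Fin 3)
  | dLap (I J : Fin 3)
  | trLap
  | ham
  | mom (I : Fin 3)
  | rot (I J : Fin 3)
  deriving DecidableEq, Fintype

/-- Functions from which the coefficients are built: the components of the solution, `1/N`, `1/t`,
`V^{(n)} ∘ φ`, and the structure functions of the reference frame. -/
inductive CoefBase : Type
  | e (I i : Fin 3)
  | om (I i : Fin 3)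
  | N
  | invN
  | shear (I J : Fin 3)
  | Gam (I J K : Fin 3)
  | dN (I : Fin 3)
  | theta
  | phit
  | dphi (I : Fin 3)
  | phi
  | invT
  | pot (n : ℕ)
  | struc (i j k : Fin 3)

/-- `([α_1, …, α_n], b)` stands for the iterated frame derivative `e_{α_1} ⋯ e_{α_n} b`. -/
abbrev CoefAtom := List (Fin 4) × CoefBase

section System

variable {S : Type*} [TopologicalSpace S] [ChartedSpace (EuclideanSpace ℝ (Fin 3)) S]
  [IsManifold (𝓡 3) ∞ S] (E : RefFrame S) (u : Unknowns S) (V : ℝ → ℝ)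

/-- The constraint variables of a solution. -/
def cvar : CVar → ℝ × S → ℝ
  | .tors I J K => torsC E u I J K
  | .lap I => lapC E u I
  | .dLap I J => dirD (eS E u I) (lapC E u J)
  | .trLap => fun p => ∑ I, dirD (eS E u I) (lapC E u I) p
  | .ham => errT E u V 0 0
  | .mom I => errT E u V I.succ 0
  | .rot I J => errA E u V I J

/-- The function on spacetime denoted by a `CoefBase`. -/
def CoefBase.val : CoefBase → ℝ × S → ℝ
  | .e I i => u.e I i
  | .om I i => u.om I i
  | .N => u.N
  | .invN => fun p => (u.N p)⁻¹
  | .shear I J => u.shear I J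
  | .Gam I J K => u.Gam I J K
  | .dN I => u.dN I
  | .theta => u.theta
  | .phit => u.phit
  | .dphi I => u.dphi I
  | .phi => u.phi
  | .invT => fun p => p.1⁻¹
  | .pot n => fun p => iteratedDeriv n V (u.phi p)
  | .struc i j k => E.struc i j k

/-- The function on spacetime denoted by a `CoefAtom`. -/
def CoefAtom.val (A : CoefAtom) : ℝ × S → ℝ :=
  A.1.foldr (fun α f => dirD (fr E u α) f) (A.2.val E u V)

/-- The value of a universal differential polynomial on a solution. -/
def coef (P : MvPolynomial CoefAtom ℝ) : ℝ × S → ℝ :=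
  fun p => MvPolynomial.eval (fun A => CoefAtom.val E u V A p) P

/-- `∑_c B_{rc} c`, where `c` runs over the constraint variables. -/
def lowerOrder (B : CVar → CVar → MvPolynomial CoefAtom ℝ) (r : CVar) : ℝ × S → ℝ :=
  fun p => ∑ c, coef E u V (B r c) p * cvar E u V c p

/-- The linear homogeneous system `∂_t v = A^i E_i v + B v` on `(T - δ, T + δ) × S` is
symmetrizable hyperbolic. -/
structure IsSymmetrizableHyperbolic {ι : Type*} [Fintype ι] (T δ : ℝ)
    (A : Fin 3 → ℝ × S → Matrix ι ι ℝ) (B : ℝ × S → Matrix ι ι ℝ) : Prop where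
  smooth_A : ∀ i r c, SmoothOn T δ (fun p => A i p r c)
  smooth_B : ∀ r c, SmoothOn T δ (fun p => B p r c)
  symmetrizer : ∃ A0 : ℝ × S → Matrix ι ι ℝ,
    (∀ r c, SmoothOn T δ (fun p => A0 p r c)) ∧
    (∀ p ∈ slab S T δ, (A0 p).IsSymm) ∧
    (∃ c : ℝ, 0 < c ∧ ∀ p ∈ slab S T δ, ∀ w : ι → ℝ,
      c * (w ⬝ᵥ w) ≤ w ⬝ᵥ (A0 p).mulVec w) ∧
    ∀ p ∈ slab S T δ, ∀ i, (A0 p * A i p).IsSymm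

/-- `v` solves `∂_t v = A^i E_i v + B v` on `(T - δ, T + δ) × S`. -/
def SolvesLinear {ι : Type*} [Fintype ι] (T δ : ℝ)
    (A : Fin 3 → ℝ × S → Matrix ι ι ℝ) (B : ℝ × S → Matrix ι ι ℝ) (v : ι → ℝ × S → ℝ) : Prop :=
  ∀ p ∈ slab S T δ, ∀ r,
    dirD dt (v r) p =
      (∑ i, ∑ c, A i p r c * dirD (E.vf i) (v c) p) + ∑ c, B p r c * v c p

end System

/-- The constant matrix that multiplies `e_M v` in the principal part of the system for the
constraint variables. The term `e_K E_{[IK]}` is written as `(1/2) e_K (E_{[IK]} - E_{[KI]})`. -/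
def principalMatrix (a ρ : ℝ) (M : Fin 3) : Matrix CVar CVar ℝ
  | .dLap I J, .mom K => -alpha a ρ * kd M I * kd K J
  | .trLap, .mom K => -alpha a ρ * kd M K
  | .mom I, .ham => (2 / 3 + ρ) * kd M I
  | .mom I, .dLap K L => -(1 / 2) * kd M K * kd L I
  | .mom I, .trLap => -(1 / 6) * (1 + 6 * ρ) * kd M I
  | .mom I, .rot K L => 1 / 2 * (kd K I * kd L M - kd L I * kd K M)
  | .ham, .mom K => (1 / (3 * ρ) - alpha a ρ) * kd M K
  | .rot I J, .mom K => 1 / 2 * (kd M J * kd K I - kd M I * kd K J)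
  | _, _ => 0

end EinsteinScalar

end

open EinsteinScalar

/-! Expressions of type `L` are the elements of an ideal. In the ring of universal differential
polynomials evaluated on solutions, let I be the ideal generated by C, 𝒩, e_I𝒩_J, E_00, E_I0 and
E_[IJ]. Each evolution equation is then a congruence modulo I, and the whole computation can be done
in a commutative ℝ-algebra with four derivations (`ConstraintSystem`, `Contains`).

The algebraic conditions at t = T propagate because their defects solve homogeneous linear ODEs in
t. Hence k is symmetric with trace θ, and D is metric. The connection has torsion, and R̂ is formed
with D_X Y - D_Y X in place of the bracket. For these structure functions, d∘d fails to vanish only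
through the commutation defect, which is the torsion C, and through the Jacobi defect, which is the
cyclic sum of R̂ (`extD2_extD1`, `extD2_strucF`). The modified equation for Γ makes the Jacobi
defects with a time index linear in M, 𝒩 and C; the remaining ones are reached through traces
(`Contains.B`). So the second Bianchi identity and its contraction hold modulo I (`bianchi`,
`sum_covR`). Together with the wave equation this puts the divergence of the trace-reversed E into I
(`Contains.div`).

To close the system, all components of E are expressed through the constraint variables: E_I0 is the
momentum constraint, E_0I is -E_I0 up to multiples of 𝒩, and E_(IJ) is given by derivatives of 𝒩 and
the Hamiltonian expression H, where H = 6ρ(∑ P_II - E_00) and P is e_I𝒩_J up to undifferentiated 𝒩.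
Inserted into the divergence, this gives the equations for E_00 and E_I0 (`D_ham`, `D_mom`). The
equation for E_[IJ] is the trace of the differentiated Jacobi identity (`D_B`, `D_rot`). Those for C
and 𝒩 follow directly from the evolution of e, Γ, N and N_I.

The coefficients must be independent of the solution. Therefore the algebra is the ring of functions
on the disjoint union of all solution domains that come from differential polynomials. The formal
derivatives descend to it (`mk_formalD_congr`), so membership in I produces one universal choice of
polynomials.

In the principal part only E_I0 is coupled to the other variables. A constant diagonal matrix that
balances each pair of opposite coefficients is therefore a symmetrizer; the bound on ρ is what makes
its E_00 entry positive. -/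

open scoped Topology
open Set
set_option linter.unusedSectionVars false
set_option linter.unusedSimpArgs false

/-! ### Lie brackets and tangent vectors tested on functions -/

section General
variable {E : Type*} [NormedAddCommGroup E] [NormedSpace ℝ E] [CompleteSpace E]
  {H : Type*} [TopologicalSpace H] {I : ModelWithCorners ℝ E H} [I.Boundaryless]
  {M : Type*} [TopologicalSpace M] [ChartedSpace H M] [IsManifold I ∞ M]

/-- The derivative of a function along a vector field, on a general manifold. -/
noncomputable def vderiv (X : Π x : M, TangentSpace I x) (f : M → ℝ) : M → ℝ :=
  fun p => mfderiv I 𝓘(ℝ, ℝ) f p (X p)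

/-- Read in the extended chart at x, this is the flat identity
`VectorField.fderiv_apply_lieBracket`, that is, the symmetry of the second derivative. Since the
model has no boundary, derivatives within its range are ordinary derivatives. -/
theorem vderiv_mlieBracket {f : M → ℝ} {V W : Π x : M, TangentSpace I x} {x : M}
    (hf : ContMDiffAt I 𝓘(ℝ, ℝ) ∞ f x)
    (hV : MDifferentiableAt I I.tangent (fun y => (⟨y, V y⟩ : TangentBundle I M)) x)
    (hW : MDifferentiableAt I I.tangent (fun y => (⟨y, W y⟩ : TangentBundle I M)) x) :
    vderiv (VectorField.mlieBracket I V W) f x =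
      vderiv V (vderiv W f) x - vderiv W (vderiv V f) x := by
  have : IsManifold I 1 M := IsManifold.of_le (n := ∞) (by simp)
  have : IsManifold I 2 M := IsManifold.of_le (n := ∞) (WithTop.coe_le_coe.2 le_top)
  set φ := extChartAt I x with hφ
  have hr : range I = univ := I.range_eq_univ
  set g : E → ℝ := f ∘ φ.symm with hg
  have hfev : ∀ᶠ y in 𝓝 x, ContMDiffAt I 𝓘(ℝ, ℝ) 1 f y := by
    have := (contMDiffAt_iff_contMDiffAt_nhds (n := 1) (by simp)).1 (hf.of_le (m := 1) (by simp))
    exact this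
  have hfev' : ∀ᶠ y in 𝓝 (φ x), ContMDiffAt I 𝓘(ℝ, ℝ) 1 f (φ.symm y) := by
    have := (continuousAt_extChartAt_symm (I := I) x).tendsto
    rw [extChartAt_to_inv] at this
    exact this.eventually hfev
  have hgs : ContDiffAt ℝ ∞ g (φ x) := by
    have h2 := ((contMDiffAt_iff (n := ∞)).1 hf).2
    rw [hr, contDiffWithinAt_univ] at h2
    simpa using! h2
  have htgt : ∀ᶠ y in 𝓝 (φ x), y ∈ φ.target := extChartAt_target_mem_nhds x
  -- `pb X` is the field X in the chart. Near the base point X f becomes y ↦ dg(y)(`pb X` y), which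
  -- can be differentiated a second time.
  let pb : (Π x : M, TangentSpace I x) → E → E := fun X =>
    VectorField.mpullbackWithin 𝓘(ℝ, E) I φ.symm X (range I)
  have hpb : ∀ X : Π x : M, TangentSpace I x, ∀ᶠ y in 𝓝 (φ x),
      (mfderiv I 𝓘(ℝ, ℝ) f (φ.symm y) (X (φ.symm y)) : ℝ) = fderiv ℝ g y (pb X y) := by
    intro X
    filter_upwards [hfev', htgt] with y hy hyt
    have hinv := isInvertible_mfderivWithin_extChartAt_symm (I := I) (x := x) hyt
    have hd : MDifferentiableWithinAt 𝓘(ℝ, E) I φ.symm (range I) y :=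
      (contMDiffWithinAt_extChartAt_symm_range (n := 1) x hyt).mdifferentiableWithinAt (by simp)
    have h1 : mfderiv 𝓘(ℝ, E) 𝓘(ℝ, ℝ) g y
        = (mfderiv I 𝓘(ℝ, ℝ) f (φ.symm y)).comp (mfderivWithin 𝓘(ℝ, E) I φ.symm (range I) y) := by
      rw [hr] at hd ⊢
      rw [mfderivWithin_univ]
      exact mfderiv_comp y (hy.mdifferentiableAt (by simp)) (mdifferentiableWithinAt_univ.1 hd)
    rw [← mfderiv_eq_fderiv, h1]
    obtain ⟨e, he⟩ := hinv
    change _ = (mfderiv I 𝓘(ℝ, ℝ) f (φ.symm y)) ((mfderivWithin 𝓘(ℝ, E) I φ.symm (range I) y)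
      ((mfderivWithin 𝓘(ℝ, E) I φ.symm (range I) y).inverse (X (φ.symm y))))
    rw [← he, ContinuousLinearMap.inverse_equiv]
    congr 1
    exact (e.apply_symm_apply _).symm
  have hdiff : ∀ X : Π x : M, TangentSpace I x,
      MDifferentiableAt I I.tangent (fun y => (⟨y, X y⟩ : TangentBundle I M)) x →
      DifferentiableAt ℝ (pb X) (φ x) := by
    intro X hX
    have := (MDifferentiableWithinAt.differentiableWithinAt_mpullbackWithin_vectorField
      (mdifferentiableWithinAt_univ.2 hX))
    rw [preimage_univ, univ_inter] at this
    have h1 : DifferentiableWithinAt ℝ (pb X) (range I) (φ x) := this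
    rwa [hr, differentiableWithinAt_univ] at h1
  have hderiv : ∀ X : Π x : M, TangentSpace I x, ∀ F : M → ℝ, ∀ G : E → ℝ,
      DifferentiableAt ℝ G (φ x) → (∀ᶠ y in 𝓝 (φ x), F (φ.symm y) = G y) →
      vderiv X F x = fderiv ℝ G (φ x) (pb X (φ x)) := by
    intro X F G hG hFG
    have h1 : F =ᶠ[𝓝 x] G ∘ φ := by
      filter_upwards [(continuousAt_extChartAt (I := I) x).eventually hFG,
        extChartAt_source_mem_nhds (I := I) x] with y hy hys
      rw [Function.comp_apply, ← hy, φ.left_inv hys]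
    rw [vderiv, h1.mfderiv_eq, mfderiv_comp x (hG.mdifferentiableAt)
      (mdifferentiableAt_extChartAt (mem_chart_source H x)), mfderiv_eq_fderiv]
    change fderiv ℝ G (φ x) (mfderiv I 𝓘(ℝ, E) φ x (X x)) = _
    congr 1
    have hinv := isInvertible_mfderivWithin_extChartAt_symm (I := I) (x := x)
      (mem_extChartAt_target x)
    have hc := mfderivWithin_extChartAt_symm_comp_mfderiv_extChartAt' (I := I)
      (mem_extChartAt_source (I := I) x)
    obtain ⟨e, he⟩ := hinv
    have hc2 : mfderivWithin 𝓘(ℝ, E) I φ.symm (range I) (φ x) (mfderiv I 𝓘(ℝ, E) φ x (X x)) = X x :=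
      congrArg (fun L => L (X x)) hc
    change _ = (mfderivWithin 𝓘(ℝ, E) I φ.symm (range I) (φ x)).inverse (X (φ.symm (φ x)))
    have hx : X (φ.symm (φ x)) = (X x : E) := by rw [extChartAt_to_inv]
    rw [← he] at hc2
    rw [← he, ContinuousLinearMap.inverse_equiv]
    rw [hx]
    exact ((e.symm_apply_eq).2 hc2.symm).symm
  have hgd : DifferentiableAt ℝ (fderiv ℝ g) (φ x) :=
    (hgs.fderiv_right (m := 1) (by exact WithTop.coe_le_coe.2 le_top)).differentiableAt (by simp)
  have e1 := hderiv (VectorField.mlieBracket I V W) f g (hgs.differentiableAt (by simp))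
    (by simp [hg])
  have e2 := hderiv V (vderiv W f) _ (hgd.clm_apply (hdiff W hW)) (hpb W)
  have e3 := hderiv W (vderiv V f) _ (hgd.clm_apply (hdiff V hV)) (hpb V)
  refine e1.trans (Eq.trans ?_ (congrArg₂ (· - ·) e2 e3).symm)
  refine Eq.trans ?_ (VectorField.fderiv_apply_lieBracket hgs
    (by rw [minSmoothness_of_isRCLikeNormedField]; exact WithTop.coe_le_coe.2 le_top) (hdiff W hW) (hdiff V hV))
  congr 1
  have hinv := isInvertible_mfderivWithin_extChartAt_symm (I := I) (x := x)
    (mem_extChartAt_target x)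
  have hinv2 := isInvertible_mfderiv_extChartAt (I := I) (mem_extChartAt_source (I := I) x)
  have hc := mfderivWithin_extChartAt_symm_comp_mfderiv_extChartAt' (I := I)
    (mem_extChartAt_source (I := I) x)
  obtain ⟨e, he⟩ := hinv
  obtain ⟨e', he'⟩ := hinv2
  change (mfderivWithin 𝓘(ℝ, E) I φ.symm (range I) (φ x)).inverse
    (VectorField.mlieBracket I V W (φ.symm (φ x))) = _
  have hx : VectorField.mlieBracket I V W (φ.symm (φ x)) = (VectorField.mlieBracket I V W x : E) := by
    rw [extChartAt_to_inv]
  set L : E := VectorField.lieBracket ℝ (E := E) (pb V) (pb W) (φ x) with hL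
  have hb : (VectorField.mlieBracket I V W x : E) =
      (mfderiv I 𝓘(ℝ, E) φ x).inverse L := by
    rw [← VectorField.mlieBracketWithin_univ, VectorField.mlieBracketWithin_apply]
    rw [preimage_univ, univ_inter]
    refine congrArg (mfderiv I 𝓘(ℝ, E) φ x).inverse ?_
    have h1 : VectorField.lieBracketWithin ℝ (E := E) (pb V) (pb W) (range I) (φ x) = L := by
      rw [hr, VectorField.lieBracketWithin_univ]
    exact h1
  rw [hx, hb, ← he, ← he', ContinuousLinearMap.inverse_equiv, ContinuousLinearMap.inverse_equiv]
  refine (e.symm_apply_eq).2 ((e'.symm_apply_eq).2 ?_)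
  have hc' := mfderiv_extChartAt_comp_mfderivWithin_extChartAt_symm' (I := I)
    (mem_extChartAt_source (I := I) x)
  have := congrArg (fun A => A L) hc'
  change mfderiv I 𝓘(ℝ, E) φ x (mfderivWithin 𝓘(ℝ, E) I φ.symm (range I) (φ x) _) = _ at this
  rw [← he, ← he'] at this
  exact this.symm

/-- Linear functionals composed with the chart already separate tangent vectors. As they are smooth
only on the chart domain, the test functions are allowed to be local, and no cut-off is needed. -/
theorem tangent_eq_of_forall_mfderiv_eq {p : M} {v w : TangentSpace I p}
    (h : ∀ (f : M → ℝ) (U : Set M), IsOpen U → p ∈ U → ContMDiffOn I 𝓘(ℝ, ℝ) ∞ f U →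
      (mfderiv I 𝓘(ℝ, ℝ) f p v : ℝ) = mfderiv I 𝓘(ℝ, ℝ) f p w) : v = w := by
  have : IsManifold I 1 M := IsManifold.of_le (n := ∞) (by simp)
  have hinj : Function.Injective (mfderiv I 𝓘(ℝ, E) (extChartAt I p) p) :=
    (isInvertible_mfderiv_extChartAt (I := I) (mem_extChartAt_source (I := I) p)).injective
  apply hinj
  have key : ∀ ℓ : E →L[ℝ] ℝ, ℓ (mfderiv I 𝓘(ℝ, E) (extChartAt I p) p v : E) =
      ℓ (mfderiv I 𝓘(ℝ, E) (extChartAt I p) p w : E) := by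
    intro ℓ
    have hd : MDifferentiableAt I 𝓘(ℝ, E) (extChartAt I p) p :=
      mdifferentiableAt_extChartAt (mem_chart_source H p)
    have e : mfderiv I 𝓘(ℝ, ℝ) (ℓ ∘ extChartAt I p) p
        = (ℓ : E →L[ℝ] ℝ).comp (mfderiv I 𝓘(ℝ, E) (extChartAt I p) p) := by
      rw [mfderiv_comp p ℓ.differentiableAt.mdifferentiableAt hd, mfderiv_eq_fderiv, ℓ.fderiv]
      rfl
    have := h (ℓ ∘ extChartAt I p) (chartAt H p).source (chartAt H p).open_source
      (mem_chart_source H p) (ℓ.contMDiff.comp_contMDiffOn contMDiffOn_extChartAt)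
    rw [e] at this
    exact this
  exact (SeparatingDual.eq_iff_forall_dual_eq (R := ℝ) (V := E)).2 key
end General

/-! ### Calculus of derivatives along vector fields on ℝ × S -/

namespace EinsteinScalar
section
variable {S : Type*} [TopologicalSpace S] [ChartedSpace (EuclideanSpace ℝ (Fin 3)) S]
  [IsManifold (𝓡 3) ∞ S]

/-- Smoothness of a vector field on the spacetime. -/
def SmoothVF (X : VField S) (U : Set (ℝ × S)) : Prop :=
  ContMDiffOn stModel stModel.tangent ∞
    (fun p => (⟨p, X p⟩ : TangentBundle stModel (ℝ × S))) U

theorem mfderiv_fst_apply (p : ℝ × S) (v : TangentSpace stModel p) :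
    mfderiv stModel 𝓘(ℝ, ℝ) (Prod.fst : ℝ × S → ℝ) p v = v.1 := by
  rw [mfderiv_fst]; rfl

theorem mfderiv_snd_apply (p : ℝ × S) (v : TangentSpace stModel p) :
    mfderiv stModel (𝓡 3) (Prod.snd : ℝ × S → S) p v = v.2 := by
  rw [mfderiv_snd]; rfl

theorem dirD_fst (X : VField S) (p : ℝ × S) : dirD X Prod.fst p = (X p).1 :=
  mfderiv_fst_apply p (X p)

/-- X f is the fibre component of the tangent map of f composed with the section X. -/
theorem SmoothVF.dirD {X : VField S} {U : Set (ℝ × S)} (hU : IsOpen U) (hX : SmoothVF X U)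
    {f : ℝ × S → ℝ} (hf : ContMDiffOn stModel 𝓘(ℝ, ℝ) ∞ f U) :
    ContMDiffOn stModel 𝓘(ℝ, ℝ) ∞ (dirD X f) U := by
  have h1 := (hf.contMDiffOn_tangentMapWithin (m := ∞) (by simp) hU.uniqueMDiffOn).comp hX
    (fun p hp => hp)
  have h2 := (contMDiff_snd_tangentBundle_modelSpace ℝ 𝓘(ℝ, ℝ) (n := ∞)).comp_contMDiffOn h1
  refine h2.congr fun p hp => ?_
  change _ = (mfderivWithin stModel 𝓘(ℝ, ℝ) f U p (X p) : ℝ)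
  rw [mfderivWithin_of_isOpen hU hp]
  rfl

theorem smoothVF_vf (E : RefFrame S) (i : Fin 3) (U : Set (ℝ × S)) : SmoothVF (E.vf i) U := by
  have h1 : ContMDiff stModel (𝓘(ℝ, ℝ).tangent.prod (𝓡 3).tangent) ∞
      (fun p : ℝ × S => ((⟨p.1, 0⟩ : TangentBundle 𝓘(ℝ, ℝ) ℝ),
        (⟨p.2, E.basis p.2 i⟩ : TangentBundle (𝓡 3) S))) :=
    ((Bundle.contMDiff_zeroSection ℝ (TangentSpace 𝓘(ℝ, ℝ) : ℝ → Type _)).comp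
      contMDiff_fst).prodMk ((E.smooth i).comp contMDiff_snd)
  exact (contMDiff_equivTangentBundleProd_symm.comp h1).contMDiffOn

theorem smoothVF_dt (U : Set (ℝ × S)) : SmoothVF (dt : VField S) U := by
  have h0 : ContMDiff 𝓘(ℝ, ℝ) 𝓘(ℝ, ℝ).tangent ∞
      (fun t : ℝ => (⟨t, (1 : ℝ)⟩ : TangentBundle 𝓘(ℝ, ℝ) ℝ)) :=
    contMDiff_vectorSpace_iff_contDiff.2 contDiff_const
  have h1 : ContMDiff stModel (𝓘(ℝ, ℝ).tangent.prod (𝓡 3).tangent) ∞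
      (fun p : ℝ × S => ((⟨p.1, (1 : ℝ)⟩ : TangentBundle 𝓘(ℝ, ℝ) ℝ),
        (⟨p.2, 0⟩ : TangentBundle (𝓡 3) S))) :=
    (h0.comp contMDiff_fst).prodMk ((Bundle.contMDiff_zeroSection ℝ
      (TangentSpace (𝓡 3) : S → Type _)).comp contMDiff_snd)
  exact (contMDiff_equivTangentBundleProd_symm.comp h1).contMDiffOn

/-- Turns ∂_t into an ordinary derivative along t ↦ (t, x), so that ODE arguments apply at each
fixed point of S. -/
theorem hasDerivAt_dirD_dt {f : ℝ × S → ℝ} {p : ℝ × S}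
    (hf : MDifferentiableAt stModel 𝓘(ℝ, ℝ) f p) :
    HasDerivAt (fun t => f (t, p.2)) (dirD dt f p) p.1 := by
  have h1 : HasMFDerivAt 𝓘(ℝ, ℝ) stModel (fun t : ℝ => (t, p.2)) p.1
      ((ContinuousLinearMap.id ℝ (TangentSpace 𝓘(ℝ, ℝ) p.1)).prod
        (0 : TangentSpace 𝓘(ℝ, ℝ) p.1 →L[ℝ] TangentSpace (𝓡 3) p.2)) :=
    (hasMFDerivAt_id p.1).prodMk (hasMFDerivAt_const p.2 p.1)
  let L : ℝ →L[ℝ] ℝ := (mfderiv stModel 𝓘(ℝ, ℝ) f p).comp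
    ((ContinuousLinearMap.id ℝ (TangentSpace 𝓘(ℝ, ℝ) p.1)).prod
        (0 : TangentSpace 𝓘(ℝ, ℝ) p.1 →L[ℝ] TangentSpace (𝓡 3) p.2))
  have h2 : HasFDerivAt (fun t => f (t, p.2)) L p.1 :=
    hasMFDerivAt_iff_hasFDerivAt.1 (HasMFDerivAt.comp p.1 (g := f) hf.hasMFDerivAt h1)
  exact h2.hasDerivAt

theorem dirD_commutator {X Y : VField S} {U : Set (ℝ × S)} (hU : IsOpen U) (hX : SmoothVF X U)
    (hY : SmoothVF Y U) {f : ℝ × S → ℝ} (hf : ContMDiffOn stModel 𝓘(ℝ, ℝ) ∞ f U) {p : ℝ × S}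
    (hp : p ∈ U) :
    dirD (VectorField.mlieBracket stModel X Y) f p =
      dirD X (dirD Y f) p - dirD Y (dirD X f) p :=
  vderiv_mlieBracket (hf.contMDiffAt (hU.mem_nhds hp))
    ((hX.contMDiffAt (hU.mem_nhds hp)).mdifferentiableAt (by simp))
    ((hY.contMDiffAt (hU.mem_nhds hp)).mdifferentiableAt (by simp))

section rules
variable {X Y : VField S} {f g : ℝ × S → ℝ} {p : ℝ × S}

theorem dirD_eq_of_eventuallyEq (h : f =ᶠ[𝓝 p] g) : dirD X f p = dirD X g p := by
  rw [dirD, dirD, h.mfderiv_eq]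
  exact congrArg (fun L : (ℝ × EuclideanSpace ℝ (Fin 3)) →L[ℝ] ℝ => L (X p)) rfl

theorem dirD_congr {U : Set (ℝ × S)} (hU : IsOpen U) (hp : p ∈ U) (h : ∀ q ∈ U, f q = g q) :
    dirD X f p = dirD X g p :=
  dirD_eq_of_eventuallyEq (Filter.eventuallyEq_of_mem (hU.mem_nhds hp) h)

theorem dirD_const (c : ℝ) : dirD X (fun _ => c) p = 0 := by
  rw [dirD, mfderiv_const]; rfl

theorem dirD_add (hf : MDifferentiableAt stModel 𝓘(ℝ, ℝ) f p)
    (hg : MDifferentiableAt stModel 𝓘(ℝ, ℝ) g p) :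
    dirD X (fun q => f q + g q) p = dirD X f p + dirD X g p := by
  have h := (hf.hasMFDerivAt.add hg.hasMFDerivAt).mfderiv
  exact congrArg (fun L : (ℝ × EuclideanSpace ℝ (Fin 3)) →L[ℝ] ℝ => L (X p)) h

theorem dirD_mul (hf : MDifferentiableAt stModel 𝓘(ℝ, ℝ) f p)
    (hg : MDifferentiableAt stModel 𝓘(ℝ, ℝ) g p) :
    dirD X (fun q => f q * g q) p = f p * dirD X g p + g p * dirD X f p := by
  have h := (hf.hasMFDerivAt.mul hg.hasMFDerivAt).mfderiv
  exact congrArg (fun L : (ℝ × EuclideanSpace ℝ (Fin 3)) →L[ℝ] ℝ => L (X p)) h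

theorem dirD_comp {h : ℝ → ℝ} {h' : ℝ} (hh : HasDerivAt h h' (f p))
    (hf : MDifferentiableAt stModel 𝓘(ℝ, ℝ) f p) :
    dirD X (fun q => h (f q)) p = h' * dirD X f p := by
  have e := (HasMFDerivAt.comp p (g := h) hh.hasFDerivAt.hasMFDerivAt hf.hasMFDerivAt).mfderiv
  refine (congrArg (fun L : (ℝ × EuclideanSpace ℝ (Fin 3)) →L[ℝ] ℝ => L (X p)) e).trans ?_
  change dirD X f p • h' = _
  rw [smul_eq_mul, mul_comm]

theorem dirD_vf_smul (c : ℝ × S → ℝ) : dirD (fun q => c q • X q) f p = c p * dirD X f p :=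
  (mfderiv stModel 𝓘(ℝ, ℝ) f p).map_smul (c p) (X p)

theorem dirD_vf_sum {ι : Type*} (s : Finset ι) (c : ι → ℝ × S → ℝ) (Z : ι → VField S) :
    dirD (fun q => ∑ i ∈ s, c i q • Z i q) f p = ∑ i ∈ s, c i p * dirD (Z i) f p := by
  refine (map_sum (mfderiv stModel 𝓘(ℝ, ℝ) f p) _ s).trans ?_
  exact Finset.sum_congr rfl fun i _ => (mfderiv stModel 𝓘(ℝ, ℝ) f p).map_smul (c i p) (Z i p)

end rules
end
end EinsteinScalar

/-! ### Commutation relations of ∂_t, E_i and e_I -/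

namespace EinsteinScalar
section
variable {S : Type*} [TopologicalSpace S] [ChartedSpace (EuclideanSpace ℝ (Fin 3)) S]
  [IsManifold (𝓡 3) ∞ S]

theorem contMDiffOn_mdifferentiableAt {f : ℝ × S → ℝ} {U : Set (ℝ × S)} {p : ℝ × S}
    (hU : IsOpen U) (hf : ContMDiffOn stModel 𝓘(ℝ, ℝ) ∞ f U) (hp : p ∈ U) :
    MDifferentiableAt stModel 𝓘(ℝ, ℝ) f p :=
  (hf.contMDiffAt (hU.mem_nhds hp)).mdifferentiableAt (by simp)

theorem dirD_sum {X : VField S} {p : ℝ × S} {ι : Type*} (s : Finset ι) (f : ι → ℝ × S → ℝ)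
    (hf : ∀ i ∈ s, MDifferentiableAt stModel 𝓘(ℝ, ℝ) (f i) p) :
    dirD X (fun q => ∑ i ∈ s, f i q) p = ∑ i ∈ s, dirD X (f i) p := by
  suffices h : MDifferentiableAt stModel 𝓘(ℝ, ℝ) (fun q => ∑ i ∈ s, f i q) p ∧
      dirD X (fun q => ∑ i ∈ s, f i q) p = ∑ i ∈ s, dirD X (f i) p from h.2
  classical
  induction s using Finset.induction_on with
  | empty => exact ⟨by simpa using mdifferentiableAt_const, by simpa using dirD_const 0⟩
  | insert i s hi ih =>
    have h1 := hf i (Finset.mem_insert_self i s)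
    obtain ⟨h2, h3⟩ := ih fun j hj => hf j (Finset.mem_insert_of_mem hj)
    simp only [Finset.sum_insert hi]
    exact ⟨h1.add h2, by rw [dirD_add h1 h2, h3]⟩

theorem vfield_eq {p : ℝ × S} {v w : TangentSpace stModel p} (h1 : v.1 = w.1) (h2 : v.2 = w.2) :
    v = w := Prod.ext h1 h2

theorem dirD_snd_comp {X : VField S} {h : S → ℝ} {p : ℝ × S}
    (hh : MDifferentiableAt (𝓡 3) 𝓘(ℝ, ℝ) h p.2) :
    dirD X (fun q => h q.2) p = mfderiv (𝓡 3) 𝓘(ℝ, ℝ) h p.2 (X p).2 := by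
  have e := (HasMFDerivAt.comp p (g := h) hh.hasMFDerivAt
    (hasMFDerivAt_snd (I := 𝓘(ℝ, ℝ)) (I' := 𝓡 3) p)).mfderiv
  exact congrArg (fun L : (ℝ × EuclideanSpace ℝ (Fin 3)) →L[ℝ] ℝ => L (X p)) e

theorem mlieBracket_fst_eq_zero {X Y : VField S} {U : Set (ℝ × S)} (hU : IsOpen U)
    (hX : SmoothVF X U) (hY : SmoothVF Y U) {p : ℝ × S} (hp : p ∈ U) {c d : ℝ}
    (hX1 : ∀ q ∈ U, (X q).1 = c) (hY1 : ∀ q ∈ U, (Y q).1 = d) :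
    (VectorField.mlieBracket stModel X Y p).1 = 0 := by
  rw [← dirD_fst (VectorField.mlieBracket stModel X Y) p,
    dirD_commutator hU hX hY contMDiff_fst.contMDiffOn hp,
    dirD_congr (g := fun _ => d) hU hp (fun q hq => (dirD_fst Y q).trans (hY1 q hq)),
    dirD_congr (X := Y) (g := fun _ => c) hU hp (fun q hq => (dirD_fst X q).trans (hX1 q hq)),
    dirD_const, dirD_const, sub_zero]

theorem mlieBracket_vf (E : RefFrame S) (i j : Fin 3) (p : ℝ × S) :
    VectorField.mlieBracket stModel (E.vf i) (E.vf j) p = ∑ k, E.struc i j k p • E.vf k p := by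
  apply vfield_eq
  · rw [mlieBracket_fst_eq_zero isOpen_univ (smoothVF_vf E i univ) (smoothVF_vf E j univ)
      (mem_univ p) (c := 0) (d := 0) (fun _ _ => rfl) (fun _ _ => rfl)]
    symm
    refine (Prod.fst_sum).trans ?_
    refine Finset.sum_eq_zero fun k _ => ?_
    exact mul_zero _
  · refine Eq.trans ?_ (Prod.snd_sum).symm
    rw [← mfderiv_snd_apply]
    exact ((E.basis p.2).sum_repr _).symm

/-- The time components of both fields are constant, which kills that of the bracket. The spatial
component is tested on functions f of S alone: E_i f does not depend on t, and ∂_t f vanishes. -/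
theorem mlieBracket_dt_vf (E : RefFrame S) (i : Fin 3) (p : ℝ × S) :
    VectorField.mlieBracket stModel dt (E.vf i) p = 0 := by
  apply vfield_eq
  · exact mlieBracket_fst_eq_zero isOpen_univ (smoothVF_dt univ) (smoothVF_vf E i univ)
      (mem_univ p) (c := 1) (d := 0) (fun _ _ => rfl) (fun _ _ => rfl)
  · refine tangent_eq_of_forall_mfderiv_eq (I := 𝓡 3) (M := S) (p := p.2) fun f U hU hp hf => ?_
    have hfd : ∀ x ∈ U, MDifferentiableAt (𝓡 3) 𝓘(ℝ, ℝ) f x := fun x hx =>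
      (hf.contMDiffAt (hU.mem_nhds hx)).mdifferentiableAt (by simp)
    set W : Set (ℝ × S) := Prod.snd ⁻¹' U with hW
    have hWo : IsOpen W := hU.preimage continuous_snd
    have hF : ContMDiffOn stModel 𝓘(ℝ, ℝ) ∞ (fun q : ℝ × S => f q.2) W :=
      hf.comp contMDiffOn_snd fun q hq => hq
    rw [← dirD_snd_comp (X := VectorField.mlieBracket stModel dt (E.vf i)) (hfd _ hp),
      dirD_commutator hWo (smoothVF_dt W) (smoothVF_vf E i W) hF hp,
      dirD_congr (X := E.vf i) (g := fun _ => 0) hWo hp (fun q hq => ?_), dirD_const, sub_zero]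
    · have h1 := hasDerivAt_dirD_dt (contMDiffOn_mdifferentiableAt hWo
        ((smoothVF_vf E i W).dirD hWo hF) hp)
      have h2 : (fun t : ℝ => dirD (E.vf i) (fun q => f q.2) (t, p.2)) = fun _ =>
          (mfderiv (𝓡 3) 𝓘(ℝ, ℝ) f p.2 (E.basis p.2 i) : ℝ) := by
        ext t
        exact dirD_snd_comp (p := (t, p.2)) (hfd _ hp)
      rw [h2] at h1
      rw [h1.unique (hasDerivAt_const _ _)]
      exact ((mfderiv (𝓡 3) 𝓘(ℝ, ℝ) f p.2).map_zero).symm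
    · rw [dirD_snd_comp (hfd _ hq)]
      exact (mfderiv (𝓡 3) 𝓘(ℝ, ℝ) f q.2).map_zero

theorem dirD_dt_vf_comm (E : RefFrame S) (i : Fin 3) {U : Set (ℝ × S)} (hU : IsOpen U)
    {f : ℝ × S → ℝ} (hf : ContMDiffOn stModel 𝓘(ℝ, ℝ) ∞ f U) {p : ℝ × S} (hp : p ∈ U) :
    dirD dt (dirD (E.vf i) f) p = dirD (E.vf i) (dirD dt f) p := by
  have h := dirD_commutator hU (smoothVF_dt U) (smoothVF_vf E i U) hf hp
  rw [dirD, mlieBracket_dt_vf] at h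
  have h0 : (mfderiv stModel 𝓘(ℝ, ℝ) f p 0 : ℝ) = 0 := map_zero _
  exact (sub_eq_zero.1 (h.symm.trans h0))

theorem dirD_vf_comm (E : RefFrame S) (i j : Fin 3) {U : Set (ℝ × S)} (hU : IsOpen U)
    {f : ℝ × S → ℝ} (hf : ContMDiffOn stModel 𝓘(ℝ, ℝ) ∞ f U) {p : ℝ × S} (hp : p ∈ U) :
    dirD (E.vf i) (dirD (E.vf j) f) p - dirD (E.vf j) (dirD (E.vf i) f) p =
      ∑ k, E.struc i j k p * dirD (E.vf k) f p := by
  rw [← dirD_commutator hU (smoothVF_vf E i U) (smoothVF_vf E j U) hf hp, ← dirD_vf_sum, dirD,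
    mlieBracket_vf]
  rfl

variable (E : RefFrame S) (u : Unknowns S)

theorem dirD_eS (I : Fin 3) (f : ℝ × S → ℝ) (p : ℝ × S) :
    dirD (eS E u I) f p = ∑ i, u.e I i p * dirD (E.vf i) f p :=
  dirD_vf_sum _ _ _

theorem dirD_e0 (f : ℝ × S → ℝ) (p : ℝ × S) :
    dirD (e0 u) f p = (u.N p)⁻¹ * dirD dt f p :=
  dirD_vf_smul _

variable {E u}

theorem smoothVF_eS {U : Set (ℝ × S)} (h : ∀ I i, ContMDiffOn stModel 𝓘(ℝ, ℝ) ∞ (u.e I i) U)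
    (I : Fin 3) : SmoothVF (eS E u I) U :=
  ContMDiffOn.sum_section fun i _ => (h I i).smul_section (smoothVF_vf E i U)

theorem smoothVF_e0 {U : Set (ℝ × S)} (h : ContMDiffOn stModel 𝓘(ℝ, ℝ) ∞ u.N U)
    (h0 : ∀ p ∈ U, u.N p ≠ 0) : SmoothVF (e0 u) U :=
  ContMDiffOn.smul_section (h.inv₀ h0) (smoothVF_dt U)

theorem dirD_eS_comm {U : Set (ℝ × S)} (hU : IsOpen U)
    (h : ∀ I i, ContMDiffOn stModel 𝓘(ℝ, ℝ) ∞ (u.e I i) U) (I J : Fin 3)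
    {f : ℝ × S → ℝ} (hf : ContMDiffOn stModel 𝓘(ℝ, ℝ) ∞ f U) {p : ℝ × S} (hp : p ∈ U) :
    dirD (eS E u I) (dirD (eS E u J) f) p - dirD (eS E u J) (dirD (eS E u I) f) p =
      ∑ k, (dirD (eS E u I) (u.e J k) p - dirD (eS E u J) (u.e I k) p
        + ∑ i, ∑ j, u.e I i p * u.e J j p * E.struc i j k p) * dirD (E.vf k) f p := by
  have hd : ∀ k, ContMDiffOn stModel 𝓘(ℝ, ℝ) ∞ (dirD (E.vf k) f) U := fun k =>
    (smoothVF_vf E k U).dirD hU hf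
  have key : ∀ I J, dirD (eS E u I) (dirD (eS E u J) f) p = ∑ k,
      (dirD (eS E u I) (u.e J k) p * dirD (E.vf k) f p +
        ∑ i, u.e I i p * u.e J k p * dirD (E.vf i) (dirD (E.vf k) f) p) := by
    intro I J
    rw [funext (dirD_eS E u J f), dirD_sum]
    · refine Finset.sum_congr rfl fun k _ => ?_
      rw [dirD_mul (contMDiffOn_mdifferentiableAt hU (h J k) hp)
        (contMDiffOn_mdifferentiableAt hU (hd k) hp), dirD_eS E u I (dirD (E.vf k) f),
        Finset.mul_sum, add_comm]
      congr 1
      · ring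
      · exact Finset.sum_congr rfl fun i _ => by ring
    · exact fun k _ => contMDiffOn_mdifferentiableAt hU ((h J k).mul (hd k)) hp
  have hc := fun i j => dirD_vf_comm E i j hU hf hp
  rw [key I J, key J I]
  simp only [Fin.sum_univ_three] at hc ⊢
  linear_combination u.e I 0 p * u.e J 0 p * hc 0 0 + u.e I 0 p * u.e J 1 p * hc 0 1
    + u.e I 0 p * u.e J 2 p * hc 0 2 + u.e I 1 p * u.e J 0 p * hc 1 0
    + u.e I 1 p * u.e J 1 p * hc 1 1 + u.e I 1 p * u.e J 2 p * hc 1 2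
    + u.e I 2 p * u.e J 0 p * hc 2 0 + u.e I 2 p * u.e J 1 p * hc 2 1
    + u.e I 2 p * u.e J 2 p * hc 2 2

/-- The action on local functions, known from `dirD_eS_comm`, determines the bracket as a tangent
vector. -/
theorem mlieBracket_eS {U : Set (ℝ × S)} (hU : IsOpen U)
    (h : ∀ I i, ContMDiffOn stModel 𝓘(ℝ, ℝ) ∞ (u.e I i) U) (I J : Fin 3)
    {p : ℝ × S} (hp : p ∈ U) :
    VectorField.mlieBracket stModel (eS E u I) (eS E u J) p =
      ∑ k, (dirD (eS E u I) (u.e J k) p - dirD (eS E u J) (u.e I k) p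
        + ∑ i, ∑ j, u.e I i p * u.e J j p * E.struc i j k p) • E.vf k p := by
  refine tangent_eq_of_forall_mfderiv_eq (I := stModel) fun f W hW hpW hf => ?_
  have hUW := hU.inter hW
  have e1 := dirD_commutator (X := eS E u I) (Y := eS E u J) hUW
    (smoothVF_eS (fun I i => (h I i).mono inter_subset_left) I)
    (smoothVF_eS (fun I i => (h I i).mono inter_subset_left) J)
    (hf.mono inter_subset_right) ⟨hp, hpW⟩
  rw [dirD_eS_comm hUW (fun I i => (h I i).mono inter_subset_left) I J
    (hf.mono inter_subset_right) ⟨hp, hpW⟩] at e1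
  refine e1.trans ?_
  exact (dirD_vf_sum (f := f) (p := p) Finset.univ (fun k _ => dirD (eS E u I) (u.e J k) p -
    dirD (eS E u J) (u.e I k) p + ∑ i, ∑ j, u.e I i p * u.e J j p * E.struc i j k p) E.vf).symm

end
end EinsteinScalar

/-! ### Uniqueness for linear ODEs and propagation of the algebraic conditions -/

theorem eq_zero_of_norm_deriv_le {F : Type*} [NormedAddCommGroup F] [NormedSpace ℝ F]
    {f f' : ℝ → F} {K a b t₀ : ℝ} (ht₀ : t₀ ∈ Icc a b)
    (hf : ∀ t ∈ Icc a b, HasDerivAt f (f' t) t) (h0 : f t₀ = 0)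
    (bound : ∀ t ∈ Icc a b, ‖f' t‖ ≤ K * ‖f t‖) : ∀ t ∈ Icc a b, f t = 0 := by
  intro t ht
  rcases le_total t₀ t with h | h
  · refine eq_zero_of_abs_deriv_le_mul_abs_self_of_eq_zero_right (f := f) (f' := f') (K := K)
      (a := t₀) (b := t) (fun s hs => ?_) (fun s hs => ?_) h0 (fun s hs => ?_) t ⟨h, le_rfl⟩
    · exact (hf s ⟨ht₀.1.trans hs.1, hs.2.trans ht.2⟩).continuousAt.continuousWithinAt
    · exact (hf s ⟨ht₀.1.trans hs.1, hs.2.le.trans ht.2⟩).hasDerivWithinAt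
    · exact bound s ⟨ht₀.1.trans hs.1, hs.2.le.trans ht.2⟩
  -- Times before t₀ are reduced to the forward Grönwall estimate by the reflection s ↦ -s.
  · have hm : ∀ s ∈ Icc (-t₀) (-t), -s ∈ Icc a b := fun s hs =>
      ⟨ht.1.trans (by linarith [hs.2]), le_trans (by linarith [hs.1]) ht₀.2⟩
    have hd : ∀ s ∈ Icc (-t₀) (-t), HasDerivAt (fun s => f (-s)) (-f' (-s)) s := fun s hs => by
      simpa using! (hf (-s) (hm s hs)).scomp s (hasDerivAt_neg s)
    have := eq_zero_of_abs_deriv_le_mul_abs_self_of_eq_zero_right (f := fun s => f (-s))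
      (f' := fun s => -f' (-s)) (K := K) (a := -t₀) (b := -t)
      (fun s hs => (hd s hs).continuousAt.continuousWithinAt)
      (fun s hs => (hd s (Ico_subset_Icc_self hs)).hasDerivWithinAt) (by simpa using h0)
      (fun s hs => by simpa using bound (-s) (hm s (Ico_subset_Icc_self hs))) (-t)
      ⟨by linarith, le_rfl⟩
    simpa using this

namespace EinsteinScalar
section
variable {S : Type*} [TopologicalSpace S] [ChartedSpace (EuclideanSpace ℝ (Fin 3)) S]
  [IsManifold (𝓡 3) ∞ S] {T δ : ℝ}

theorem isOpen_slab : IsOpen (slab S T δ) := isOpen_Ioo.prod isOpen_univ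

theorem SmoothOn.mdiff {f : ℝ × S → ℝ} (hf : SmoothOn T δ f) {p : ℝ × S} (hp : p ∈ slab S T δ) :
    MDifferentiableAt stModel 𝓘(ℝ, ℝ) f p := contMDiffOn_mdifferentiableAt isOpen_slab hf hp

theorem SmoothOn.continuousOn_line {f : ℝ × S → ℝ} (hf : SmoothOn T δ f) (x : S) :
    ContinuousOn (fun t => f (t, x)) (Ioo (T - δ) (T + δ)) :=
  hf.continuousOn.comp (by fun_prop) fun t ht => ⟨ht, mem_univ _⟩

/-- Solutions of a homogeneous linear system of ODEs along `∂_t` that vanish at one time vanish. -/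
theorem eq_zero_of_dirD_dt_linear {ι : Type*} [Fintype ι] {f : ι → ℝ × S → ℝ}
    {c : ι → ι → ℝ × S → ℝ} (hf : ∀ i, SmoothOn T δ (f i)) (hc : ∀ i j, SmoothOn T δ (c i j))
    (x : S) (h : ∀ t ∈ Ioo (T - δ) (T + δ), ∀ i,
      dirD dt (f i) (t, x) = ∑ j, c i j (t, x) * f j (t, x))
    {t₀ : ℝ} (ht₀ : t₀ ∈ Ioo (T - δ) (T + δ)) (h0 : ∀ i, f i (t₀, x) = 0)
    {t : ℝ} (ht : t ∈ Ioo (T - δ) (T + δ)) (i : ι) : f i (t, x) = 0 := by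
  set y : ℝ → ι → ℝ := fun s i => f i (s, x) with hy
  set y' : ℝ → ι → ℝ := fun s i => ∑ j, c i j (s, x) * f j (s, x) with hy'
  have hsub : Icc (min t₀ t) (max t₀ t) ⊆ Ioo (T - δ) (T + δ) := fun s hs =>
    ⟨(lt_min ht₀.1 ht.1).trans_le hs.1, hs.2.trans_lt (max_lt ht₀.2 ht.2)⟩
  -- The sum of the absolute values of all coefficients dominates the matrix in the sup norm, and it
  -- is bounded on the compact interval between the two times.
  have hcont : ContinuousOn (fun s => ∑ i, ∑ j, |c i j (s, x)|) (Icc (min t₀ t) (max t₀ t)) :=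
    continuousOn_finsetSum _ fun i _ => continuousOn_finsetSum _ fun j _ =>
      (((hc i j).continuousOn_line x).mono hsub).abs
  obtain ⟨K, hK⟩ := isCompact_Icc.exists_bound_of_continuousOn hcont
  have key := eq_zero_of_norm_deriv_le (f := y) (f' := y') (K := K) (t₀ := t₀)
    ⟨min_le_left t₀ t, le_max_left t₀ t⟩ (fun s hs => ?_) (funext h0) (fun s hs => ?_) t
    ⟨min_le_right t₀ t, le_max_right t₀ t⟩
  · exact congrFun key i
  · refine hasDerivAt_pi.2 fun i => ?_
    have := hasDerivAt_dirD_dt ((hf i).mdiff (p := (s, x)) ⟨hsub hs, mem_univ _⟩)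
    rwa [h s (hsub hs) i] at this
  · have hKs := hK s hs
    have hnn : ∀ i, 0 ≤ ∑ j, |c i j (s, x)| := fun i => Finset.sum_nonneg fun j _ => abs_nonneg _
    rw [Real.norm_of_nonneg (Finset.sum_nonneg fun i _ => hnn i)] at hKs
    have hK0 : 0 ≤ K := (Finset.sum_nonneg fun i _ => hnn i).trans hKs
    refine (pi_norm_le_iff_of_nonneg (mul_nonneg hK0 (norm_nonneg _))).2 fun i => ?_
    calc ‖y' s i‖ ≤ ∑ j, ‖c i j (s, x) * f j (s, x)‖ := norm_sum_le _ _
      _ ≤ ∑ j, |c i j (s, x)| * ‖y s‖ := Finset.sum_le_sum fun j _ => by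
          rw [norm_mul, Real.norm_eq_abs]
          exact mul_le_mul_of_nonneg_left (norm_le_pi_norm (y s) j) (abs_nonneg _)
      _ = (∑ j, |c i j (s, x)|) * ‖y s‖ := (Finset.sum_mul _ _ _).symm
      _ ≤ K * ‖y s‖ := mul_le_mul_of_nonneg_right
          ((Finset.single_le_sum (fun i _ => hnn i) (Finset.mem_univ i)).trans hKs) (norm_nonneg _)

theorem SmoothOn.const (c : ℝ) : SmoothOn (S := S) T δ (fun _ => c) := contMDiffOn_const

theorem SmoothOn.dirD_vf {f : ℝ × S → ℝ} (hf : SmoothOn T δ f) (E : RefFrame S) (i : Fin 3) :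
    SmoothOn T δ (dirD (E.vf i) f) := (smoothVF_vf E i _).dirD isOpen_slab hf

theorem SmoothOn.dirD_dt {f : ℝ × S → ℝ} (hf : SmoothOn T δ f) :
    SmoothOn T δ (dirD dt f) := (smoothVF_dt _).dirD isOpen_slab hf

theorem SmoothOn.add {f g : ℝ × S → ℝ} (hf : SmoothOn T δ f) (hg : SmoothOn T δ g) :
    SmoothOn T δ (fun p => f p + g p) := ContMDiffOn.add hf hg

theorem SmoothOn.sub {f g : ℝ × S → ℝ} (hf : SmoothOn T δ f) (hg : SmoothOn T δ g) :
    SmoothOn T δ (fun p => f p - g p) := ContMDiffOn.sub hf hg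

theorem SmoothOn.mul {f g : ℝ × S → ℝ} (hf : SmoothOn T δ f) (hg : SmoothOn T δ g) :
    SmoothOn T δ (fun p => f p * g p) := ContMDiffOn.mul hf hg

theorem SmoothOn.div_const {f : ℝ × S → ℝ} (hf : SmoothOn T δ f) (c : ℝ) :
    SmoothOn T δ (fun p => f p / c) := by
  simpa only [div_eq_mul_inv] using hf.mul (SmoothOn.const c⁻¹)

variable {E : RefFrame S} {u : Unknowns S} {a ρ : ℝ} {V : ℝ → ℝ}

theorem eq_zero_of_dirD_dt_scalar {f c : ℝ × S → ℝ} (hf : SmoothOn T δ f) (hc : SmoothOn T δ c)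
    (h : ∀ p ∈ slab S T δ, dirD dt f p = c p * f p) {x : S}
    {t₀ : ℝ} (ht₀ : t₀ ∈ Ioo (T - δ) (T + δ)) (h0 : f (t₀, x) = 0)
    {t : ℝ} (ht : t ∈ Ioo (T - δ) (T + δ)) : f (t, x) = 0 :=
  eq_zero_of_dirD_dt_linear (ι := Unit) (f := fun _ => f) (c := fun _ _ => c) (fun _ => hf)
    (fun _ _ => hc) x (fun t ht _ => by simpa using h (t, x) ⟨ht, mem_univ _⟩) ht₀ (fun _ => h0) ht ()

theorem SmoothOn.sum {ι : Type*} {s : Finset ι} {f : ι → ℝ × S → ℝ}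
    (h : ∀ i ∈ s, SmoothOn T δ (f i)) : SmoothOn T δ (fun p => ∑ i ∈ s, f i p) :=
  contMDiffOn_finsetSum h

theorem mem_Ioo_center (hδ : 0 < δ) : T ∈ Ioo (T - δ) (T + δ) := ⟨by linarith, by linarith⟩

theorem slab_time_pos (hT : δ ≤ T) {p : ℝ × S} (hp : p ∈ slab S T δ) : 0 < p.1 := by
  have := hp.1.1; linarith

theorem smoothOn_inv_time (hT : δ ≤ T) : SmoothOn (S := S) T δ (fun p => p.1⁻¹) :=
  contMDiff_fst.contMDiffOn.inv₀ fun _ hp => (slab_time_pos hT hp).ne'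

namespace IsModifiedSolution

theorem smooth_k (hu : IsModifiedSolution E u a ρ V T δ) (I J : Fin 3) :
    SmoothOn T δ (u.k I J) :=
  (hu.smooth_shear I J).add ((SmoothOn.div_const hu.smooth_theta 3).mul (SmoothOn.const _))

/-- The lapse equation is linear and homogeneous in N, so a zero at any time would force N to vanish
at t = T. By the intermediate value theorem N cannot change sign either. -/
theorem lapse_pos (hu : IsModifiedSolution E u a ρ V T δ) (hd : HasAdmissibleData E u T)
    (hδ : 0 < δ) (hT : δ ≤ T) {p : ℝ × S} (hp : p ∈ slab S T δ) : 0 < u.N p := by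
  have hc : SmoothOn T δ (fun p : ℝ × S => (a + 1) * (u.N p * u.theta p - p.1⁻¹)) :=
    (SmoothOn.const _).mul ((hu.smooth_N.mul hu.smooth_theta).sub (smoothOn_inv_time hT))
  have hne : ∀ t ∈ Ioo (T - δ) (T + δ), u.N (t, p.2) ≠ 0 := fun t ht h0 =>
    (hd.lapse_pos p.2).ne' (eq_zero_of_dirD_dt_scalar hu.smooth_N hc
      (fun q hq => by rw [hu.eq_N q hq]; simp only [one_div]) ht h0 (mem_Ioo_center hδ))
  by_contra hneg
  have hcont := hu.smooth_N.continuousOn_line p.2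
  have := isPreconnected_Ioo.intermediate_value (a := p.1) (b := T) hp.1 (mem_Ioo_center hδ) hcont
  obtain ⟨t, ht, h0⟩ := this (show (0 : ℝ) ∈ Icc (u.N (p.1, p.2)) (u.N (T, p.2)) from
    ⟨not_lt.1 hneg, (hd.lapse_pos p.2).le⟩)
  exact hne t ht h0

/-- Every term except -NθΣ_IJ is a trace-free symmetrization. The antisymmetric part, and likewise
the trace, therefore satisfies f' = -Nθ f. -/
theorem shear_symm (hu : IsModifiedSolution E u a ρ V T δ) (hd : HasAdmissibleData E u T)
    (hδ : 0 < δ) {p : ℝ × S} (hp : p ∈ slab S T δ) (I J : Fin 3) :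
    u.shear I J p = u.shear J I p := by
  have hc : SmoothOn T δ (fun p : ℝ × S => -1 * (u.N p * u.theta p)) :=
    (SmoothOn.const (-1)).mul (hu.smooth_N.mul hu.smooth_theta)
  have key := eq_zero_of_dirD_dt_scalar (f := fun p => u.shear I J p + -1 * u.shear J I p)
    ((hu.smooth_shear I J).add ((SmoothOn.const (-1)).mul (hu.smooth_shear J I))) hc (fun q hq => by
      rw [dirD_add ((hu.smooth_shear I J).mdiff hq)
        (((SmoothOn.const (-1)).mul (hu.smooth_shear J I)).mdiff hq),
        dirD_mul ((SmoothOn.const _).mdiff hq) ((hu.smooth_shear J I).mdiff hq), dirD_const,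
        hu.eq_shear q hq I J, hu.eq_shear q hq J I]
      simp only [tfs, kd, eq_comm (a := J) (b := I)]
      ring) (x := p.2) (mem_Ioo_center hδ) (by simp only [hd.shear_symm p.2 I J]; ring) hp.1
  linarith [key]

theorem shear_trace (hu : IsModifiedSolution E u a ρ V T δ) (hd : HasAdmissibleData E u T)
    (hδ : 0 < δ) {p : ℝ × S} (hp : p ∈ slab S T δ) : ∑ I, u.shear I I p = 0 := by
  have hc : SmoothOn T δ (fun p : ℝ × S => -1 * (u.N p * u.theta p)) :=
    (SmoothOn.const (-1)).mul (hu.smooth_N.mul hu.smooth_theta)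
  exact eq_zero_of_dirD_dt_scalar (f := fun p => ∑ I, u.shear I I p)
    (SmoothOn.sum fun I _ => hu.smooth_shear I I) hc (fun q hq => by
      rw [dirD_sum _ _ fun I _ => (hu.smooth_shear I I).mdiff hq]
      simp only [hu.eq_shear q hq, tfs, Fin.sum_univ_three, kd, if_true]
      ring) (x := p.2) (mem_Ioo_center hδ) (hd.shear_trace p.2) hp.1

/-- Apart from -N k_IL Γ_LJK, the right-hand side is antisymmetric in J and K. The symmetric part
thus solves a closed linear system in the index I. -/
theorem Gam_antisymm (hu : IsModifiedSolution E u a ρ V T δ) (hd : HasAdmissibleData E u T)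
    (hδ : 0 < δ) {p : ℝ × S} (hp : p ∈ slab S T δ) (I J K : Fin 3) :
    u.Gam I J K p = -u.Gam I K J p := by
  have key := eq_zero_of_dirD_dt_linear (f := fun I p => u.Gam I J K p + u.Gam I K J p)
    (c := fun I L p => -1 * (u.N p * u.k I L p))
    (fun I => (hu.smooth_Gam I J K).add (hu.smooth_Gam I K J))
    (fun I L => (SmoothOn.const (-1)).mul (hu.smooth_N.mul (hu.smooth_k I L))) p.2
    (fun t ht I => by
      have hq : (t, p.2) ∈ slab S T δ := ⟨ht, mem_univ _⟩
      rw [dirD_add ((hu.smooth_Gam I J K).mdiff hq) ((hu.smooth_Gam I K J).mdiff hq),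
        hu.eq_Gam _ hq I J K, hu.eq_Gam _ hq I K J]
      simp only [Fin.sum_univ_three]
      ring) (mem_Ioo_center hδ) (fun I => by rw [hd.Gam_antisymm p.2 I J K]; ring) hp.1 I
  exact eq_neg_of_add_eq_zero_left key

theorem k_symm (hu : IsModifiedSolution E u a ρ V T δ) (hd : HasAdmissibleData E u T)
    (hδ : 0 < δ) {p : ℝ × S} (hp : p ∈ slab S T δ) (I J : Fin 3) :
    u.k I J p = u.k J I p := by
  simp only [Unknowns.k, hu.shear_symm hd hδ hp I J, kd, eq_comm (a := J) (b := I)]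

/-- The pairing of e_I with ω^J obeys a linear system for which δ_IJ is stationary, because k is
symmetric. The difference from δ_IJ then solves the same homogeneous system. -/
theorem dual (hu : IsModifiedSolution E u a ρ V T δ) (hd : HasAdmissibleData E u T)
    (hδ : 0 < δ) {p : ℝ × S} (hp : p ∈ slab S T δ) (I J : Fin 3) :
    ∑ i, u.e I i p * u.om J i p = kd I J := by
  have key := eq_zero_of_dirD_dt_linear (ι := Fin 3 × Fin 3)
    (f := fun X p => ∑ i, u.e X.1 i p * u.om X.2 i p + -kd X.1 X.2)
    (c := fun X Y p => -1 * (u.N p * u.k X.1 Y.1 p) * kd Y.2 X.2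
      + u.N p * u.k X.2 Y.2 p * kd Y.1 X.1)
    (fun X => (SmoothOn.sum fun i _ => (hu.smooth_e X.1 i).mul (hu.smooth_om X.2 i)).add
      (SmoothOn.const _))
    (fun X Y => (((SmoothOn.const (-1)).mul (hu.smooth_N.mul (hu.smooth_k X.1 Y.1))).mul
      (SmoothOn.const _)).add ((hu.smooth_N.mul (hu.smooth_k X.2 Y.2)).mul (SmoothOn.const _))) p.2
    (fun t ht X => by
      have hq : (t, p.2) ∈ slab S T δ := ⟨ht, mem_univ _⟩
      obtain ⟨I, J⟩ := X
      dsimp only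
      rw [dirD_add ((SmoothOn.sum fun i _ => (hu.smooth_e I i).mul (hu.smooth_om J i)).mdiff hq)
        ((SmoothOn.const _).mdiff hq), dirD_const,
        dirD_sum _ _ fun i _ => ((hu.smooth_e I i).mul (hu.smooth_om J i)).mdiff hq]
      simp only [fun i => dirD_mul (X := dt) ((hu.smooth_e I i).mdiff hq)
        ((hu.smooth_om J i).mdiff hq), hu.eq_e _ hq, hu.eq_om _ hq, Fintype.sum_prod_type]
      have hk := hu.k_symm hd hδ hq
      fin_cases I <;> fin_cases J <;> simp [Fin.sum_univ_three, kd, hk 1 0, hk 2 0, hk 2 1] <;> ring)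
    (mem_Ioo_center hδ) (fun X => by rw [hd.dual p.2]; ring) hp.1 (I, J)
  linarith [key]

/-- Since ∂_t commutes with E_i, the function e_I φ satisfies the same equation as φ_I, so the
difference solves f_I' = -N k_IJ f_J. -/
theorem dphi_eq (hu : IsModifiedSolution E u a ρ V T δ) (hd : HasAdmissibleData E u T)
    (hδ : 0 < δ) {p : ℝ × S} (hp : p ∈ slab S T δ) (I : Fin 3) :
    u.dphi I p = dirD (eS E u I) u.phi p := by
  have hs : ∀ I, SmoothOn T δ (fun q => ∑ i, u.e I i q * dirD (E.vf i) u.phi q) := fun I =>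
    SmoothOn.sum fun i _ => (hu.smooth_e I i).mul (hu.smooth_phi.dirD_vf E i)
  have key := eq_zero_of_dirD_dt_linear
    (f := fun I p => u.dphi I p + -1 * ∑ i, u.e I i p * dirD (E.vf i) u.phi p)
    (c := fun I J p => -1 * (u.N p * u.k I J p))
    (fun I => (hu.smooth_dphi I).add ((SmoothOn.const (-1)).mul (hs I)))
    (fun I J => (SmoothOn.const (-1)).mul (hu.smooth_N.mul (hu.smooth_k I J))) p.2
    (fun t ht I => by
      have hq : (t, p.2) ∈ slab S T δ := ⟨ht, mem_univ _⟩
      rw [dirD_add ((hu.smooth_dphi I).mdiff hq) (((SmoothOn.const (-1)).mul (hs I)).mdiff hq),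
        dirD_mul ((SmoothOn.const _).mdiff hq) ((hs I).mdiff hq), dirD_const,
        dirD_sum _ _ fun i _ => ((hu.smooth_e I i).mul (hu.smooth_phi.dirD_vf E i)).mdiff hq]
      simp only [fun i => dirD_mul (X := dt) ((hu.smooth_e I i).mdiff hq)
        ((hu.smooth_phi.dirD_vf E i).mdiff hq), hu.eq_e _ hq, hu.eq_dphi _ hq,
        fun i => dirD_dt_vf_comm E i isOpen_slab hu.smooth_phi hq,
        fun i => dirD_congr (X := E.vf i) isOpen_slab hq hu.eq_phi, dirD_eS, Fin.sum_univ_three]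
      ring)
    (mem_Ioo_center hδ) (fun I => by rw [hd.dphi_eq p.2, dirD_eS]; ring) hp.1 I
  rw [dirD_eS]
  linarith [key]

end IsModifiedSolution
end
end EinsteinScalar

/-! ### Exterior calculus and curvature for prescribed structure functions -/

namespace FrameCalculus
section
variable {A : Type*} [CommRing A] [Algebra ℝ A] (D : Fin 4 → Derivation ℝ A A)
  (F : Fin 4 → Fin 4 → Fin 4 → A)

/-- Defect of the commutation relation `[D_α, D_β] = F_{αβ}^λ D_λ`. -/
def commDefect (α β : Fin 4) (x : A) : A :=
  D α (D β x) - D β (D α x) - ∑ l, F α β l * D l x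

/-- Exterior derivative of a one form with respect to the structure functions `F`. -/
def extD1 (w : Fin 4 → A) (α β : Fin 4) : A :=
  D α (w β) - D β (w α) - ∑ l, F α β l * w l

/-- Exterior derivative of a two form with respect to the structure functions `F`. -/
def extD2 (G : Fin 4 → Fin 4 → A) (α β γ : Fin 4) : A :=
  D α (G β γ) + D β (G γ α) + D γ (G α β)
    - ∑ l, (F α β l * G l γ + F β γ l * G l α + F γ α l * G l β)

/-- d² is not zero, because the functions F need not be the structure functions of the derivations.
The obstruction consists of the commutation defect on the components and the Jacobi defect of F,
viewed as two forms labelled by the upper index. -/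
theorem extD2_extD1 (w : Fin 4 → A) (α β γ : Fin 4) :
    extD2 D F (extD1 D F w) α β γ =
      commDefect D F α β (w γ) + commDefect D F β γ (w α) + commDefect D F γ α (w β)
        - ∑ l, extD2 D F (fun α β => F α β l) α β γ * w l := by
  simp only [extD2, extD1, commDefect, Fin.sum_univ_four, map_sub, map_add, Derivation.leibniz,
    smul_eq_mul]
  ring

theorem eq_zero_of_eq_neg {x : A} (h : x = -x) : x = 0 := by
  have h2 : (2 : ℝ) • x = 0 := by rw [two_smul]; nth_rewrite 2 [h]; exact add_neg_cancel x
  exact (smul_eq_zero.1 h2).resolve_left two_ne_zero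

set_option maxRecDepth 4000 in
-- The analogue of d² = 0 for two forms, with the same two kinds of error. Applied to the structure
-- functions themselves, it differentiates the Jacobi identity.
theorem extD2_closed (hF : ∀ α β l, F α β l = -F β α l) (G : Fin 4 → Fin 4 → A)
    (hG : ∀ α β, G α β = -G β α) (α β γ δ : Fin 4) :
    D α (extD2 D F G β γ δ) - D β (extD2 D F G α γ δ) + D γ (extD2 D F G α β δ)
      - D δ (extD2 D F G α β γ) =
    commDefect D F α β (G γ δ) - commDefect D F α γ (G β δ) + commDefect D F α δ (G β γ)
      + commDefect D F β γ (G α δ) - commDefect D F β δ (G α γ) + commDefect D F γ δ (G α β)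
      + ∑ l, (F α β l * extD2 D F G l γ δ - F α γ l * extD2 D F G l β δ
        + F α δ l * extD2 D F G l β γ + F β γ l * extD2 D F G l α δ
        - F β δ l * extD2 D F G l α γ + F γ δ l * extD2 D F G l α β)
      - ∑ l, (extD2 D F (fun α β => F α β l) α β γ * G l δ
        - extD2 D F (fun α β => F α β l) α β δ * G l γ
        + extD2 D F (fun α β => F α β l) α γ δ * G l β
        - extD2 D F (fun α β => F α β l) β γ δ * G l α) := by
  have hGd : ∀ l, G l l = 0 := fun l => eq_zero_of_eq_neg (hG l l)
  have hGs : ∀ l, G β l = -G l β ∧ G γ l = -G l γ ∧ G δ l = -G l δ :=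
    fun l => ⟨hG β l, hG γ l, hG δ l⟩
  have hFs : ∀ l m, F β l m = -F l β m ∧ F γ l m = -F l γ m ∧ F δ l m = -F l δ m :=
    fun l m => ⟨hF β l m, hF γ l m, hF δ l m⟩
  simp only [extD2, commDefect, Fin.sum_univ_four, map_sub, map_add,
    Derivation.leibniz, smul_eq_mul, (hGs 0).1, (hGs 0).2.1, (hGs 0).2.2, (hGs 1).1, (hGs 1).2.1,
    (hGs 1).2.2, (hGs 2).1, (hGs 2).2.1, (hGs 2).2.2, (hGs 3).1, (hGs 3).2.1, (hGs 3).2.2,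
    (hFs 0 _).2.2, (hFs 1 _).2.2, (hFs 2 _).2.2, (hFs 3 _).2.2, (hFs 0 _).2.1, (hFs 1 _).2.1,
    (hFs 2 _).2.1, (hFs 3 _).2.1, (hFs 0 _).1, (hFs 1 _).1, (hFs 2 _).1, (hFs 3 _).1,
    hG δ β, hG γ α, hG δ α, hF δ β, hF γ α, hF δ α, map_neg,
    hG 1 0, hG 2 0, hG 2 1, hG 3 0, hG 3 1, hG 3 2, hGd]
  ring

section connection
variable (ε : Fin 4 → A) (w : Fin 4 → Fin 4 → Fin 4 → A)

/-- Structure functions of the bracket `D_{e_α} e_β - D_{e_β} e_α`, for the connection with lowered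
coefficients `w` and the diagonal metric `ε`. -/
def strucF (α β l : Fin 4) : A := ε l * (w α β l - w β α l)

/-- Lowered curvature of the connection with coefficients `w`, computed with `strucF`. -/
def curvR (α β μ ν : Fin 4) : A :=
  extD1 D (strucF ε w) (fun β => w β μ ν) α β
    + ∑ l, ε l * (w β μ l * w α l ν - w α μ l * w β l ν)

/-- Covariant derivative of the curvature. -/
def covR (γ α β μ ν : Fin 4) : A :=
  D γ (curvR D ε w α β μ ν) - ∑ l, ε l * (w γ α l * curvR D ε w l β μ ν
    + w γ β l * curvR D ε w α l μ ν + w γ μ l * curvR D ε w α β l ν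
    + w γ ν l * curvR D ε w α β μ l)

/-- Ricci contraction. -/
def ricR (α β : Fin 4) : A := ∑ l, ε l * curvR D ε w l α β l

theorem strucF_antisymm (α β l : Fin 4) : strucF ε w α β l = -strucF ε w β α l := by
  unfold strucF; ring

theorem curvR_antisymm (α β μ ν : Fin 4) : curvR D ε w α β μ ν = -curvR D ε w β α μ ν := by
  simp only [curvR, extD1, strucF, Fin.sum_univ_four]; ring

variable {ε w} (hε : ∀ α β, D α (ε β) = 0) (hw : ∀ α β γ, w α β γ = -w α γ β)
include hε hw

theorem curvR_antisymm' (α β μ ν : Fin 4) : curvR D ε w α β μ ν = -curvR D ε w α β ν μ := by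
  have h : ∀ l, w α l μ = -w α μ l ∧ w α l ν = -w α ν l ∧ w β l μ = -w β μ l ∧
    w β l ν = -w β ν l := fun l => ⟨hw _ _ _, hw _ _ _, hw _ _ _, hw _ _ _⟩
  simp only [curvR, extD1, Fin.sum_univ_four, hw _ ν μ, map_neg, (h 0).1, (h 0).2.1, (h 0).2.2.1,
    (h 0).2.2.2, (h 1).1, (h 1).2.1, (h 1).2.2.1, (h 1).2.2.2, (h 2).1, (h 2).2.1, (h 2).2.2.1,
    (h 2).2.2.2, (h 3).1, (h 3).2.1, (h 3).2.2.1, (h 3).2.2.2]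
  ring

/-- First Bianchi identity. F is the antisymmetrized connection, so its Jacobi defect regroups into
the cyclic sum of curvatures. -/
theorem extD2_strucF (α β γ l : Fin 4) :
    extD2 D (strucF ε w) (fun α β => strucF ε w α β l) α β γ =
      ε l * (curvR D ε w α β γ l + curvR D ε w β γ α l + curvR D ε w γ α β l) := by
  simp only [extD2, curvR, extD1, strucF, Fin.sum_univ_four, Derivation.leibniz, hε, map_sub,
    smul_eq_mul]
  ring

set_option maxRecDepth 4000 in
-- Second Bianchi identity in the form R = dw + w∧w. In the cyclic sum the connection terms on α, β,
-- γ become the structure terms of dR, and those on μ, ν cancel d(w∧w). What remains is d²w, which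
-- does not vanish here.
theorem bianchi (α β γ μ ν : Fin 4) :
    covR D ε w γ α β μ ν + covR D ε w α β γ μ ν + covR D ε w β γ α μ ν =
      extD2 D (strucF ε w) (extD1 D (strucF ε w) (fun β => w β μ ν)) α β γ := by
  have h : ∀ l, w α ν l = -w α l ν ∧ w β ν l = -w β l ν ∧ w γ ν l = -w γ l ν :=
    fun l => ⟨hw _ _ _, hw _ _ _, hw _ _ _⟩
  have key : extD2 D (strucF ε w) (fun α β => curvR D ε w α β μ ν) α β γ
      - ∑ l, ε l * (w γ μ l * curvR D ε w α β l ν + w γ ν l * curvR D ε w α β μ l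
        + w α μ l * curvR D ε w β γ l ν + w α ν l * curvR D ε w β γ μ l
        + w β μ l * curvR D ε w γ α l ν + w β ν l * curvR D ε w γ α μ l) =
      extD2 D (strucF ε w) (extD1 D (strucF ε w) (fun β => w β μ ν)) α β γ := by
    have lin : ∀ G H : Fin 4 → Fin 4 → A, extD2 D (strucF ε w) (fun α β => G α β + H α β) α β γ =
        extD2 D (strucF ε w) G α β γ + extD2 D (strucF ε w) H α β γ := fun G H => by
      simp only [extD2, Fin.sum_univ_four, map_add]; ring
    have e := lin (extD1 D (strucF ε w) (fun β => w β μ ν))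
      (fun α β => ∑ l, ε l * (w β μ l * w α l ν - w α μ l * w β l ν))
    simp only [curvR] at e ⊢
    rw [e, add_sub_assoc]
    refine add_eq_left.2 ?_
    generalize strucF ε w = F
    simp only [extD2, extD1, Fin.sum_univ_four, Derivation.leibniz, hε, map_sub, map_add,
      smul_eq_mul, (h 0).1, (h 0).2.1, (h 0).2.2, (h 1).1, (h 1).2.1, (h 1).2.2, (h 2).1, (h 2).2.1,
      (h 2).2.2, (h 3).1, (h 3).2.1, (h 3).2.2]
    ring
  rw [← key]
  have ha := fun l => curvR_antisymm D ε w α l μ ν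
  have hb := fun l => curvR_antisymm D ε w β l μ ν
  have hc := fun l => curvR_antisymm D ε w γ l μ ν
  simp only [covR, extD2, strucF, Fin.sum_univ_four]
  simp only [ha 0, ha 1, ha 2, ha 3, hb 0, hb 1, hb 2, hb 3, hc 0, hc 1, hc 2, hc 3]
  ring

theorem covR_antisymm (γ α β μ ν : Fin 4) : covR D ε w γ α β μ ν = -covR D ε w γ β α μ ν := by
  have h : ∀ l, curvR D ε w l α μ ν = -curvR D ε w α l μ ν ∧
    curvR D ε w l β μ ν = -curvR D ε w β l μ ν :=
    fun l => ⟨curvR_antisymm D ε w _ _ _ _, curvR_antisymm D ε w _ _ _ _⟩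
  simp only [covR, curvR_antisymm D ε w β α, Fin.sum_univ_four, map_neg, (h 0).1, (h 0).2,
    (h 1).1, (h 1).2, (h 2).1, (h 2).2, (h 3).1, (h 3).2]
  ring

theorem covR_antisymm' (γ α β μ ν : Fin 4) : covR D ε w γ α β μ ν = -covR D ε w γ α β ν μ := by
  have h : ∀ α β l, curvR D ε w α β l μ = -curvR D ε w α β μ l ∧
    curvR D ε w α β l ν = -curvR D ε w α β ν l :=
    fun _ _ l => ⟨curvR_antisymm' D hε hw _ _ _ _, curvR_antisymm' D hε hw _ _ _ _⟩
  simp only [covR, curvR_antisymm' D hε hw _ _ ν μ, Fin.sum_univ_four, map_neg, (h _ _ 0).1,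
    (h _ _ 0).2, (h _ _ 1).1, (h _ _ 1).2, (h _ _ 2).1, (h _ _ 2).2, (h _ _ 3).1, (h _ _ 3).2]
  ring

/-- Twice contracted second Bianchi identity. -/
theorem sum_covR (γ : Fin 4) :
    ∑ α, ∑ β, ε α * ε β * (covR D ε w γ α β β α + covR D ε w α β γ β α + covR D ε w β γ α β α) =
      D γ (∑ α, ε α * ricR D ε w α α) - 2 * ∑ α, ε α * (D α (ricR D ε w γ α)
        - ∑ l, ε l * (w α γ l * ricR D ε w l α + w α α l * ricR D ε w γ l)) := by
  have R1 := curvR_antisymm D ε w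
  have R2 := curvR_antisymm' D hε hw
  -- Metric compatibility enters through this cancellation: connection coefficients are
  -- antisymmetric in the last two indices, and contraction over a summed pair makes the other
  -- factor symmetric.
  have skew : ∀ a Y : Fin 4 → Fin 4 → A, (∀ i j, a i j = -a j i) → (∀ i j, Y i j = Y j i) →
      ∑ i, ∑ j, a i j * Y i j = 0 := fun a Y ha hY => by
    refine eq_zero_of_eq_neg ?_
    conv_lhs => rw [Finset.sum_comm]
    simp only [← Finset.sum_neg_distrib]
    refine Finset.sum_congr rfl fun i _ => Finset.sum_congr rfl fun j _ => ?_
    rw [ha j i, hY j i]; ring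
  have hD : ∀ α (f : Fin 4 → A), D α (∑ β, ε β * f β) = ∑ β, ε β * D α (f β) := fun α f => by
    simp only [map_sum, Derivation.leibniz, hε, smul_eq_mul, mul_zero, add_zero]
  have hr : ∀ a b, ∑ β, ε β * curvR D ε w β a β b = -ricR D ε w a b := fun a b => by
    rw [ricR, ← Finset.sum_neg_distrib]
    exact Finset.sum_congr rfl fun β _ => by rw [R2 β a β b]; ring
  have c1 : ∑ α, ∑ β, ε α * ε β * covR D ε w γ α β β α =
      D γ (∑ α, ε α * ricR D ε w α α) := by
    have e : ∑ α, ∑ β, ε α * ε β * covR D ε w γ α β β α =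
        ∑ β, ε β * ∑ α, ε α * D γ (curvR D ε w α β β α)
        - ∑ β, ∑ α, ∑ l, w γ α l *
          (ε α * ε l * ε β * (curvR D ε w l β β α + curvR D ε w α β β l))
        - ∑ α, ∑ β, ∑ l, w γ β l *
          (ε β * ε l * ε α * (curvR D ε w α l β α + curvR D ε w α β l α)) := by
      simp only [covR, Fin.sum_univ_four]; ring
    have z1 : ∀ β, ∑ α, ∑ l, w γ α l *
        (ε α * ε l * ε β * (curvR D ε w l β β α + curvR D ε w α β β l)) = 0 := fun β =>
      skew _ _ (fun i j => hw _ _ _) fun i j => by ring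
    have z2 : ∀ α, ∑ β, ∑ l, w γ β l *
        (ε β * ε l * ε α * (curvR D ε w α l β α + curvR D ε w α β l α)) = 0 := fun α =>
      skew _ _ (fun i j => hw _ _ _) fun i j => by ring
    rw [e]
    simp only [z1, z2, Finset.sum_const_zero, sub_zero, hD, ricR]
  have c2 : ∑ α, ∑ β, ε α * ε β * covR D ε w α β γ β α =
      - ∑ α, ε α * (D α (ricR D ε w γ α)
        - ∑ l, ε l * (w α γ l * ricR D ε w l α + w α α l * ricR D ε w γ l)) := by
    rw [← Finset.sum_neg_distrib]
    refine Finset.sum_congr rfl fun α _ => ?_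
    have e : ∑ β, ε α * ε β * covR D ε w α β γ β α =
        ε α * (∑ β, ε β * D α (curvR D ε w β γ β α)
        - ∑ β, ∑ l, w α β l * (ε β * ε l * (curvR D ε w l γ β α + curvR D ε w β γ l α))
        - ∑ l, ε l * (w α γ l * (∑ β, ε β * curvR D ε w β l β α)
          + w α α l * ∑ β, ε β * curvR D ε w β γ β l)) := by
      simp only [covR, Fin.sum_univ_four]; ring
    rw [e, skew _ _ (fun i j => hw _ _ _) fun i j => by ring, ← hD, hr, map_neg]
    simp only [hr, Fin.sum_univ_four]
    ring
  -- The two antisymmetries of the curvature identify the last two terms of the cyclic sum, which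
  -- accounts for the factor 2 in front of the divergence.
  have c3 : ∑ α, ∑ β, ε α * ε β * covR D ε w β γ α β α =
      ∑ α, ∑ β, ε α * ε β * covR D ε w α β γ β α := by
    rw [Finset.sum_comm]
    refine Finset.sum_congr rfl fun α _ => Finset.sum_congr rfl fun β _ => ?_
    rw [covR_antisymm D hε hw α γ β, covR_antisymm' D hε hw α β γ α β]; ring
  have e : ∑ α, ∑ β, ε α * ε β * (covR D ε w γ α β β α + covR D ε w α β γ β α
      + covR D ε w β γ α β α) = ∑ α, ∑ β, ε α * ε β * covR D ε w γ α β β α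
      + ∑ α, ∑ β, ε α * ε β * covR D ε w α β γ β α
      + ∑ α, ∑ β, ε α * ε β * covR D ε w β γ α β α := by
    simp only [mul_add, Finset.sum_add_distrib]
  rw [e, c3, c1, c2]
  ring

end connection
end
end FrameCalculus

/-! ### The modified system in an algebra with four derivations -/

namespace FrameCalculus

/-- The modified system in a commutative algebra with four derivations `e_0, …, e_3`. -/
structure ConstraintSystem (a ρ : ℝ) (A : Type*) [CommRing A] [Algebra ℝ A] where
  D : Fin 4 → Derivation ℝ A A
  e : Fin 3 → Fin 3 → A
  om : Fin 3 → Fin 3 → A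
  st : Fin 3 → Fin 3 → Fin 3 → A
  k : Fin 3 → Fin 3 → A
  Γ : Fin 3 → Fin 3 → Fin 3 → A
  -- `n` plays the role of the true e_I(ln N) and `ν` that of the unknown N_I; their difference is
  -- the lapse constraint. The connection is built from `n`, whereas the evolution equations contain
  -- `ν`.
  n : Fin 3 → A
  ν : Fin 3 → A
  θ : A
  φ : A
  V0 : A
  V1 : A
  k_symm : ∀ I J, k I J = k J I
  Γ_antisymm : ∀ I J K, Γ I J K = -Γ I K J
  k_trace : ∑ I, k I I = θ
  dual : ∀ I J, ∑ i, e I i * om J i = if I = J then 1 else 0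
  D_e : ∀ I i, D 0 (e I i) = -∑ J, k I J * e J i
  D_om : ∀ I i, D 0 (om I i) = ∑ J, k I J * om J i
  D_st : ∀ i j l, D 0 (st i j l) = 0
  comm_zero : ∀ I x, D 0 (D (Fin.succ I) x) =
    D (Fin.succ I) (D 0 x) + n I * D 0 x - ∑ J, k I J * D (Fin.succ J) x
  comm : ∀ I J x, D (Fin.succ I) (D (Fin.succ J) x) - D (Fin.succ J) (D (Fin.succ I) x) =
    ∑ K, (∑ i, (D (Fin.succ I) (e J i) - D (Fin.succ J) (e I i)
      + ∑ j, ∑ l, e I j * e J l * st j l i) * om K i) * D (Fin.succ K) x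
  curl_n : ∀ I J, D (Fin.succ I) (n J) - D (Fin.succ J) (n I) =
    ∑ K, (∑ i, (D (Fin.succ I) (e J i) - D (Fin.succ J) (e I i)
      + ∑ j, ∑ l, e I j * e J l * st j l i) * om K i) * n K
  D_n : ∀ I, D 0 (n I) = (a + 1) • D (Fin.succ I) θ + (a + 1) • (θ * n I) - ∑ J, k I J * n J
  D_ν : ∀ I, D 0 (ν I) = (a + 1) • D (Fin.succ I) θ + (a + 1) • (θ * ν I) - ∑ J, k I J * ν J
    + alpha a ρ • (∑ J, D (Fin.succ J) (k J I) - D (Fin.succ I) θ - ∑ J, ∑ K, Γ J J K * k K I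
      - ∑ J, ∑ K, Γ J I K * k J K - D 0 φ * D (Fin.succ I) φ)
  D_Γ : ∀ I J K, D 0 (Γ I J K) = -∑ L, k I L * Γ L J K + D (Fin.succ J) (k K I)
    - D (Fin.succ K) (k J I) + ∑ L, k K L * Γ J L I - ∑ L, k J L * Γ K L I
    - ∑ L, k I L * Γ J K L + ∑ L, k I L * Γ K J L + ν J * k I K - ν K * k I J
    + kd I K • (∑ L, D (Fin.succ L) (k L J) - D (Fin.succ J) θ - ∑ L, ∑ M, Γ L L M * k M J
      - ∑ L, ∑ M, Γ L J M * k L M - D 0 φ * D (Fin.succ J) φ)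
    - kd I J • (∑ L, D (Fin.succ L) (k L K) - D (Fin.succ K) θ - ∑ L, ∑ M, Γ L L M * k M K
      - ∑ L, ∑ M, Γ L K M * k L M - D 0 φ * D (Fin.succ K) φ)
  X : Fin 3 → Fin 3 → A
  X_eq : ∀ I J, X I J = -∑ K, D (Fin.succ K) (Γ I J K) + ∑ K, D (Fin.succ I) (Γ K J K)
    + D (Fin.succ I) (ν J) - ∑ K, ∑ L, Γ I J L * Γ K L K + ∑ K, ∑ L, Γ K I L * Γ L J K
    + ν I * ν J - ∑ K, Γ I J K * ν K + D (Fin.succ I) φ * D (Fin.succ J) φ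
  H : A
  H_eq : H = 2 * ∑ I, ∑ K, D (Fin.succ K) (Γ I I K) + ∑ I, ∑ K, ∑ L, Γ I I L * Γ K L K
    - ∑ I, ∑ K, ∑ L, Γ K I L * Γ L I K + θ ^ 2 - ∑ I, ∑ J, k I J * k I J - D 0 φ ^ 2
    - ∑ I, D (Fin.succ I) φ * D (Fin.succ I) φ - 2 * V0
  D_k : ∀ I J, D 0 (k I J) = -(θ * k I J) + (1 / 2 : ℝ) • (X I J + X J I) + kd I J • V0
    + (kd I J * beta ρ / 3) • H
  wave : D 0 (D 0 φ) = ∑ I, D (Fin.succ I) (D (Fin.succ I) φ) - θ * D 0 φ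
    - ∑ I, ∑ K, Γ I I K * D (Fin.succ K) φ + ∑ I, D (Fin.succ I) φ * ν I - V1
  D_V0 : ∀ α, D α V0 = V1 * D α φ

namespace ConstraintSystem
variable {a ρ : ℝ} {A : Type*} [CommRing A] [Algebra ℝ A] (s : ConstraintSystem a ρ A)

theorem sum_four {M : Type*} [AddCommMonoid M] (f : Fin 4 → M) :
    ∑ l, f l = f 0 + ∑ I : Fin 3, f I.succ := Fin.sum_univ_succ f

/-- Diagonal of the frame metric. -/
def ε (A : Type*) [CommRing A] (α : Fin 4) : A := Fin.cases (motive := fun _ => A) (-1) (fun _ => 1) α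

/-- Lowered connection coefficients. -/
def w (α β γ : Fin 4) : A :=
  Fin.cases (motive := fun _ => A)
    (Fin.cases (motive := fun _ => A) (Fin.cases (motive := fun _ => A) 0 s.n γ)
      (fun I => Fin.cases (motive := fun _ => A) (-s.n I) (fun _ => 0) γ) β)
    (fun I => Fin.cases (motive := fun _ => A)
      (Fin.cases (motive := fun _ => A) 0 (s.k I) γ)
      (fun J => Fin.cases (motive := fun _ => A) (-s.k I J) (s.Γ I J) γ) β) α

@[simp] theorem ε_zero : ε A 0 = -1 := rfl
@[simp] theorem ε_succ (I : Fin 3) : ε A I.succ = 1 := rfl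
@[simp] theorem w_000 : s.w 0 0 0 = 0 := rfl
@[simp] theorem w_00s (I : Fin 3) : s.w 0 0 I.succ = s.n I := rfl
@[simp] theorem w_0s0 (I : Fin 3) : s.w 0 I.succ 0 = -s.n I := rfl
@[simp] theorem w_0ss (I J : Fin 3) : s.w 0 I.succ J.succ = 0 := rfl
@[simp] theorem w_s00 (I : Fin 3) : s.w I.succ 0 0 = 0 := rfl
@[simp] theorem w_s0s (I J : Fin 3) : s.w I.succ 0 J.succ = s.k I J := rfl
@[simp] theorem w_ss0 (I J : Fin 3) : s.w I.succ J.succ 0 = -s.k I J := rfl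
@[simp] theorem w_sss (I J K : Fin 3) : s.w I.succ J.succ K.succ = s.Γ I J K := rfl

/-- Structure functions of the spatial frame. -/
def c (I J K : Fin 3) : A :=
  ∑ i, (s.D (Fin.succ I) (s.e J i) - s.D (Fin.succ J) (s.e I i)
      + ∑ j, ∑ l, s.e I j * s.e J l * s.st j l i) * s.om K i

/-- Torsion. -/
def C (I J K : Fin 3) : A := s.c I J K - s.Γ I J K + s.Γ J I K

/-- The lapse constraint. -/
def lap (I : Fin 3) : A := s.n I - s.ν I

/-- The momentum constraint. -/
def M (I : Fin 3) : A :=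
  ∑ J, s.D (Fin.succ J) (s.k J I) - s.D (Fin.succ I) s.θ - ∑ J, ∑ K, s.Γ J J K * s.k K I
      - ∑ J, ∑ K, s.Γ J I K * s.k J K - s.D 0 s.φ * s.D (Fin.succ I) s.φ

/-- Frame components of the metric. -/
def g (A : Type*) [CommRing A] (α β : Fin 4) : A := if α = β then ε A α else 0

/-- The structure functions used to measure the curvature. -/
abbrev F (α β l : Fin 4) : A := strucF (ε A) s.w α β l

/-- The curvature. -/
abbrev R (α β μ ν : Fin 4) : A := curvR s.D (ε A) s.w α β μ ν

/-- The Ricci contraction. -/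
abbrev Ric (α β : Fin 4) : A := ricR s.D (ε A) s.w α β

/-- The Einstein equation defect. -/
def E (α β : Fin 4) : A := s.Ric α β - s.D α s.φ * s.D β s.φ - s.V0 * g A α β

@[simp] theorem F_s0 (I : Fin 3) (α : Fin 4) : s.F I.succ 0 α = -s.F 0 I.succ α := by
  rw [F, strucF_antisymm]
@[simp] theorem F_00 (α : Fin 4) : s.F 0 0 α = 0 := by simp [F, strucF]
@[simp] theorem F_0s0 (I : Fin 3) : s.F 0 I.succ 0 = s.n I := by simp [F, strucF]
@[simp] theorem F_0ss (I J : Fin 3) : s.F 0 I.succ J.succ = -s.k I J := by simp [F, strucF]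
@[simp] theorem F_ss0 (I J : Fin 3) : s.F I.succ J.succ 0 = 0 := by
  simp [F, strucF, s.k_symm I J]
@[simp] theorem F_sss (I J K : Fin 3) : s.F I.succ J.succ K.succ = s.Γ I J K - s.Γ J I K := by
  simp [F, strucF]

theorem D_ε (α β : Fin 4) : s.D α (ε A β) = 0 := by
  refine Fin.cases ?_ (fun I => ?_) β
  · simp
  · simp

theorem w_antisymm (α β γ : Fin 4) : s.w α β γ = -s.w α γ β := by
  refine Fin.cases ?_ (fun I => ?_) α <;> refine Fin.cases ?_ (fun J => ?_) β <;>
    refine Fin.cases ?_ (fun K => ?_) γ <;>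
    first | simp; done | simpa using s.Γ_antisymm _ _ _

theorem commDefect_self (α : Fin 4) (x : A) : commDefect s.D s.F α α x = 0 := by
  refine Fin.cases ?_ (fun I => ?_) α <;> simp [commDefect, F, strucF]

theorem commDefect_antisymm (α β : Fin 4) (x : A) :
    commDefect s.D s.F α β x = -commDefect s.D s.F β α x := by
  simp only [commDefect, F, strucF, Fin.sum_univ_four]; ring

theorem commDefect_zero (I : Fin 3) (x : A) : commDefect s.D s.F 0 I.succ x = 0 := by
  simp only [commDefect, sum_four, F_0s0, F_0ss, s.comm_zero, neg_mul, Finset.sum_neg_distrib]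
  ring

theorem commDefect_succ (I J : Fin 3) (x : A) :
    commDefect s.D s.F I.succ J.succ x = ∑ K, s.C I J K * s.D K.succ x := by
  simp only [commDefect, sum_four, F_ss0, F_sss, s.comm, C, c]
  rw [zero_mul, zero_add, ← Finset.sum_sub_distrib]
  exact Finset.sum_congr rfl fun K _ => by ring

theorem curl (I J : Fin 3) : s.D I.succ (s.n J) - s.D J.succ (s.n I)
    - ∑ K, (s.Γ I J K - s.Γ J I K) * s.n K = ∑ K, s.C I J K * s.n K := by
  simp only [s.curl_n, C, c]
  rw [← Finset.sum_sub_distrib]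
  exact Finset.sum_congr rfl fun K _ => by ring

/-- Differentiates the definition of the structure functions with the commutator of e_0 and e_I and
the equations for e and ω. -/
theorem D_c (I J K : Fin 3) : s.D 0 (s.c I J K) =
    -(s.D I.succ (s.k J K) - s.D J.succ (s.k I K)) - (s.n I * s.k J K - s.n J * s.k I K)
    - ∑ L, s.k I L * s.c L J K - ∑ L, s.k J L * s.c I L K + ∑ L, s.c I J L * s.k L K := by
  -- Inserts δ_LK as the pairing of e_L with ω^K, so that the terms with e and ω differentiated
  -- match those without.
  have d : ∀ (f : Fin 3 → A), f K = ∑ L, f L * ∑ i, s.e L i * s.om K i := fun f => by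
    simp [s.dual]
  have d1 := d (fun L => s.D I.succ (s.k J L) - s.D J.succ (s.k I L)
    + (s.n I * s.k J L - s.n J * s.k I L))
  have e1 : s.D 0 (s.c I J K) = -(∑ L, (s.D I.succ (s.k J L) - s.D J.succ (s.k I L)
    + (s.n I * s.k J L - s.n J * s.k I L)) * ∑ i, s.e L i * s.om K i)
    - ∑ L, s.k I L * s.c L J K - ∑ L, s.k J L * s.c I L K + ∑ L, s.c I J L * s.k L K := by
    simp only [c, Derivation.leibniz, map_add, map_sub, s.comm_zero, s.D_e, s.D_om, s.D_st,
      smul_eq_mul, map_neg, Fin.sum_univ_three, mul_zero, s.k_symm K]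
    ring
  rw [e1, ← d1]
  ring

theorem extD2_F (α β γ l : Fin 4) : extD2 s.D s.F (fun α β => s.F α β l) α β γ =
    ε A l * (s.R α β γ l + s.R β γ α l + s.R γ α β l) :=
  extD2_strucF s.D s.D_ε s.w_antisymm α β γ l

/-- This defect is minus the curl of `n` computed with the connection bracket. As `n` is exact for
the true bracket, only torsion survives. -/
theorem extD2_F_0ss0 (I J : Fin 3) : extD2 s.D s.F (fun α β => s.F α β 0) 0 I.succ J.succ =
    -∑ K, s.C I J K * s.n K := by
  rw [← s.curl]
  simp only [extD2, sum_four, Fin.sum_univ_three, F_s0, F_00, F_0s0, F_0ss, F_ss0, F_sss, map_neg]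
  simp only [map_zero]
  ring

theorem D_Γ_eq (I J K : Fin 3) : s.D 0 (s.Γ I J K) = -∑ L, s.k I L * s.Γ L J K
    + s.D (Fin.succ J) (s.k K I)
    - s.D (Fin.succ K) (s.k J I) + ∑ L, s.k K L * s.Γ J L I - ∑ L, s.k J L * s.Γ K L I
    - ∑ L, s.k I L * s.Γ J K L + ∑ L, s.k I L * s.Γ K J L + s.ν J * s.k I K - s.ν K * s.k I J
    + kd I K • s.M J - kd I J • s.M K := s.D_Γ I J K

theorem kd_comm (I J : Fin 3) : kd I J = kd J I := by simp [kd, eq_comm]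

/-- The form of the Γ equation enters here. The terms δ_IK M_J - δ_IJ M_K added to it produce the
momentum constraint, and the use of `ν` instead of `n` produces the lapse constraint; otherwise this
defect would vanish. -/
theorem extD2_F_0sss (I J K : Fin 3) :
    extD2 s.D s.F (fun α β => s.F α β K.succ) 0 I.succ J.succ =
    kd I K • s.M J - kd J K • s.M I + s.lap I * s.k J K - s.lap J * s.k I K := by
  have h : ∀ x L, s.Γ x L I = -s.Γ x I L ∧ s.Γ x L J = -s.Γ x J L ∧ s.Γ x L K = -s.Γ x K L :=
    fun x L => ⟨s.Γ_antisymm _ _ _, s.Γ_antisymm _ _ _, s.Γ_antisymm _ _ _⟩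
  have hk : ∀ L, s.k L I = s.k I L ∧ s.k L J = s.k J L ∧ s.k L K = s.k K L :=
    fun L => ⟨s.k_symm _ _, s.k_symm _ _, s.k_symm _ _⟩
  simp only [extD2, sum_four, Fin.sum_univ_three, F_s0, F_00, F_0s0, F_0ss, F_ss0, F_sss, map_neg,
    map_sub, s.D_Γ_eq, s.k_symm J I, s.k_symm K I, s.k_symm K J, lap, kd_comm J I, (h _ 0).1,
    (h _ 0).2.1, (h _ 0).2.2, (h _ 1).1, (h _ 1).2.1, (h _ 1).2.2, (h _ 2).1, (h _ 2).2.1,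
    (h _ 2).2.2, (hk 0).1, (hk 0).2.1, (hk 0).2.2, (hk 1).1, (hk 1).2.1, (hk 1).2.2, (hk 2).1,
    (hk 2).2.1, (hk 2).2.2]
  ring

theorem extD2_F_sss0 (I J K : Fin 3) :
    extD2 s.D s.F (fun α β => s.F α β 0) I.succ J.succ K.succ = 0 := by
  simp only [extD2, sum_four, Fin.sum_univ_three, F_0s0, F_ss0, F_sss, map_zero]
  ring

/-- Compares the evolution of the true structure functions with that of Γ_IJK - Γ_JIK. The mismatch
is the Jacobi defect of `extD2_F_0sss`. -/
theorem D_C (I J K : Fin 3) : s.D 0 (s.C I J K) =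
    -(kd I K • s.M J - kd J K • s.M I + s.lap I * s.k J K - s.lap J * s.k I K)
    - ∑ L, s.k I L * s.C L J K - ∑ L, s.k J L * s.C I L K + ∑ L, s.C I J L * s.k L K := by
  have h := s.extD2_F_0sss I J K
  simp only [extD2, sum_four, F_s0, F_0s0, F_0ss, F_ss0, F_sss, map_neg, map_sub,
    Fin.sum_univ_three] at h
  have hk : s.k K 0 = s.k 0 K ∧ s.k K 1 = s.k 1 K ∧ s.k K 2 = s.k 2 K :=
    ⟨s.k_symm _ _, s.k_symm _ _, s.k_symm _ _⟩
  rw [← h]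
  simp only [C, map_add, map_sub, s.D_c, Fin.sum_univ_three, s.k_symm J I]
  ring

/-- Generators and basic membership facts. -/
structure Contains (I : Ideal A) : Prop where
  C : ∀ i j k, s.C i j k ∈ I
  lap : ∀ i, s.lap i ∈ I
  dlap : ∀ i j, s.D (Fin.succ i) (s.lap j) ∈ I
  ham : s.E 0 0 ∈ I
  mom : ∀ i, s.E (Fin.succ i) 0 ∈ I
  rot : ∀ i j, (1 / 2 : ℝ) • (s.E (Fin.succ i) (Fin.succ j) - s.E (Fin.succ j) (Fin.succ i)) ∈ I

theorem R_eq (α β μ ν : Fin 4) : s.R α β μ ν = s.D α (s.w β μ ν) - s.D β (s.w α μ ν)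
    - ∑ l, s.F α β l * s.w l μ ν + ∑ l, ε A l * (s.w β μ l * s.w α l ν - s.w α μ l * s.w β l ν) := rfl

/-- Orients the symmetries of k and Γ, for concrete indices and for one free index, so that expanded
sums reach a normal form that `ring` can compare. -/
theorem normal_rules (I : Fin 3) : (s.k 1 0 = s.k 0 1 ∧ s.k 2 0 = s.k 0 2 ∧ s.k 2 1 = s.k 1 2) ∧
    (∀ x : Fin 3, s.Γ x 0 0 = 0 ∧ s.Γ x 1 1 = 0 ∧ s.Γ x 2 2 = 0 ∧ s.Γ x 1 0 = -s.Γ x 0 1 ∧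
      s.Γ x 2 0 = -s.Γ x 0 2 ∧ s.Γ x 2 1 = -s.Γ x 1 2) ∧
    (∀ L, s.k L I = s.k I L) ∧ ∀ x L, s.Γ x L I = -s.Γ x I L :=
  ⟨⟨s.k_symm _ _, s.k_symm _ _, s.k_symm _ _⟩, fun _ => ⟨eq_zero_of_eq_neg (s.Γ_antisymm _ _ _),
    eq_zero_of_eq_neg (s.Γ_antisymm _ _ _), eq_zero_of_eq_neg (s.Γ_antisymm _ _ _),
    s.Γ_antisymm _ _ _, s.Γ_antisymm _ _ _, s.Γ_antisymm _ _ _⟩, fun _ => s.k_symm _ _,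
    fun _ _ => s.Γ_antisymm _ _ _⟩

/-- The curvature supplies the derivative of the trace of k, which is e_I θ. Thus the expression
added to the evolution equations is itself a component of E. -/
theorem E_s0 (I : Fin 3) : s.E I.succ 0 = s.M I := by
  have h0 : g A I.succ 0 = 0 := by simp [g]
  obtain ⟨⟨k1, k2, k3⟩, hΓ, hk, hI⟩ := s.normal_rules I
  have ht := congrArg (s.D I.succ) s.k_trace
  simp only [Fin.sum_univ_three, map_add] at ht
  simp only [E, ricR, R_eq, sum_four, Fin.sum_univ_three, h0, ε_zero, ε_succ, F_s0, F_0s0, F_0ss,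
    F_ss0, F_sss, w_000, w_00s, w_0s0, w_s00, w_s0s, w_ss0, w_sss, map_zero, M, ← ht,
    hk 0, hk 1, hk 2, k1, k2, k3, (hΓ _).1, (hΓ _).2.1, (hΓ _).2.2.1, (hΓ _).2.2.2.1,
    (hΓ _).2.2.2.2.1, (hΓ _).2.2.2.2.2, hI _ 0, hI _ 1, hI _ 2]
  ring

/-- The momentum terms in the Γ equation contribute -2M_I to E_0I through the trace 3M_I - M_I. This
turns the usual symmetry of E into antisymmetry of the mixed components, up to the lapse constraint.
-/
theorem E_0s (I : Fin 3) : s.E 0 I.succ + s.E I.succ 0 =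
    s.θ * s.lap I - ∑ J, s.k J I * s.lap J := by
  rw [E_s0]
  have h0 : g A 0 I.succ = 0 := by simp [g, (Fin.succ_ne_zero I).symm]
  obtain ⟨⟨k1, k2, k3⟩, hΓ, hk, hI⟩ := s.normal_rules I
  have ht := congrArg (s.D I.succ) s.k_trace
  have hm : ∑ J, kd J I • s.M J = s.M I := by simp [kd]
  have hM := M.eq_1 s I
  have h1 : ∀ J, kd J J = 1 := by simp [kd]
  simp only [Fin.sum_univ_three, map_add] at ht hm hM
  simp only [E, ricR, R_eq, sum_four, Fin.sum_univ_three, h0, ε_zero, ε_succ, F_s0, F_00, F_0s0,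
    F_0ss, w_000, w_00s, w_0s0, w_0ss, w_s00, w_s0s, w_ss0, w_sss, map_zero, lap,
    s.D_Γ_eq, h1, ← s.k_trace]
  simp only [← ht, k1, k2, k3, hk 0, hk 1, hk 2, (hΓ _).1, (hΓ _).2.1, (hΓ _).2.2.1,
    (hΓ _).2.2.2.1, (hΓ _).2.2.2.2.1, (hΓ _).2.2.2.2.2, hI _ 0, hI _ 1, hI _ 2, one_smul] at hM ⊢
  linear_combination hm - hM

theorem E_00 : s.E 0 0 = ∑ I : Fin 3, s.D I.succ (s.n I) + ∑ I, s.n I * s.n I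
    + ∑ I, ∑ J, s.n I * s.Γ J I J - s.D 0 s.θ - ∑ I, ∑ J, s.k I J * s.k I J
    - s.D 0 s.φ * s.D 0 s.φ + s.V0 := by
  have h0 : g A 0 0 = -1 := by simp [g]
  simp only [E, ricR, R_eq, sum_four, Fin.sum_univ_three, h0, ε_zero, ε_succ, F_s0, F_00, F_0s0,
    F_0ss, w_000, w_00s, w_0s0, w_0ss, w_s00, w_s0s, w_sss, map_zero, ← s.k_trace,
    map_add, s.k_symm 1 0, s.k_symm 2 0, s.k_symm 2 1]
  ring

/-- The correction of the Hessian of the lapse. -/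
def P (I J : Fin 3) : A := s.D I.succ (s.lap J) + s.lap I * s.n J + s.ν I * s.lap J
  - ∑ L, s.Γ I J L * s.lap L

/-- Only the symmetrization of X enters the equation for k, which leaves its antisymmetric part in
E. Replacing `n` by `ν` in the Hessian of the lapse costs P, and the β-correction supplies the
multiple of H. -/
theorem E_ss (I J : Fin 3) : s.E I.succ J.succ = (1 / 2 : ℝ) • (s.X J I - s.X I J) - s.P I J
    + (kd I J * beta ρ / 3) • s.H := by
  have h0 : s.V0 * g A I.succ J.succ = kd I J • s.V0 := by
    by_cases h : I = J <;> simp [g, h, kd]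
  have hX : s.X I J = (1 / 2 : ℝ) • (s.X I J + s.X J I) - (1 / 2 : ℝ) • (s.X J I - s.X I J) := by
    module
  have key : s.E I.succ J.succ = s.D 0 (s.k I J) + s.θ * s.k I J - s.X I J - s.P I J
      - kd I J • s.V0 := by
    obtain ⟨⟨k1, k2, k3⟩, hΓ, hk, hI⟩ := s.normal_rules I
    obtain ⟨-, -, hkJ, hJ⟩ := s.normal_rules J
    simp only [E, ricR, R_eq, sum_four, Fin.sum_univ_three, h0, ε_zero, ε_succ, F_s0, F_0s0, F_0ss,
      F_ss0, F_sss, w_000, w_s00, w_00s, w_0s0, w_0ss, w_s0s, w_ss0, w_sss, P, X_eq, lap, map_neg, ← s.k_trace,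
      map_sub, map_zero]
    simp only [hk 0, hk 1, hk 2, hkJ 0, hkJ 1, hkJ 2, k1, k2, k3, hI _ 0, hI _ 1, hI _ 2, hJ _ 0,
      hJ _ 1, hJ _ 2, (hΓ _).1, (hΓ _).2.1, (hΓ _).2.2.1, (hΓ _).2.2.2.1, (hΓ _).2.2.2.2.1,
      (hΓ _).2.2.2.2.2, map_neg, map_zero]
    ring
  rw [key, D_k]
  nth_rewrite 2 [hX]
  module

theorem sum_E_ss : ∑ I : Fin 3, s.E I.succ I.succ = beta ρ • s.H - ∑ I, s.P I I := by
  have h1 : ∀ J, kd J J = 1 := by simp [kd]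
  simp only [E_ss, Fin.sum_univ_three, h1]
  module

/-- In this combination the time derivative of θ and the second derivatives of the lapse cancel,
which leaves the Hamiltonian expression. -/
theorem sum_E_ss_add : ∑ I : Fin 3, s.E I.succ I.succ + s.E 0 0 = s.H := by
  have h1 : ∀ J, kd J J = 1 := by simp [kd]
  have ht := congrArg (s.D 0) s.k_trace
  have key : ∑ I, s.P I I = ∑ I : Fin 3, s.D I.succ (s.n I) + ∑ I, s.n I * s.n I
    + ∑ I, ∑ J, s.n I * s.Γ J I J - (∑ I : Fin 3, s.D I.succ (s.ν I) + ∑ I, s.ν I * s.ν I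
    + ∑ I, ∑ J, s.ν I * s.Γ J I J) := by
    obtain ⟨-, hΓ, -⟩ := s.normal_rules 0
    simp only [P, lap, map_sub, Fin.sum_univ_three]
    simp only [(hΓ _).1, (hΓ _).2.1, (hΓ _).2.2.1, (hΓ _).2.2.2.1, (hΓ _).2.2.2.2.1,
      (hΓ _).2.2.2.2.2]
    ring
  have hX : ∑ I, s.X I I = -2 * ∑ I, ∑ K, s.D (Fin.succ K) (s.Γ I I K) +
    ∑ I, s.D (Fin.succ I) (s.ν I) - ∑ I, ∑ K, ∑ L, s.Γ I I L * s.Γ K L K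
    + ∑ I, ∑ K, ∑ L, s.Γ K I L * s.Γ L I K
    + ∑ I, s.ν I * s.ν I + ∑ I, ∑ J, s.ν I * s.Γ J I J
    + ∑ I, s.D (Fin.succ I) s.φ * s.D (Fin.succ I) s.φ := by
    obtain ⟨-, hΓ, -⟩ := s.normal_rules 0
    simp only [X_eq, Fin.sum_univ_three]
    simp only [(hΓ _).1, (hΓ _).2.1, (hΓ _).2.2.1, (hΓ _).2.2.2.1, (hΓ _).2.2.2.2.1,
      (hΓ _).2.2.2.2.2, map_neg, map_zero]
    ring
  have hk : s.D 0 s.θ = -s.θ ^ 2 + ∑ I, s.X I I + 3 * s.V0 + beta ρ • s.H := by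
    have hq := s.k_trace
    rw [← ht]
    simp only [map_add, s.D_k, Fin.sum_univ_three, h1] at hq ⊢
    linear_combination (norm := algebra) -s.θ * hq
  have hH := s.H_eq
  rw [sum_E_ss, E_00, key, hk, hX]
  linear_combination -hH

/-- Comparing the two trace identities gives (β - 1)H = ∑ P_II - E_00, and β - 1 = 1/(6ρ). The added
multiple of the Hamiltonian constraint is thus what allows H to be recovered from E_00. -/
theorem H_eq_smul (hρ : 0 < ρ) : s.H = (6 * ρ) • (∑ I, s.P I I - s.E 0 0) := by
  have h1 := s.sum_E_ss_add
  rw [sum_E_ss] at h1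
  have h2 : (1 / (6 * ρ)) • s.H = ∑ I, s.P I I - s.E 0 0 := by
    rw [beta] at h1
    linear_combination (norm := module) h1
  rw [← h2, smul_smul, mul_one_div_cancel (by positivity), one_smul]
end ConstraintSystem
end FrameCalculus

/-! ### First Bianchi defects, divergence of E, and the constraint ideal -/

namespace FrameCalculus
namespace ConstraintSystem
variable {a ρ : ℝ} {A : Type*} [CommRing A] [Algebra ℝ A] (s : ConstraintSystem a ρ A)

theorem D_lap (I : Fin 3) : s.D 0 (s.lap I) =
    (a + 1) • (s.θ * s.lap I) - ∑ J, s.k I J * s.lap J - alpha a ρ • s.M I := by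
  have h : s.D 0 (s.ν I) = (a + 1) • s.D (Fin.succ I) s.θ + (a + 1) • (s.θ * s.ν I)
    - ∑ J, s.k I J * s.ν J + alpha a ρ • s.M I := s.D_ν I
  simp only [lap, map_sub, s.D_n, h, mul_sub, Finset.sum_sub_distrib, smul_sub]
  ring

/-- Cyclic sum of the curvature. -/
def B (α β γ l : Fin 4) : A := s.R α β γ l + s.R β γ α l + s.R γ α β l

theorem B_swap (α β γ l : Fin 4) : s.B α β γ l = -s.B β α γ l := by
  simp only [B, R]
  rw [curvR_antisymm _ _ _ β α, curvR_antisymm _ _ _ α γ, curvR_antisymm _ _ _ γ β]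
  ring

theorem B_cyc (α β γ l : Fin 4) : s.B α β γ l = s.B β γ α l := by
  simp only [B]; ring

theorem B_self (α γ l : Fin 4) : s.B α α γ l = 0 := eq_zero_of_eq_neg (s.B_swap α α γ l)

theorem extD2_eq (α β γ l : Fin 4) :
    extD2 s.D s.F (fun α β => s.F α β l) α β γ = ε A l * s.B α β γ l := s.extD2_F α β γ l

theorem B_eq (α β γ l : Fin 4) :
    s.B α β γ l = ε A l * extD2 s.D s.F (fun α β => s.F α β l) α β γ := by
  rw [extD2_eq, ← mul_assoc]
  refine Fin.cases ?_ (fun I => ?_) l <;> simp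

theorem B_0sss (I J K : Fin 3) : s.B 0 I.succ J.succ K.succ =
    kd I K • s.M J - kd J K • s.M I + s.lap I * s.k J K - s.lap J * s.k I K := by
  rw [B_eq, extD2_F_0sss, ε_succ, one_mul]

theorem B_0ss0 (I J : Fin 3) : s.B 0 I.succ J.succ 0 = ∑ K, s.C I J K * s.n K := by
  rw [B_eq, extD2_F_0ss0, ε_zero]; ring

theorem B_sss0 (I J K : Fin 3) : s.B I.succ J.succ K.succ 0 = 0 := by
  rw [B_eq, extD2_F_sss0, mul_zero]

/-- Contracted first Bianchi identity: the trace of the cyclic sum is the antisymmetric part of the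
Ricci contraction, and the matter terms in E are symmetric. -/
theorem sum_B (α β : Fin 4) : ∑ l, ε A l * s.B α β l l = s.E α β - s.E β α := by
  have h : ∀ l, ε A l * s.B α β l l = ε A l * s.R l α β l - ε A l * s.R l β α l := fun l => by
    have h1 : s.R α β l l = 0 :=
      eq_zero_of_eq_neg (curvR_antisymm' s.D s.D_ε s.w_antisymm _ _ _ _)
    have h2 : s.R β l α l = -s.R l β α l := curvR_antisymm _ _ _ _ _ _ _
    rw [B, h1, h2]; ring
  have hg : g A α β = g A β α := by
    by_cases h : α = β
    · rw [h]
    · simp [g, h, Ne.symm h]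
  simp only [h, Finset.sum_sub_distrib, E, hg, ricR]
  ring

theorem sum_B_sss (I J : Fin 3) : ∑ K : Fin 3, s.B I.succ J.succ K.succ K.succ =
    s.E I.succ J.succ - s.E J.succ I.succ + ∑ K, s.C I J K * s.n K := by
  have h := s.sum_B I.succ J.succ
  rw [sum_four] at h
  simp only [ε_zero, ε_succ, one_mul] at h
  rw [← s.B_0ss0, ← h, s.B_cyc 0]
  ring

variable {s} {I : Ideal A}

/-- The ideal need not be stable under the derivations. By Leibniz, a product can still be
differentiated inside it when both the generator and its derivative in that direction belong to it.
-/
theorem D_mul_mem {α : Fin 4} {x : A} (hx : x ∈ I) (hDx : s.D α x ∈ I) (y : A) :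
    s.D α (y * x) ∈ I := by
  rw [Derivation.leibniz, smul_eq_mul, smul_eq_mul]
  exact I.add_mem (I.mul_mem_left _ hDx) (I.mul_mem_right _ hx)

theorem real_smul_mem (r : ℝ) {x : A} (hx : x ∈ I) : r • x ∈ I := by
  rw [Algebra.smul_def]; exact I.mul_mem_left _ hx

namespace Contains
variable (h : s.Contains I)
include h

theorem M (i : Fin 3) : s.M i ∈ I := s.E_s0 i ▸ h.mom i

theorem D_lap (i : Fin 3) : s.D 0 (s.lap i) ∈ I := by
  rw [s.D_lap]
  exact I.sub_mem (I.sub_mem (real_smul_mem _ (I.mul_mem_left _ (h.lap i)))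
    (I.sum_mem fun _ _ => I.mul_mem_left _ (h.lap _))) (real_smul_mem _ (h.M i))

theorem D_C (i j k : Fin 3) : s.D 0 (s.C i j k) ∈ I := by
  rw [s.D_C]
  exact I.add_mem (I.sub_mem (I.sub_mem (I.neg_mem (I.sub_mem (I.add_mem (I.sub_mem
    (real_smul_mem _ (h.M j)) (real_smul_mem _ (h.M i))) (I.mul_mem_right _ (h.lap i)))
    (I.mul_mem_right _ (h.lap j)))) (I.sum_mem fun _ _ => I.mul_mem_left _ (h.C _ _ _)))
    (I.sum_mem fun _ _ => I.mul_mem_left _ (h.C _ _ _)))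
    (I.sum_mem fun _ _ => I.mul_mem_right _ (h.C _ _ _))

theorem P (i j : Fin 3) : s.P i j ∈ I :=
  I.sub_mem (I.add_mem (I.add_mem (h.dlap i j) (I.mul_mem_right _ (h.lap i)))
    (I.mul_mem_left _ (h.lap j))) (I.sum_mem fun _ _ => I.mul_mem_left _ (h.lap _))

theorem H (hρ : 0 < ρ) : s.H ∈ I := by
  rw [s.H_eq_smul hρ]
  exact real_smul_mem _ (I.sub_mem (I.sum_mem fun _ _ => h.P _ _) h.ham)

theorem E (hρ : 0 < ρ) (α β : Fin 4) : s.E α β ∈ I := by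
  have hs : ∀ i, s.E 0 (Fin.succ i) ∈ I := fun i => by
    rw [eq_sub_of_add_eq (s.E_0s i)]
    exact I.sub_mem (I.sub_mem (I.mul_mem_left _ (h.lap i))
      (I.sum_mem fun _ _ => I.mul_mem_left _ (h.lap _))) (h.mom i)
  have hss : ∀ i j, s.E (Fin.succ i) (Fin.succ j) ∈ I := fun i j => by
    have e : s.E (Fin.succ i) (Fin.succ j) =
        (1 / 2 : ℝ) • (s.E (Fin.succ i) (Fin.succ j) - s.E (Fin.succ j) (Fin.succ i))
        - (1 / 2 : ℝ) • (s.P i j + s.P j i) + (kd i j * beta ρ / 3) • s.H := by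
      simp only [E_ss, kd_comm j i]; module
    rw [e]
    exact I.add_mem (I.sub_mem (h.rot i j) (real_smul_mem _ (I.add_mem (h.P _ _) (h.P _ _))))
      (real_smul_mem _ (h.H hρ))
  refine Fin.cases ?_ (fun i => ?_) α <;> refine Fin.cases ?_ (fun j => ?_) β
  exacts [h.ham, hs j, h.mom i, hss i j]

theorem commDefect (α β : Fin 4) (x : A) : commDefect s.D s.F α β x ∈ I := by
  refine Fin.cases ?_ (fun i => ?_) α <;> refine Fin.cases ?_ (fun j => ?_) β
  · rw [commDefect_self]; exact I.zero_mem
  · rw [commDefect_zero]; exact I.zero_mem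
  · rw [commDefect_antisymm, commDefect_zero, neg_zero]; exact I.zero_mem
  · rw [commDefect_succ]; exact I.sum_mem fun _ _ => I.mul_mem_right _ (h.C _ _ _)

/-- The cyclic sum is totally antisymmetric in its first three indices. With a time index it is
given explicitly. With three distinct spatial indices the last index repeats one of them, and the
value is a trace controlled by E_[IJ] and torsion. -/
theorem B (hρ : 0 < ρ) (α β γ l : Fin 4) : s.B α β γ l ∈ I := by
  have h0 : ∀ i j l, s.B 0 (Fin.succ i) (Fin.succ j) l ∈ I := fun i j l => by
    refine Fin.cases ?_ (fun k => ?_) l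
    · rw [B_0ss0]; exact I.sum_mem fun _ _ => I.mul_mem_right _ (h.C _ _ _)
    · rw [B_0sss]
      exact I.sub_mem (I.add_mem (I.sub_mem (real_smul_mem _ (h.M j)) (real_smul_mem _ (h.M i)))
        (I.mul_mem_right _ (h.lap i))) (I.mul_mem_right _ (h.lap j))
  have h00 : ∀ i l, s.B 0 (Fin.succ i) 0 l ∈ I := fun i l => by
    rw [B_cyc, B_cyc, B_self]; exact I.zero_mem
  -- In dimension three the trace over the last pair has only one nonzero term, because the other
  -- two repeat i or j among the first three indices.
  have htr : ∀ i j k : Fin 3, i ≠ j → j ≠ k → i ≠ k →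
      s.B i.succ j.succ k.succ k.succ ∈ I := fun i j k hij hjk hik => by
    have e : s.B i.succ j.succ k.succ k.succ = ∑ K : Fin 3, s.B i.succ j.succ K.succ K.succ := by
      symm
      apply Finset.sum_eq_single k _ fun hk => absurd (Finset.mem_univ k) hk
      intro m _ hm
      have hm' : m = i ∨ m = j := by omega
      rcases hm' with rfl | rfl
      · rw [B_cyc, B_cyc, B_self]
      · rw [B_cyc, B_self]
    rw [e, sum_B_sss]
    exact I.add_mem (I.sub_mem (h.E hρ _ _) (h.E hρ _ _))
      (I.sum_mem fun _ _ => I.mul_mem_right _ (h.C _ _ _))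
  have hs : ∀ i j k l, s.B (Fin.succ i) (Fin.succ j) (Fin.succ k) l ∈ I := fun i j k l => by
    refine Fin.cases ?_ (fun m => ?_) l
    · rw [B_sss0]; exact I.zero_mem
    · by_cases hij : i = j
      · rw [hij, B_self]; exact I.zero_mem
      by_cases hjk : j = k
      · rw [hjk, B_cyc, B_self]; exact I.zero_mem
      by_cases hik : i = k
      · rw [hik, B_cyc, B_cyc, B_self]; exact I.zero_mem
      have hm : m = i ∨ m = j ∨ m = k := by omega
      rcases hm with rfl | rfl | rfl
      · rw [B_cyc]; exact htr _ _ _ hjk (Ne.symm hik) (Ne.symm hij)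
      · rw [B_cyc, B_cyc]; exact htr _ _ _ (Ne.symm hik) hij (Ne.symm hjk)
      · exact htr _ _ _ hij hjk hik
  refine Fin.cases ?_ (fun i => ?_) α <;> refine Fin.cases ?_ (fun j => ?_) β <;>
    refine Fin.cases ?_ (fun k => ?_) γ
  · rw [B_self]; exact I.zero_mem
  · rw [B_self]; exact I.zero_mem
  · exact h00 _ _
  · exact h0 _ _ _
  · rw [B_cyc, B_self]; exact I.zero_mem
  · rw [B_swap]; exact I.neg_mem (h0 _ _ _)
  · rw [B_cyc, B_cyc]; exact h0 _ _ _
  · exact hs _ _ _ _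

theorem extD2_F (hρ : 0 < ρ) (α β γ l : Fin 4) :
    extD2 s.D s.F (fun α β => s.F α β l) α β γ ∈ I := by
  rw [s.extD2_eq]; exact I.mul_mem_left _ (h.B hρ _ _ _ _)

theorem bianchi (hρ : 0 < ρ) (α β γ μ ν : Fin 4) :
    extD2 s.D s.F (extD1 s.D s.F (fun β => s.w β μ ν)) α β γ ∈ I := by
  rw [extD2_extD1]
  exact I.sub_mem (I.add_mem (I.add_mem (h.commDefect _ _ _) (h.commDefect _ _ _))
    (h.commDefect _ _ _)) (I.sum_mem fun _ _ => I.mul_mem_right _ (h.extD2_F hρ _ _ _ _))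

end Contains

variable (s) in
/-- Divergence of the trace-reversed tensor `Y`, times `-2`. -/
def div (Y : Fin 4 → Fin 4 → A) (γ : Fin 4) : A :=
  s.D γ (∑ α, ε A α * Y α α) - 2 * ∑ α, ε A α * (s.D α (Y γ α)
        - ∑ l, ε A l * (s.w α γ l * Y l α + s.w α α l * Y γ l))

theorem div_add (Y Z : Fin 4 → Fin 4 → A) (γ : Fin 4) :
    s.div (fun α β => Y α β + Z α β) γ = s.div Y γ + s.div Z γ := by
  simp only [div, Fin.sum_univ_four, map_add, mul_add]; ring

theorem div_metric (γ : Fin 4) : s.div (fun α β => s.V0 * g A α β) γ = 2 * s.D γ s.V0 := by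
  have h2 : ∀ α, ε A α * ε A α = 1 := fun α => by
    refine Fin.cases ?_ (fun I => ?_) α <;> simp
  have e1 : ∑ α, ε A α * (s.V0 * g A α α) = s.V0 + s.V0 + s.V0 + s.V0 := by
    simp only [Fin.sum_univ_four, g, if_true]
    linear_combination s.V0 * (h2 0 + h2 1 + h2 2 + h2 3)
  have e2 : ∑ α, ε A α * s.D α (s.V0 * g A γ α) = s.D γ s.V0 := by
    rw [Finset.sum_eq_single γ]
    · rw [g, if_pos rfl, Derivation.leibniz, s.D_ε, smul_eq_mul, smul_eq_mul, mul_zero, zero_add,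
        ← mul_assoc, h2, one_mul]
    · intro b _ hb
      rw [g, if_neg (Ne.symm hb), mul_zero, map_zero, mul_zero]
    · simp
  have e3 : ∀ α, ∑ l, ε A l * (s.w α γ l * (s.V0 * g A l α) + s.w α α l * (s.V0 * g A γ l)) = 0 := by
    intro α
    simp only [mul_add, Finset.sum_add_distrib]
    rw [Finset.sum_eq_single α, Finset.sum_eq_single γ]
    · rw [g, g, if_pos rfl, if_pos rfl, s.w_antisymm α γ α]
      linear_combination s.V0 * s.w α α γ * (h2 γ - h2 α)
    · intro b _ hb; rw [g, if_neg (Ne.symm hb)]; ring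
    · simp
    · intro b _ hb; rw [g, if_neg hb]; ring
    · simp
  simp only [div, e1, e3, sub_zero, e2, map_add]
  ring

/-- The scalar stress contributes the wave operator times e_γ φ. Second derivatives of φ commute
only up to torsion, hence the extra defect term. -/
theorem div_scalar (γ : Fin 4) : s.div (fun α β => s.D α s.φ * s.D β s.φ) γ =
    2 * ∑ α, ε A α * s.D α s.φ * commDefect s.D s.F γ α s.φ
    - 2 * s.D γ s.φ * ∑ α, ε A α * (s.D α (s.D α s.φ) - ∑ l, ε A l * s.w α α l * s.D l s.φ) := by
  have hw : ∀ γ, s.w γ 0 0 = 0 ∧ s.w γ 1 1 = 0 ∧ s.w γ 2 2 = 0 ∧ s.w γ 3 3 = 0 :=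
    fun γ => ⟨eq_zero_of_eq_neg (s.w_antisymm _ _ _), eq_zero_of_eq_neg (s.w_antisymm _ _ _),
      eq_zero_of_eq_neg (s.w_antisymm _ _ _), eq_zero_of_eq_neg (s.w_antisymm _ _ _)⟩
  simp only [div, Fin.sum_univ_four, map_add, Derivation.leibniz, smul_eq_mul, D_ε, commDefect, F,
    strucF, s.w_antisymm γ 1 0, s.w_antisymm γ 2 0, s.w_antisymm γ 2 1, s.w_antisymm γ 3 0,
    s.w_antisymm γ 3 1, s.w_antisymm γ 3 2, (hw γ).1, (hw γ).2.1, (hw γ).2.2.1, (hw γ).2.2.2]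
  ring

theorem wave_eq : ∑ α, ε A α * (s.D α (s.D α s.φ) - ∑ l, ε A l * s.w α α l * s.D l s.φ) =
    s.V1 + ∑ i : Fin 3, s.D i.succ s.φ * s.lap i := by
  have ht := s.k_trace
  simp only [Fin.sum_univ_three] at ht
  simp only [sum_four, Fin.sum_univ_three, s.wave, lap, ε_zero, ε_succ, w_000, w_00s, w_ss0, w_sss]
  linear_combination -s.D 0 s.φ * ht

/-- The curvature part lies in the ideal by the contracted Bianchi identity. In the matter part the
wave equation, which holds up to the lapse constraint, makes V' cancel against the derivative of the
potential term. -/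
theorem Contains.div (h : s.Contains I) (hρ : 0 < ρ) (γ : Fin 4) : s.div s.E γ ∈ I := by
  have e : s.div s.E γ = s.div s.Ric γ - s.div (fun α β => s.D α s.φ * s.D β s.φ) γ
      - s.div (fun α β => s.V0 * g A α β) γ := by
    have h1 := div_add (s := s) s.E (fun α β => s.D α s.φ * s.D β s.φ + s.V0 * g A α β) γ
    have h3 := div_add (s := s) (fun α β => s.D α s.φ * s.D β s.φ) (fun α β => s.V0 * g A α β) γ
    have h2 : (fun α β => s.E α β + (s.D α s.φ * s.D β s.φ + s.V0 * g A α β)) = s.Ric := by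
      funext α β; rw [ConstraintSystem.E]; ring
    rw [h2, h3] at h1
    rw [h1]; ring
  have hR : s.div s.Ric γ ∈ I := by
    rw [ConstraintSystem.div, ← sum_covR s.D s.D_ε s.w_antisymm]
    refine I.sum_mem fun α _ => I.sum_mem fun β _ => I.mul_mem_left _ ?_
    rw [FrameCalculus.bianchi s.D s.D_ε s.w_antisymm]
    exact h.bianchi hρ _ _ _ _ _
  rw [e, div_scalar, div_metric, wave_eq, s.D_V0]
  have e2 : ∀ x y z : A, x - (2 * y - 2 * s.D γ s.φ * (s.V1 + z)) - 2 * (s.V1 * s.D γ s.φ) =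
    x - 2 * y + 2 * s.D γ s.φ * z := fun x y z => by ring
  rw [e2]
  exact I.add_mem (I.sub_mem hR (I.mul_mem_left _ (I.sum_mem fun _ _ => I.mul_mem_left _
    (h.commDefect _ _ _)))) (I.mul_mem_left _ (I.sum_mem fun _ _ => I.mul_mem_left _ (h.lap _)))

end ConstraintSystem
end FrameCalculus

/-! ### Evolution of the constraints modulo the ideal -/

namespace FrameCalculus
namespace ConstraintSystem
variable {a ρ : ℝ} {A : Type*} [CommRing A] [Algebra ℝ A] {s : ConstraintSystem a ρ A} {I : Ideal A}
namespace Contains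
variable (h : s.Contains I)
include h

theorem D_succ_P (l i j : Fin 3) :
    s.D l.succ (s.P i j) - s.D l.succ (s.D i.succ (s.lap j)) ∈ I := by
  have e : s.D l.succ (s.P i j) - s.D l.succ (s.D i.succ (s.lap j)) =
      s.D l.succ (s.n j * s.lap i) + s.D l.succ (s.ν i * s.lap j)
      - ∑ m, s.D l.succ (s.Γ i j m * s.lap m) := by
    rw [ConstraintSystem.P, map_sub, map_add, map_add, map_sum, mul_comm (s.lap i)]; ring
  rw [e]
  exact I.sub_mem (I.add_mem (D_mul_mem (h.lap i) (h.dlap _ _) _)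
    (D_mul_mem (h.lap j) (h.dlap _ _) _))
    (I.sum_mem fun _ _ => D_mul_mem (h.lap _) (h.dlap _ _) _)

/-- Commuting e_0 past e_i costs only first derivatives of the lapse constraint, and the momentum
term of `D_lap` becomes the principal part. -/
theorem D_dlap (i j : Fin 3) :
    s.D 0 (s.D i.succ (s.lap j)) + alpha a ρ • s.D i.succ (s.E j.succ 0) ∈ I := by
  have e : s.D 0 (s.D i.succ (s.lap j)) + alpha a ρ • s.D i.succ (s.E j.succ 0) =
      (a + 1) • s.D i.succ (s.θ * s.lap j) - ∑ m, s.D i.succ (s.k j m * s.lap m)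
      + s.n i * s.D 0 (s.lap j) - ∑ m, s.k i m * s.D m.succ (s.lap j) := by
    rw [s.comm_zero, s.D_lap j, E_s0, map_sub, map_sub, map_sum, Derivation.map_smul,
      Derivation.map_smul]
    ring
  rw [e]
  exact I.sub_mem (I.add_mem (I.sub_mem (real_smul_mem _ (D_mul_mem (h.lap _) (h.dlap _ _) _))
    (I.sum_mem fun _ _ => D_mul_mem (h.lap _) (h.dlap _ _) _)) (I.mul_mem_left _ (h.D_lap j)))
    (I.sum_mem fun _ _ => I.mul_mem_left _ (h.dlap _ _))

theorem D_zero_P (i j : Fin 3) :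
    s.D 0 (s.P i j) + alpha a ρ • s.D i.succ (s.E j.succ 0) ∈ I := by
  have e : s.D 0 (s.P i j) + alpha a ρ • s.D i.succ (s.E j.succ 0) =
      (s.D 0 (s.D i.succ (s.lap j)) + alpha a ρ • s.D i.succ (s.E j.succ 0))
      + s.D 0 (s.n j * s.lap i) + s.D 0 (s.ν i * s.lap j)
      - ∑ m, s.D 0 (s.Γ i j m * s.lap m) := by
    rw [ConstraintSystem.P, map_sub, map_add, map_add, map_sum, mul_comm (s.lap i)]; ring
  rw [e]
  exact I.sub_mem (I.add_mem (I.add_mem (h.D_dlap i j) (D_mul_mem (h.lap i) (h.D_lap _) _))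
    (D_mul_mem (h.lap j) (h.D_lap _) _))
    (I.sum_mem fun _ _ => D_mul_mem (h.lap _) (h.D_lap _) _)

theorem D_succ_E_add (l i : Fin 3) :
    s.D l.succ (s.E 0 i.succ) + s.D l.succ (s.E i.succ 0) ∈ I := by
  rw [← map_add, s.E_0s, map_sub, map_sum]
  exact I.sub_mem (D_mul_mem (h.lap _) (h.dlap _ _) _)
    (I.sum_mem fun _ _ => D_mul_mem (h.lap _) (h.dlap _ _) _)

/-- The divergence identity without the connection terms. -/
theorem D_sum_E (hρ : 0 < ρ) (γ : Fin 4) :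
    s.D γ (∑ i : Fin 3, s.E i.succ i.succ - s.E 0 0)
      - 2 * (∑ i : Fin 3, s.D i.succ (s.E γ i.succ) - s.D 0 (s.E γ 0)) ∈ I := by
  have e : s.D γ (∑ i : Fin 3, s.E i.succ i.succ - s.E 0 0)
      - 2 * (∑ i : Fin 3, s.D i.succ (s.E γ i.succ) - s.D 0 (s.E γ 0)) = s.div s.E γ
      - 2 * ∑ α, ε A α * ∑ l, ε A l * (s.w α γ l * s.E l α + s.w α α l * s.E γ l) := by
    have h1 : ∑ α, ε A α * s.E α α = ∑ i : Fin 3, s.E i.succ i.succ - s.E 0 0 := by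
      rw [sum_four]; simp only [ε_zero, ε_succ, one_mul]; ring
    have h2 : ∑ α, ε A α * s.D α (s.E γ α) =
        ∑ i : Fin 3, s.D i.succ (s.E γ i.succ) - s.D 0 (s.E γ 0) := by
      rw [sum_four]; simp only [ε_zero, ε_succ, one_mul]; ring
    rw [ConstraintSystem.div, h1, ← h2]
    simp only [mul_sub, Finset.sum_sub_distrib]
    ring
  rw [e]
  exact I.sub_mem (h.div hρ γ) (I.mul_mem_left _ (I.sum_mem fun _ _ => I.mul_mem_left _
    (I.sum_mem fun _ _ => I.mul_mem_left _ (I.add_mem (I.mul_mem_left _ (h.E hρ _ _))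
    (I.mul_mem_left _ (h.E hρ _ _))))))

/-- The time component of the divergence identity, with ∑ E_II - E_00 replaced by 6ρ ∑ P_II - (6ρ +
2)E_00. After division by 6ρ, the flux E_0I = -E_I0 + … contributes 1/(3ρ) and the time derivative
of P contributes -α. -/
theorem D_ham (hρ : 0 < ρ) : s.D 0 (s.E 0 0)
    - (1 / (3 * ρ) - alpha a ρ) • ∑ i : Fin 3, s.D i.succ (s.E i.succ 0) ∈ I := by
  have hE : ∑ i : Fin 3, s.E i.succ i.succ - s.E 0 0 =
      (6 * ρ) • ∑ i, s.P i i - (6 * ρ + 2) • s.E 0 0 := by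
    have h1 := s.H_eq_smul hρ
    rw [← sum_E_ss_add, smul_sub] at h1
    linear_combination (norm := module) h1
  have e : s.D 0 (s.E 0 0)
      - (1 / (3 * ρ) - alpha a ρ) • ∑ i : Fin 3, s.D i.succ (s.E i.succ 0) =
      (1 / (6 * ρ)) • ((6 * ρ) • (∑ i, (s.D 0 (s.P i i) + alpha a ρ • s.D i.succ (s.E i.succ 0)))
      - 2 * ∑ i : Fin 3, (s.D i.succ (s.E 0 i.succ) + s.D i.succ (s.E i.succ 0))
      - (s.D 0 (∑ i : Fin 3, s.E i.succ i.succ - s.E 0 0)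
      - 2 * (∑ i : Fin 3, s.D i.succ (s.E 0 i.succ) - s.D 0 (s.E 0 0)))) := by
    rw [hE, map_sub, Derivation.map_smul, Derivation.map_smul, map_sum]
    simp only [Finset.sum_add_distrib, ← Finset.smul_sum, two_mul]
    match_scalars <;> field_simp <;> ring
  rw [e]
  exact real_smul_mem _ (I.sub_mem (I.sub_mem (real_smul_mem _ (I.sum_mem fun i _ =>
    h.D_zero_P i i)) (I.mul_mem_left _ (I.sum_mem fun i _ => h.D_succ_E_add i i)))
    (h.D_sum_E hρ 0))

/-- The spatial component of the divergence identity, with E_IJ split into its antisymmetric part,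
the symmetrized P and the trace part in H. The coefficient 2/3 + ρ is (3ρ + 1) - (1 + 6ρ)/3, from
the gradient of the trace and the divergence of the trace part. -/
theorem D_mom (hρ : 0 < ρ) (i : Fin 3) : s.D 0 (s.E i.succ 0)
    - ((2 / 3 + ρ) • s.D i.succ (s.E 0 0)
      - (1 / 2 : ℝ) • ∑ m : Fin 3, s.D m.succ (s.D m.succ (s.lap i))
      - (1 / 6 * (1 + 6 * ρ)) • ∑ m : Fin 3, s.D i.succ (s.D m.succ (s.lap m))
      + ∑ m : Fin 3, s.D m.succ
        ((1 / 2 : ℝ) • (s.E i.succ m.succ - s.E m.succ i.succ))) ∈ I := by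
  have h1 := s.H_eq_smul hρ
  have hE : ∑ i : Fin 3, s.E i.succ i.succ - s.E 0 0 =
      (6 * ρ) • ∑ i, s.P i i - (6 * ρ + 2) • s.E 0 0 := by
    rw [← sum_E_ss_add, smul_sub] at h1
    linear_combination (norm := module) h1
  have hb : beta ρ • s.H = (1 + 6 * ρ) • (∑ i, s.P i i - s.E 0 0) := by
    rw [h1, smul_smul, beta]
    congr 1
    field_simp
  have hm : ∑ m : Fin 3, s.D m.succ (s.E i.succ m.succ) =
      ∑ m : Fin 3, s.D m.succ ((1 / 2 : ℝ) • (s.E i.succ m.succ - s.E m.succ i.succ))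
      - (1 / 2 : ℝ) • ∑ m : Fin 3, (s.D m.succ (s.P i m) + s.D m.succ (s.P m i))
      + ((1 + 6 * ρ) / 3) • (s.D i.succ (∑ m, s.P m m) - s.D i.succ (s.E 0 0)) := by
    have h2 : ∀ m : Fin 3, s.D m.succ (s.E i.succ m.succ) =
      s.D m.succ ((1 / 2 : ℝ) • (s.E i.succ m.succ - s.E m.succ i.succ))
      - (1 / 2 : ℝ) • (s.D m.succ (s.P i m) + s.D m.succ (s.P m i))
      + kd i m • s.D m.succ ((1 / 3 : ℝ) • beta ρ • s.H) := fun m => by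
      rw [← Derivation.map_smul, ← map_add, ← Derivation.map_smul, ← map_sub, ← map_add]
      congr 1
      simp only [E_ss, kd_comm m i]
      module
    have h3 : ∑ m : Fin 3, kd i m • s.D m.succ ((1 / 3 : ℝ) • beta ρ • s.H) =
      s.D i.succ ((1 / 3 : ℝ) • beta ρ • s.H) := by simp [kd]
    rw [Finset.sum_congr rfl fun m _ => h2 m, Finset.sum_add_distrib, Finset.sum_sub_distrib,
      ← Finset.smul_sum, h3, hb, Derivation.map_smul, Derivation.map_smul, map_sub]
    module
  -- The divergence yields e_m e_i 𝒩_m whereas the principal part has e_i e_m 𝒩_m; exchanging the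
  -- order costs torsion and first derivatives of 𝒩.
  have hc : ∑ m : Fin 3, s.D i.succ (s.D m.succ (s.lap m)) =
      ∑ m : Fin 3, s.D m.succ (s.D i.succ (s.lap m))
      + ∑ m : Fin 3, FrameCalculus.commDefect s.D s.F i.succ m.succ (s.lap m)
      + ∑ m : Fin 3, ∑ l, s.F i.succ m.succ l * s.D l (s.lap m) := by
    simp only [FrameCalculus.commDefect, ← Finset.sum_add_distrib]
    exact Finset.sum_congr rfl fun m _ => by ring
  have e : s.D 0 (s.E i.succ 0)
    - ((2 / 3 + ρ) • s.D i.succ (s.E 0 0)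
      - (1 / 2 : ℝ) • ∑ m : Fin 3, s.D m.succ (s.D m.succ (s.lap i))
      - (1 / 6 * (1 + 6 * ρ)) • ∑ m : Fin 3, s.D i.succ (s.D m.succ (s.lap m))
      + ∑ m : Fin 3, s.D m.succ
        ((1 / 2 : ℝ) • (s.E i.succ m.succ - s.E m.succ i.succ))) =
      (1 / 2 : ℝ) • (s.D i.succ (∑ i : Fin 3, s.E i.succ i.succ - s.E 0 0)
      - 2 * (∑ m : Fin 3, s.D m.succ (s.E i.succ m.succ) - s.D 0 (s.E i.succ 0)))
      - (1 / 2 : ℝ) • ∑ m, (s.D m.succ (s.P i m) - s.D m.succ (s.D i.succ (s.lap m)))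
      - (1 / 2 : ℝ) • ∑ m, (s.D m.succ (s.P m i) - s.D m.succ (s.D m.succ (s.lap i)))
      + (1 / 3 - ρ) • ∑ m, (s.D i.succ (s.P m m) - s.D i.succ (s.D m.succ (s.lap m)))
      + (1 / 2 : ℝ) • (∑ m : Fin 3, FrameCalculus.commDefect s.D s.F i.succ m.succ (s.lap m)
      + ∑ m : Fin 3, ∑ l, s.F i.succ m.succ l * s.D l (s.lap m)) := by
    rw [hE, hm, map_sub, Derivation.map_smul, Derivation.map_smul, map_sum]
    simp only [Finset.sum_add_distrib, Finset.sum_sub_distrib, two_mul]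
    linear_combination (norm := module) (1 / 2 : ℝ) • hc
  have hl : ∀ α i, s.D α (s.lap i) ∈ I := fun α i => by
    refine Fin.cases (h.D_lap i) (fun j => h.dlap j i) α
  rw [e]
  exact I.add_mem (I.add_mem (I.sub_mem (I.sub_mem (real_smul_mem _ (h.D_sum_E hρ i.succ))
    (real_smul_mem _ (I.sum_mem fun m _ => h.D_succ_P _ _ _)))
    (real_smul_mem _ (I.sum_mem fun m _ => h.D_succ_P _ _ _)))
    (real_smul_mem _ (I.sum_mem fun m _ => h.D_succ_P _ _ _)))
    (real_smul_mem _ (I.add_mem (I.sum_mem fun _ _ => h.commDefect _ _ _)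
    (I.sum_mem fun _ _ => I.sum_mem fun _ _ => I.mul_mem_left _ (hl _ _))))

/-- `extD2_closed` for the two form F with fixed upper index: modulo the ideal, the exterior
derivative of the Jacobi defect vanishes, which expresses its time derivative by spatial ones. -/
theorem D_B (hρ : 0 < ρ) (i j k l : Fin 3) : s.D 0 (s.B i.succ j.succ k.succ l.succ)
    - (s.D i.succ (s.B 0 j.succ k.succ l.succ) - s.D j.succ (s.B 0 i.succ k.succ l.succ)
    + s.D k.succ (s.B 0 i.succ j.succ l.succ)) ∈ I := by
  have key := extD2_closed s.D s.F (fun α β l => strucF_antisymm (ε A) s.w α β l)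
    (fun α β => s.F α β l.succ) (fun α β => strucF_antisymm (ε A) s.w α β l.succ)
    0 i.succ j.succ k.succ
  have hB : ∀ α β γ, extD2 s.D s.F (fun α β => s.F α β l.succ) α β γ = s.B α β γ l.succ :=
    fun α β γ => by rw [extD2_eq, ε_succ, one_mul]
  simp only [hB] at key
  have e : s.D 0 (s.B i.succ j.succ k.succ l.succ)
    - (s.D i.succ (s.B 0 j.succ k.succ l.succ) - s.D j.succ (s.B 0 i.succ k.succ l.succ)
    + s.D k.succ (s.B 0 i.succ j.succ l.succ)) = s.D 0 (s.B i.succ j.succ k.succ l.succ)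
    - s.D i.succ (s.B 0 j.succ k.succ l.succ) + s.D j.succ (s.B 0 i.succ k.succ l.succ)
    - s.D k.succ (s.B 0 i.succ j.succ l.succ) := by ring
  rw [e, key]
  have hF := fun α β γ l => h.extD2_F hρ α β γ l
  have hd := h.commDefect
  have hB' := h.B hρ
  refine I.sub_mem (I.add_mem (I.add_mem (I.sub_mem (I.add_mem (I.add_mem (I.sub_mem
    (hd _ _ _) (hd _ _ _)) (hd _ _ _)) (hd _ _ _)) (hd _ _ _)) (hd _ _ _))
    (I.sum_mem fun m _ => ?_)) (I.sum_mem fun m _ => ?_)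
  · exact I.add_mem (I.sub_mem (I.add_mem (I.add_mem (I.sub_mem (I.mul_mem_left _ (hB' _ _ _ _))
      (I.mul_mem_left _ (hB' _ _ _ _))) (I.mul_mem_left _ (hB' _ _ _ _)))
      (I.mul_mem_left _ (hB' _ _ _ _))) (I.mul_mem_left _ (hB' _ _ _ _)))
      (I.mul_mem_left _ (hB' _ _ _ _))
  · exact I.sub_mem (I.add_mem (I.sub_mem (I.mul_mem_right _ (hF _ _ _ _))
      (I.mul_mem_right _ (hF _ _ _ _))) (I.mul_mem_right _ (hF _ _ _ _)))
      (I.mul_mem_right _ (hF _ _ _ _))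

theorem D_B_zero (l i j k : Fin 3) : s.D l.succ (s.B 0 i.succ j.succ k.succ)
    - (kd i k • s.D l.succ (s.E j.succ 0) - kd j k • s.D l.succ (s.E i.succ 0)) ∈ I := by
  have e : s.D l.succ (s.B 0 i.succ j.succ k.succ)
    - (kd i k • s.D l.succ (s.E j.succ 0) - kd j k • s.D l.succ (s.E i.succ 0)) =
    s.D l.succ (s.k j k * s.lap i) - s.D l.succ (s.k i k * s.lap j) := by
    rw [B_0sss, E_s0, E_s0, map_sub, map_add, map_sub, Derivation.map_smul, Derivation.map_smul,
      mul_comm (s.lap i), mul_comm (s.lap j)]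
    ring
  rw [e]
  exact I.sub_mem (D_mul_mem (h.lap _) (h.dlap _ _) _) (D_mul_mem (h.lap _) (h.dlap _ _) _)

/-- Trace of `D_B` over the last two spatial indices. By `sum_B_sss` the left side is twice E_[IJ]
up to torsion, and `D_B_zero` evaluates the right side by derivatives of E_I0. -/
theorem D_rot (hρ : 0 < ρ) (i j : Fin 3) :
    s.D 0 ((1 / 2 : ℝ) • (s.E i.succ j.succ - s.E j.succ i.succ))
    - (1 / 2 : ℝ) • (s.D j.succ (s.E i.succ 0) - s.D i.succ (s.E j.succ 0)) ∈ I := by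
  have h1 := congrArg (s.D 0) (s.sum_B_sss i j)
  rw [map_add, map_sum] at h1
  have hC : s.D 0 (∑ K, s.C i j K * s.n K) ∈ I := by
    rw [map_sum]
    exact I.sum_mem fun k _ => by
      rw [mul_comm]; exact D_mul_mem (h.C _ _ _) (h.D_C _ _ _) _
  have h11 : kd 0 0 = 1 ∧ kd 1 1 = 1 ∧ kd 2 2 = 1 := by simp [kd]
  have s1 : ∀ l i, ∑ m, kd m i • s.D l (s.E m.succ 0) = s.D l (s.E i.succ 0) := by simp [kd]
  have s2 : ∀ i j, ∑ m, kd m i • s.D m.succ (s.E j 0) = s.D i.succ (s.E j 0) := by simp [kd]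
  have s3 : ∀ l i j, ∑ m, kd m i • s.D l (s.E j 0) = s.D l (s.E j 0) := by simp [kd]
  have e : s.D 0 ((1 / 2 : ℝ) • (s.E i.succ j.succ - s.E j.succ i.succ))
    - (1 / 2 : ℝ) • (s.D j.succ (s.E i.succ 0) - s.D i.succ (s.E j.succ 0)) =
    (1 / 2 : ℝ) • (∑ m : Fin 3, (s.D 0 (s.B i.succ j.succ m.succ m.succ)
    - (s.D i.succ (s.B 0 j.succ m.succ m.succ) - s.D j.succ (s.B 0 i.succ m.succ m.succ)
    + s.D m.succ (s.B 0 i.succ j.succ m.succ)))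
    + (∑ m : Fin 3, (s.D i.succ (s.B 0 j.succ m.succ m.succ)
      - (kd j m • s.D i.succ (s.E m.succ 0) - kd m m • s.D i.succ (s.E j.succ 0))))
    - (∑ m : Fin 3, (s.D j.succ (s.B 0 i.succ m.succ m.succ)
      - (kd i m • s.D j.succ (s.E m.succ 0) - kd m m • s.D j.succ (s.E i.succ 0))))
    + (∑ m : Fin 3, (s.D m.succ (s.B 0 i.succ j.succ m.succ)
      - (kd i m • s.D m.succ (s.E j.succ 0) - kd j m • s.D m.succ (s.E i.succ 0))))
    - s.D 0 (∑ K, s.C i j K * s.n K)) := by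
    have a1 := s1 i.succ j
    have a2 := s1 j.succ i
    have a3 := s2 i j.succ
    have a4 := s2 j i.succ
    simp only [kd_comm _ i, kd_comm _ j, Fin.sum_univ_three, h11.1, h11.2.1, h11.2.2]
      at h1 a1 a2 a3 a4 ⊢
    rw [Derivation.map_smul]
    linear_combination (norm := module) (-1 / 2 : ℝ) • h1 + (1 / 2 : ℝ) • a1 - (1 / 2 : ℝ) • a2
      + (1 / 2 : ℝ) • a3 - (1 / 2 : ℝ) • a4
  rw [e]
  exact real_smul_mem _ (I.sub_mem (I.add_mem (I.sub_mem (I.add_mem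
    (I.sum_mem fun _ _ => h.D_B hρ _ _ _ _) (I.sum_mem fun _ _ => h.D_B_zero _ _ _ _))
    (I.sum_mem fun _ _ => h.D_B_zero _ _ _ _)) (I.sum_mem fun _ _ => h.D_B_zero _ _ _ _)) hC)

end Contains
end ConstraintSystem
end FrameCalculus

/-! ### Smoothness of coefficients in a frame -/

section frame
variable {E : Type*} [NormedAddCommGroup E] [NormedSpace ℝ E] [FiniteDimensional ℝ E]
  {H : Type*} [TopologicalSpace H] {I : ModelWithCorners ℝ E H}
  {M : Type*} [TopologicalSpace M] [ChartedSpace H M] [IsManifold I ∞ M]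

/-- The coefficients of a smooth vector field in a smooth frame are smooth. -/
theorem contMDiffAt_frame_coeff {m : ℕ} {s : Fin m → Π x : M, TangentSpace I x}
    {Z : Π x : M, TangentSpace I x} {c : Fin m → M → ℝ} {x₀ : M}
    (hs : ∀ i, ContMDiffAt I I.tangent ∞ (fun x => (⟨x, s i x⟩ : TangentBundle I M)) x₀)
    (hZ : ContMDiffAt I I.tangent ∞ (fun x => (⟨x, Z x⟩ : TangentBundle I M)) x₀)
    (hc : ∀ x, Z x = ∑ i, c i x • s i x) (hli : LinearIndependent ℝ (fun i => s i x₀))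
    (hm : m = Module.finrank ℝ E) (i : Fin m) : ContMDiffAt I 𝓘(ℝ, ℝ) ∞ (c i) x₀ := by
  have : IsManifold I 1 M := IsManifold.of_le (n := ∞) (by simp)
  let e := trivializationAt E (TangentSpace I : M → Type _) x₀
  let v : Fin m → M → E := fun i x => (e ⟨x, s i x⟩).2
  let w : M → E := fun x => (e ⟨x, Z x⟩).2
  have hv : ∀ i, ContMDiffAt I 𝓘(ℝ, E) ∞ (v i) x₀ := fun i =>
    (Bundle.contMDiffAt_section (F := E) (E := (TangentSpace I : M → Type _)) x₀).1 (hs i)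
  have hw : ContMDiffAt I 𝓘(ℝ, E) ∞ w x₀ :=
    (Bundle.contMDiffAt_section (F := E) (E := (TangentSpace I : M → Type _)) x₀).1 hZ
  -- L x is the frame as a linear map in a trivialization. It is invertible at x₀, and inversion is
  -- smooth, so the coefficients L⁻¹w are smooth nearby.
  let L : M → (Fin m → ℝ) →L[ℝ] E := fun x =>
    ∑ i, (ContinuousLinearMap.proj (R := ℝ) (φ := fun _ : Fin m => ℝ) i).smulRight (v i x)
  have hL : ContMDiffAt I 𝓘(ℝ, (Fin m → ℝ) →L[ℝ] E) ∞ L x₀ := by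
    refine ContMDiffAt.sum fun i _ => ?_
    exact (ContinuousLinearMap.smulRightL ℝ (Fin m → ℝ) E
      (ContinuousLinearMap.proj (R := ℝ) (φ := fun _ : Fin m => ℝ) i)).contMDiff.contMDiffAt.comp
        x₀ (hv i)
  have hb : e.baseSet ∈ 𝓝 x₀ := e.open_baseSet.mem_nhds (FiberBundle.mem_baseSet_trivializationAt' x₀)
  have hLc : ∀ (x) (hx : x ∈ e.baseSet) (d : Fin m → ℝ),
      L x d = e.linearEquivAt ℝ x hx (∑ i, d i • s i x) := fun x hx d => by
    rw [map_sum]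
    simp only [L, sum_apply, map_smul]
    rfl
  have hx0 : x₀ ∈ e.baseSet := mem_of_mem_nhds hb
  have hinj : Function.Injective (L x₀) := by
    refine (injective_iff_map_eq_zero (L x₀)).2 fun d hd => ?_
    rw [hLc x₀ hx0, LinearEquiv.map_eq_zero_iff] at hd
    funext j
    exact (Fintype.linearIndependent_iff.1 hli) d hd j
  let eq0 : (Fin m → ℝ) ≃L[ℝ] E := (LinearEquiv.ofInjectiveOfFinrankEq (L x₀ : (Fin m → ℝ) →ₗ[ℝ] E)
    hinj (by simp [hm])).toContinuousLinearEquiv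
  have heq0 : (eq0 : (Fin m → ℝ) →L[ℝ] E) = L x₀ := by
    ext1 d; rfl
  have hinv : ContMDiffAt I 𝓘(ℝ, E →L[ℝ] (Fin m → ℝ)) ∞
      (fun x => ContinuousLinearMap.inverse (L x)) x₀ := by
    have h1 : ContDiffAt ℝ ∞ ContinuousLinearMap.inverse (L x₀) :=
      heq0 ▸ contDiffAt_map_inverse eq0
    exact h1.contMDiffAt.comp x₀ hL
  have hall : ContMDiffAt I 𝓘(ℝ, Fin m → ℝ) ∞
      (fun x => ContinuousLinearMap.inverse (L x) (w x)) x₀ := hinv.clm_apply hw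
  have hev : ∀ᶠ x in 𝓝 x₀, (fun i => c i x) = ContinuousLinearMap.inverse (L x) (w x) := by
    have h1 : ∀ᶠ x in 𝓝 x₀, L x ∈ range ((↑) : ((Fin m → ℝ) ≃L[ℝ] E) → (Fin m → ℝ) →L[ℝ] E) :=
      hL.continuousAt (heq0 ▸ ContinuousLinearEquiv.nhds eq0)
    filter_upwards [h1, hb] with x hx hxb
    obtain ⟨q, hq⟩ := hx
    have h2 : w x = L x (fun i => c i x) := by
      rw [hLc x hxb, ← hc x]; rfl
    rw [h2, ← hq, ContinuousLinearMap.inverse_equiv]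
    exact (q.symm_apply_apply _).symm
  have hpi := contMDiffAt_pi_space.1 (hall.congr_of_eventuallyEq hev) i
  exact hpi

end frame

namespace EinsteinScalar
section
variable {S : Type*} [TopologicalSpace S] [ChartedSpace (EuclideanSpace ℝ (Fin 3)) S]
  [IsManifold (𝓡 3) ∞ S]

theorem contMDiff_struc (E : RefFrame S) (i j k : Fin 3) :
    ContMDiff stModel 𝓘(ℝ, ℝ) ∞ (E.struc i j k) := by
  intro p
  -- The fields E_i only span the slices; ∂_t is added to obtain a frame of the spacetime, in which
  -- the bracket has zero time coefficient.
  let s : Fin 4 → VField S := Fin.cons dt E.vf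
  have h := contMDiffAt_frame_coeff (I := stModel) (M := ℝ × S) (m := 4) (s := s)
    (Z := VectorField.mlieBracket stModel (E.vf i) (E.vf j))
    (c := Fin.cons (fun _ => 0) (E.struc i j)) (x₀ := p) ?_ ?_ ?_ ?_ ?_ k.succ
  · exact h
  · intro l
    refine Fin.cases ?_ (fun l => ?_) l
    · exact (smoothVF_dt univ).contMDiffAt Filter.univ_mem
    · exact (smoothVF_vf E l univ).contMDiffAt Filter.univ_mem
  · have : IsManifold stModel (minSmoothness ℝ 2) (ℝ × S) :=
      IsManifold.of_le (n := ∞) (by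
        rw [minSmoothness_of_isRCLikeNormedField]; exact WithTop.coe_le_coe.2 le_top)
    have : IsManifold stModel (minSmoothness ℝ 3) (ℝ × S) :=
      IsManifold.of_le (n := ∞) (by
        rw [minSmoothness_of_isRCLikeNormedField]; exact WithTop.coe_le_coe.2 le_top)
    have : IsManifold stModel (((⊤ : ℕ∞) : WithTop ℕ∞) + 1) (ℝ × S) :=
      IsManifold.of_le (n := ∞) (WithTop.coe_le_coe.2 le_top)
    refine ContMDiffAt.mlieBracket_vectorField (m := ⊤) (n := ⊤) ?_ ?_ ?_
    · exact (smoothVF_vf E i univ).contMDiffAt Filter.univ_mem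
    · exact (smoothVF_vf E j univ).contMDiffAt Filter.univ_mem
    · simp
  · intro x
    rw [mlieBracket_vf, Fin.sum_univ_succ]
    simp only [s, Fin.cons_zero, Fin.cons_succ]
    exact (zero_add _).symm.trans (congrArg (· + _) (zero_smul ℝ _).symm)
  · rw [Fintype.linearIndependent_iff]
    intro g hg
    rw [Fin.sum_univ_succ] at hg
    simp only [s, Fin.cons_zero, Fin.cons_succ] at hg
    have h1 : g 0 = 0 := by
      have := congrArg Prod.fst hg
      have h2 : (∑ i : Fin 3, g i.succ • E.vf i p).1 = 0 := by
        refine (Prod.fst_sum).trans (Finset.sum_eq_zero fun k _ => mul_zero _)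
      have h3 : (g 0 • (dt p : TangentSpace stModel p)).1 = g 0 := mul_one _
      exact (h3.symm.trans ((add_zero _).symm.trans (congrArg (_ + ·) h2.symm))).trans this
    have h2 : ∑ i : Fin 3, g i.succ • E.basis p.2 i = 0 := by
      have := congrArg Prod.snd hg
      have h3 : (g 0 • (dt p : TangentSpace stModel p)).2 = 0 :=
        (smul_zero (g 0) : g 0 • (0 : EuclideanSpace ℝ (Fin 3)) = 0)
      have h4 : (∑ i : Fin 3, g i.succ • E.vf i p).2 = ∑ i : Fin 3, g i.succ • E.basis p.2 i :=
        Prod.snd_sum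
      exact (h4.symm.trans ((zero_add _).symm.trans (congrArg (· + _) h3.symm))).trans this
    have h3 := (Fintype.linearIndependent_iff.1 (E.basis p.2).linearIndependent) _ h2
    intro l
    exact Fin.cases h1 h3 l
  · simp
end
end EinsteinScalar

/-! ### Differential polynomials evaluated on all solutions at once -/

noncomputable section
namespace EinsteinScalar
universe v

/-- Solutions of the modified system with admissible data. -/
structure Sol (a ρ : ℝ) where
  S : Type v
  [top : TopologicalSpace S]
  [charted : ChartedSpace (EuclideanSpace ℝ (Fin 3)) S]
  [mfd : IsManifold (𝓡 3) ∞ S]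
  E : RefFrame S
  u : Unknowns S
  V : ℝ → ℝ
  T : ℝ
  δ : ℝ
  hV : ContDiff ℝ ∞ V
  hδ : 0 < δ
  hT : δ ≤ T
  hu : IsModifiedSolution E u a ρ V T δ
  hd : HasAdmissibleData E u T

attribute [instance] Sol.top Sol.charted Sol.mfd

namespace Sol
variable {a ρ : ℝ} (X : Sol.{v} a ρ)

/-- The domain of a solution. -/
abbrev dom : Set (ℝ × X.S) := slab X.S X.T X.δ

theorem isOpen_dom : IsOpen X.dom := isOpen_slab

theorem N_pos {p : ℝ × X.S} (hp : p ∈ X.dom) : 0 < X.u.N p := X.hu.lapse_pos X.hd X.hδ X.hT hp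

theorem smoothOn_inv_N : SmoothOn X.T X.δ (fun p => (X.u.N p)⁻¹) := fun p hp =>
  ((contDiffAt_inv ℝ (X.N_pos hp).ne').contMDiffAt (x := X.u.N p)).comp_contMDiffWithinAt p
    (X.hu.smooth_N p hp)

theorem smoothOn_base (b : CoefBase) : SmoothOn X.T X.δ (b.val X.E X.u X.V) := by
  cases b with
  | e I i => exact X.hu.smooth_e I i
  | om I i => exact X.hu.smooth_om I i
  | N => exact X.hu.smooth_N
  | invN => exact X.smoothOn_inv_N
  | shear I J => exact X.hu.smooth_shear I J
  | Gam I J K => exact X.hu.smooth_Gam I J K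
  | dN I => exact X.hu.smooth_dN I
  | theta => exact X.hu.smooth_theta
  | phit => exact X.hu.smooth_phit
  | dphi I => exact X.hu.smooth_dphi I
  | phi => exact X.hu.smooth_phi
  | invT => exact smoothOn_inv_time X.hT
  | pot n =>
    have h : ContDiff ℝ ∞ (iteratedDeriv n X.V) := by
      rw [iteratedDeriv_eq_iterate]; exact ContDiff.iterate_deriv n X.hV
    exact h.contMDiff.comp_contMDiffOn X.hu.smooth_phi
  | struc i j k => exact (contMDiff_struc X.E i j k).contMDiffOn

theorem smoothVF_fr (α : Fin 4) : SmoothVF (fr X.E X.u α) X.dom := by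
  refine Fin.cases ?_ (fun I => ?_) α
  · exact smoothVF_e0 X.hu.smooth_N fun p hp => (X.N_pos hp).ne'
  · exact smoothVF_eS X.hu.smooth_e I

theorem smoothOn_dirD (α : Fin 4) {f : ℝ × X.S → ℝ} (hf : SmoothOn X.T X.δ f) :
    SmoothOn X.T X.δ (dirD (fr X.E X.u α) f) :=
  (X.smoothVF_fr α).dirD X.isOpen_dom hf

theorem smoothOn_atom (A : CoefAtom) : SmoothOn X.T X.δ (A.val X.E X.u X.V) := by
  obtain ⟨l, b⟩ := A
  induction l with
  | nil => exact X.smoothOn_base b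
  | cons α l ih => exact X.smoothOn_dirD α ih

theorem coef_C (r : ℝ) : coef X.E X.u X.V (MvPolynomial.C r) = fun _ => r := by
  funext p; simp [coef]

theorem coef_X (A : CoefAtom) : coef X.E X.u X.V (MvPolynomial.X A) = A.val X.E X.u X.V := by
  funext p; simp [coef]

theorem coef_add (P Q : MvPolynomial CoefAtom ℝ) : coef X.E X.u X.V (P + Q) =
    fun p => coef X.E X.u X.V P p + coef X.E X.u X.V Q p := by
  funext p; simp [coef]

theorem coef_mul (P Q : MvPolynomial CoefAtom ℝ) : coef X.E X.u X.V (P * Q) =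
    fun p => coef X.E X.u X.V P p * coef X.E X.u X.V Q p := by
  funext p; simp [coef]

theorem smoothOn_coef (P : MvPolynomial CoefAtom ℝ) : SmoothOn X.T X.δ (coef X.E X.u X.V P) := by
  induction P using MvPolynomial.induction_on with
  | C r => rw [coef_C]; exact SmoothOn.const r
  | add P Q hP hQ => rw [coef_add]; exact hP.add hQ
  | mul_X P A hP => rw [coef_mul, coef_X]; exact hP.mul (X.smoothOn_atom A)

end Sol

/-- The formal derivative along `e_α` of a universal differential polynomial. -/
def formalD (α : Fin 4) :
    Derivation ℝ (MvPolynomial CoefAtom ℝ) (MvPolynomial CoefAtom ℝ) :=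
  MvPolynomial.mkDerivation ℝ fun A => MvPolynomial.X (α :: A.1, A.2)

theorem formalD_X (α : Fin 4) (A : CoefAtom) :
    formalD α (MvPolynomial.X A) = MvPolynomial.X (α :: A.1, A.2) :=
  MvPolynomial.mkDerivation_X _ _ _

namespace Sol
variable {a ρ : ℝ} (X : Sol.{v} a ρ)

theorem coef_formalD (α : Fin 4) (P : MvPolynomial CoefAtom ℝ) {p : ℝ × X.S} (hp : p ∈ X.dom) :
    coef X.E X.u X.V (formalD α P) p = dirD (fr X.E X.u α) (coef X.E X.u X.V P) p := by
  induction P using MvPolynomial.induction_on with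
  | C r =>
    rw [coef_C, dirD_const, MvPolynomial.derivation_C]; simp [coef]
  | add P Q hP hQ =>
    rw [map_add, coef_add, coef_add, dirD_add ((X.smoothOn_coef P).mdiff hp)
      ((X.smoothOn_coef Q).mdiff hp), ← hP, ← hQ]
  | mul_X P A hP =>
    rw [Derivation.leibniz, coef_add, coef_mul, dirD_mul ((X.smoothOn_coef P).mdiff hp)
      ((X.smoothOn_coef _).mdiff hp), smul_eq_mul, smul_eq_mul, coef_mul, coef_mul, ← hP, formalD_X,
      coef_X, coef_X]
    rfl

end Sol

/-- Points of the domains of all solutions. -/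
abbrev SolPt (a ρ : ℝ) := Σ X : Sol.{v} a ρ, X.dom

/-- Evaluation of universal differential polynomials on all solutions. -/
def evalAll (a ρ : ℝ) : MvPolynomial CoefAtom ℝ →ₐ[ℝ] (SolPt.{v} a ρ → ℝ) :=
  MvPolynomial.aeval fun A x => A.val x.1.E x.1.u x.1.V x.2.1

theorem evalAll_apply (a ρ : ℝ) (P : MvPolynomial CoefAtom ℝ) (x : SolPt.{v} a ρ) :
    evalAll a ρ P x = coef x.1.E x.1.u x.1.V P x.2.1 := by
  induction P using MvPolynomial.induction_on with
  | C r => rw [Sol.coef_C]; simp [evalAll]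
  | add P Q hP hQ => rw [map_add, Pi.add_apply, hP, hQ, Sol.coef_add]
  | mul_X P A hP => rw [map_mul, Pi.mul_apply, hP, Sol.coef_mul, Sol.coef_X]; simp [evalAll]

/-- The ring of functions given by universal differential polynomials. -/
abbrev CoefRing (a ρ : ℝ) := (evalAll.{v} a ρ).range

namespace CoefRing
variable {a ρ : ℝ}

/-- The function given by a universal differential polynomial. -/
def mk (P : MvPolynomial CoefAtom ℝ) : CoefRing.{v} a ρ := (evalAll a ρ).rangeRestrict P

theorem mk_surjective : Function.Surjective (mk : _ → CoefRing.{v} a ρ) :=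
  (evalAll a ρ).rangeRestrict_surjective

/-- Evaluation at a point of the domain of a solution. -/
def at' (X : Sol.{v} a ρ) (p : X.dom) : CoefRing.{v} a ρ →ₐ[ℝ] ℝ :=
  (Pi.evalAlgHom ℝ (fun _ : SolPt.{v} a ρ => ℝ) ⟨X, p⟩).comp (evalAll a ρ).range.val

theorem at_mk (X : Sol.{v} a ρ) (p : X.dom) (P : MvPolynomial CoefAtom ℝ) :
    at' X p (mk P) = coef X.E X.u X.V P p := evalAll_apply a ρ P ⟨X, p⟩

theorem ext_at {x y : CoefRing.{v} a ρ} (h : ∀ X p, at' X p x = at' X p y) : x = y :=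
  Subtype.ext (funext fun q => h q.1 q.2)

/-- Two polynomials that agree on every solution domain, an open set, have equal derivatives there.
So the formal derivative depends only on the function and descends to the quotient ring. -/
theorem mk_formalD_congr (α : Fin 4) {P Q : MvPolynomial CoefAtom ℝ}
    (h : (mk P : CoefRing.{v} a ρ) = mk Q) : (mk (formalD α P) : CoefRing.{v} a ρ) = mk (formalD α Q) := by
  refine ext_at fun X p => ?_
  rw [at_mk, at_mk, X.coef_formalD α P p.2, X.coef_formalD α Q p.2]
  refine dirD_congr X.isOpen_dom p.2 fun q hq => ?_
  have := congrArg (at' X ⟨q, hq⟩) h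
  rwa [at_mk, at_mk] at this

/-- The derivation `e_α`. -/
def D (α : Fin 4) : Derivation ℝ (CoefRing.{v} a ρ) (CoefRing.{v} a ρ) := by
  let g : CoefRing.{v} a ρ → MvPolynomial CoefAtom ℝ := Function.surjInv mk_surjective
  have hg : ∀ x, mk (g x) = x := Function.surjInv_eq mk_surjective
  have key : ∀ P x, mk P = x → mk (formalD α (g x)) = mk (formalD α P) := fun P x h =>
    mk_formalD_congr α ((hg x).trans h.symm)
  have hadd : ∀ P Q, (mk (P + Q) : CoefRing.{v} a ρ) = mk P + mk Q := fun P Q => map_add _ _ _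
  have hmul : ∀ P Q, (mk (P * Q) : CoefRing.{v} a ρ) = mk P * mk Q := fun P Q => map_mul _ _ _
  have hsmul : ∀ (r : ℝ) P, (mk (r • P) : CoefRing.{v} a ρ) = r • mk P := fun r P => map_smul _ _ _
  exact Derivation.mk'
    { toFun := fun x => mk (formalD α (g x))
      map_add' := fun x y => by
        rw [key (g x + g y) (x + y) (by rw [hadd, hg, hg]), map_add, hadd]
      map_smul' := fun r x => by
        rw [key (r • g x) (r • x) (by rw [hsmul, hg]), Derivation.map_smul, hsmul]; rfl }
    (fun x y => by
      change mk (formalD α (g (x * y))) = x • mk (formalD α (g y)) + y • mk (formalD α (g x))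
      rw [key (g x * g y) (x * y) (by rw [hmul, hg, hg]), Derivation.leibniz, hadd, smul_eq_mul,
        smul_eq_mul, hmul, hmul, hg, hg]
      rfl)

theorem D_mk (α : Fin 4) (P : MvPolynomial CoefAtom ℝ) :
    D α (mk P : CoefRing.{v} a ρ) = mk (formalD α P) :=
  mk_formalD_congr α (Function.surjInv_eq mk_surjective (mk P))

/-- The function on spacetime given by an element of the coefficient ring. -/
def fn (x : CoefRing.{v} a ρ) (X : Sol.{v} a ρ) : ℝ × X.S → ℝ :=
  coef X.E X.u X.V (Function.surjInv mk_surjective x)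

theorem at_eq_fn (x : CoefRing.{v} a ρ) (X : Sol.{v} a ρ) (p : X.dom) : at' X p x = fn x X p := by
  rw [fn, ← at_mk, Function.surjInv_eq mk_surjective]

theorem smoothOn_fn (x : CoefRing.{v} a ρ) (X : Sol.{v} a ρ) : SmoothOn X.T X.δ (fn x X) :=
  X.smoothOn_coef _

theorem at_D (α : Fin 4) (x : CoefRing.{v} a ρ) (X : Sol.{v} a ρ) (p : X.dom)
    {f : ℝ × X.S → ℝ} (h : ∀ q : X.dom, at' X q x = f q) :
    at' X p (D α x) = dirD (fr X.E X.u α) f p := by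
  obtain ⟨P, rfl⟩ := mk_surjective x
  rw [D_mk, at_mk, X.coef_formalD α P p.2]
  refine dirD_congr X.isOpen_dom p.2 fun q hq => ?_
  rw [← at_mk X ⟨q, hq⟩, h]

/-- The element of the coefficient ring given by one of the basic functions. -/
def base (b : CoefBase) : CoefRing.{v} a ρ := mk (MvPolynomial.X ([], b))

theorem at_base (b : CoefBase) (X : Sol.{v} a ρ) (p : X.dom) :
    at' X p (base b) = b.val X.E X.u X.V p := by
  rw [base, at_mk, Sol.coef_X]; rfl

theorem at_D_base (α : Fin 4) (b : CoefBase) (X : Sol.{v} a ρ) (p : X.dom) :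
    at' X p (D α (base b)) = dirD (fr X.E X.u α) (b.val X.E X.u X.V) p :=
  at_D α _ X p fun q => at_base b X q

theorem at_D_D_base (α β : Fin 4) (b : CoefBase) (X : Sol.{v} a ρ) (p : X.dom) :
    at' X p (D α (D β (base b))) =
      dirD (fr X.E X.u α) (dirD (fr X.E X.u β) (b.val X.E X.u X.V)) p :=
  at_D α _ X p fun q => at_D_base β b X q

end CoefRing
end EinsteinScalar
end

/-! ### The modified equations in frame form -/

noncomputable section
namespace EinsteinScalar
universe v

section
variable {S : Type*} [TopologicalSpace S] [ChartedSpace (EuclideanSpace ℝ (Fin 3)) S]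
  [IsManifold (𝓡 3) ∞ S]

/-- ∂_t commutes with every E_i. Applying it to the commutator relation of E_i and E_j on test
functions leaves the time derivatives of the structure functions as coefficients of a vanishing
combination of the E_k. -/
theorem dirD_dt_struc (E : RefFrame S) (i j k : Fin 3) (p : ℝ × S) :
    dirD dt (E.struc i j k) p = 0 := by
  have hs : ∀ k, ContMDiffOn stModel 𝓘(ℝ, ℝ) ∞ (E.struc i j k) univ :=
    fun k => (contMDiff_struc E i j k).contMDiffOn
  have key : (∑ k, dirD dt (E.struc i j k) p • E.vf k p : TangentSpace stModel p) = 0 := by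
    refine tangent_eq_of_forall_mfderiv_eq (I := stModel) (M := ℝ × S) (p := p)
      fun f U hU hp hf => ?_
    have md : ∀ {f : ℝ × S → ℝ}, ContMDiffOn stModel 𝓘(ℝ, ℝ) ∞ f U → MDifferentiableAt stModel 𝓘(ℝ, ℝ) f p :=
      fun hf => (hf.contMDiffAt (hU.mem_nhds hp)).mdifferentiableAt (by simp)
    have hE : ∀ {f : ℝ × S → ℝ} (k), ContMDiffOn stModel 𝓘(ℝ, ℝ) ∞ f U →
        ContMDiffOn stModel 𝓘(ℝ, ℝ) ∞ (dirD (E.vf k) f) U :=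
      fun k hf => (smoothVF_vf E k U).dirD hU hf
    have hT : ∀ {f : ℝ × S → ℝ}, ContMDiffOn stModel 𝓘(ℝ, ℝ) ∞ f U →
        ContMDiffOn stModel 𝓘(ℝ, ℝ) ∞ (dirD dt f) U :=
      fun hf => (smoothVF_dt U).dirD hU hf
    have h2 : ∀ k l, dirD dt (dirD (E.vf k) (dirD (E.vf l) f)) p =
        dirD (E.vf k) (dirD (E.vf l) (dirD dt f)) p := fun k l => by
      rw [dirD_dt_vf_comm E k hU (hE l hf) hp]
      exact dirD_congr hU hp fun q hq => dirD_dt_vf_comm E l hU hf hq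
    have hsub : ∀ q ∈ U, dirD (E.vf i) (dirD (E.vf j) f) q =
        dirD (E.vf j) (dirD (E.vf i) f) q + ∑ k, E.struc i j k q * dirD (E.vf k) f q :=
      fun q hq => by rw [← dirD_vf_comm E i j hU hf hq]; ring
    have h4 := dirD_congr (X := dt) hU hp hsub
    have hm : ∀ k, ContMDiffOn stModel 𝓘(ℝ, ℝ) ∞ (fun q => E.struc i j k q * dirD (E.vf k) f q) U :=
      fun k => ((hs k).mono (subset_univ _)).mul (hE k hf)
    rw [dirD_add (md (hE j (hE i hf))) (md (contMDiffOn_finsetSum fun k _ => hm k)), dirD_sum _ _ fun k _ => md (hm k), h2, h2] at h4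
    have h5 := dirD_vf_comm E i j hU (hT hf) hp
    rw [h4, add_sub_cancel_left] at h5
    have h6 : ∑ k, dirD dt (E.struc i j k) p * dirD (E.vf k) f p = 0 := by
      have h7 : ∀ k, dirD dt (fun q => E.struc i j k q * dirD (E.vf k) f q) p =
          E.struc i j k p * dirD (E.vf k) (dirD dt f) p
          + dirD dt (E.struc i j k) p * dirD (E.vf k) f p := fun k => by
        rw [dirD_mul (md ((hs k).mono (subset_univ _))) (md (hE k hf)),
          dirD_dt_vf_comm E k hU hf hp]
        ring
      rw [Finset.sum_congr rfl fun k _ => h7 k, Finset.sum_add_distrib] at h5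
      linarith
    have h8 := dirD_vf_sum (f := f) (p := p) Finset.univ (fun k _ => dirD dt (E.struc i j k) p) E.vf
    exact (h8.trans h6).trans (map_zero (mfderiv stModel 𝓘(ℝ, ℝ) f p)).symm
  have h2 : ∑ k, dirD dt (E.struc i j k) p • E.basis p.2 k = 0 :=
    (Prod.snd_sum (s := Finset.univ) (f := fun k => ((dirD dt (E.struc i j k) p • E.vf k p :
      TangentSpace stModel p) : ℝ × EuclideanSpace ℝ (Fin 3)))).symm.trans (congrArg Prod.snd key)
  exact (Fintype.linearIndependent_iff.1 (E.basis p.2).linearIndependent) _ h2 k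

end

theorem fr_zero {S : Type*} [TopologicalSpace S] [ChartedSpace (EuclideanSpace ℝ (Fin 3)) S]
  [IsManifold (𝓡 3) ∞ S] (E : RefFrame S) (u : Unknowns S) : fr E u 0 = e0 u := rfl

theorem fr_succ {S : Type*} [TopologicalSpace S] [ChartedSpace (EuclideanSpace ℝ (Fin 3)) S]
  [IsManifold (𝓡 3) ∞ S] (E : RefFrame S) (u : Unknowns S) (I : Fin 3) :
  fr E u I.succ = eS E u I := rfl

namespace Sol
variable {a ρ : ℝ} (X : Sol.{v} a ρ) {p : ℝ × X.S} {f : ℝ × X.S → ℝ}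

theorem dual_swap (hp : p ∈ X.dom) (i j : Fin 3) :
    ∑ I, X.u.om I i p * X.u.e I j p = if i = j then 1 else 0 := by
  have h : (Matrix.of fun I i => X.u.e I i p) * (Matrix.of fun i I => X.u.om I i p) = 1 := by
    ext I J
    have := X.hu.dual X.hd X.hδ hp I J
    simp only [Matrix.mul_apply, Matrix.of_apply, Matrix.one_apply]
    rw [this, kd]
  have h1 := mul_eq_one_comm.1 h
  have h2 := congrFun (congrFun h1 i) j
  simpa only [Matrix.mul_apply, Matrix.of_apply, Matrix.one_apply] using h2

/-- Structure functions of the spatial frame. -/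
def c (I J K : Fin 3) (p : ℝ × X.S) : ℝ :=
  ∑ i, (dirD (eS X.E X.u I) (X.u.e J i) p - dirD (eS X.E X.u J) (X.u.e I i) p
      + ∑ j, ∑ l, X.u.e I j p * X.u.e J l p * X.E.struc j l i p) * X.u.om K i p

theorem sum_c_smul {M : Type*} [AddCommGroup M] [Module ℝ M] (hp : p ∈ X.dom) (I J : Fin 3)
    (m : Fin 3 → M) : ∑ K, X.c I J K p • ∑ k, X.u.e K k p • m k =
    ∑ k, (dirD (eS X.E X.u I) (X.u.e J k) p - dirD (eS X.E X.u J) (X.u.e I k) p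
      + ∑ j, ∑ l, X.u.e I j p * X.u.e J l p * X.E.struc j l k p) • m k := by
  have h := fun i j => X.dual_swap hp i j
  simp only [c, Finset.smul_sum, Finset.sum_mul, Finset.sum_smul, smul_smul]
  rw [Finset.sum_comm]
  refine Finset.sum_congr rfl fun k _ => ?_
  rw [Finset.sum_comm]
  have h3 : ∀ i K, ∀ y : ℝ, (y * X.u.om K i p * X.u.e K k p) • m k =
    y • (X.u.om K i p * X.u.e K k p) • m k := fun i K y => by rw [smul_smul, mul_assoc]
  simp only [h3, ← Finset.smul_sum, ← Finset.sum_smul, h]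
  simp

theorem comm (hp : p ∈ X.dom) (hf : SmoothOn X.T X.δ f) (I J : Fin 3) :
    dirD (eS X.E X.u I) (dirD (eS X.E X.u J) f) p - dirD (eS X.E X.u J) (dirD (eS X.E X.u I) f) p =
    ∑ K, X.c I J K p * dirD (eS X.E X.u K) f p := by
  rw [dirD_eS_comm X.isOpen_dom X.hu.smooth_e I J hf hp]
  have := X.sum_c_smul hp I J (fun k => dirD (X.E.vf k) f p)
  simp only [smul_eq_mul, ← dirD_eS] at this
  exact this.symm

theorem bracket (hp : p ∈ X.dom) (I J : Fin 3) :
    VectorField.mlieBracket stModel (eS X.E X.u I) (eS X.E X.u J) p =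
    ∑ K, X.c I J K p • eS X.E X.u K p := by
  rw [mlieBracket_eS X.isOpen_dom X.hu.smooth_e I J hp]
  exact (X.sum_c_smul hp I J (fun k => X.E.vf k p)).symm

theorem comm_zero (hp : p ∈ X.dom) (hf : SmoothOn X.T X.δ f) (I : Fin 3) :
    dirD (e0 X.u) (dirD (eS X.E X.u I) f) p = dirD (eS X.E X.u I) (dirD (e0 X.u) f) p
      + dLog X.E X.u I p * dirD (e0 X.u) f p - ∑ J, X.u.k I J p * dirD (eS X.E X.u J) f p := by
  have hN := (X.N_pos hp).ne'
  have h1 : dirD dt (dirD (eS X.E X.u I) f) p = ∑ i, (X.u.e I i p * dirD (X.E.vf i) (dirD dt f) p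
      + dirD (X.E.vf i) f p * (-X.u.N p * ∑ J, X.u.k I J p * X.u.e J i p)) := by
    rw [funext (dirD_eS X.E X.u I f), dirD_sum _ _ fun i _ =>
      ((X.hu.smooth_e I i).mul (hf.dirD_vf X.E i)).mdiff hp]
    refine Finset.sum_congr rfl fun i _ => ?_
    rw [dirD_mul ((X.hu.smooth_e I i).mdiff hp) ((hf.dirD_vf X.E i).mdiff hp),
      dirD_dt_vf_comm X.E i X.isOpen_dom hf hp, X.hu.eq_e p hp]
  have h2 : dirD (eS X.E X.u I) (dirD (e0 X.u) f) p =
      (X.u.N p)⁻¹ * dirD (eS X.E X.u I) (dirD dt f) p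
      + dirD dt f p * (-((X.u.N p) ^ 2)⁻¹ * dirD (eS X.E X.u I) X.u.N p) := by
    rw [funext (dirD_e0 X.u f), dirD_mul (X.smoothOn_inv_N.mdiff hp) (hf.dirD_dt.mdiff hp),
      dirD_comp (hasDerivAt_inv hN) (X.hu.smooth_N.mdiff hp)]
  have h3 : dLog X.E X.u I p = (X.u.N p)⁻¹ * dirD (eS X.E X.u I) X.u.N p :=
    dirD_comp (Real.hasDerivAt_log hN) (X.hu.smooth_N.mdiff hp)
  rw [dirD_e0, h1, h2, h3, dirD_e0]
  simp only [dirD_eS, Fin.sum_univ_three]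
  field_simp
  ring

theorem dLog_eq (hp : p ∈ X.dom) (I : Fin 3) :
    dLog X.E X.u I p = (X.u.N p)⁻¹ * dirD (eS X.E X.u I) X.u.N p :=
  dirD_comp (Real.hasDerivAt_log (X.N_pos hp).ne') (X.hu.smooth_N.mdiff hp)

theorem smoothOn_log : SmoothOn X.T X.δ (fun q => Real.log (X.u.N q)) := fun p hp =>
  ((Real.contDiffAt_log.2 (X.N_pos hp).ne').contMDiffAt (x := X.u.N p)).comp_contMDiffWithinAt p
    (X.hu.smooth_N p hp)

/-- Commutes e_I with e_0 ln N = (𝔞 + 1)(θ - 1/(tN)). The term from e_I(1/N) cancels the 1/t part of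
e_I(ln N) e_0 ln N, so no explicit time remains. -/
theorem e0_dLog (hp : p ∈ X.dom) (I : Fin 3) : dirD (e0 X.u) (dLog X.E X.u I) p =
    (a + 1) * dirD (eS X.E X.u I) X.u.theta p + (a + 1) * (X.u.theta p * dLog X.E X.u I p)
      - ∑ J, X.u.k I J p * dLog X.E X.u J p := by
  have hN := (X.N_pos hp).ne'
  have h0 : ∀ q ∈ X.dom, dirD (e0 X.u) (fun q => Real.log (X.u.N q)) q =
      (a + 1) * (X.u.theta q + -1 * (q.1⁻¹ * (X.u.N q)⁻¹)) := fun q hq => by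
    have hN := (X.N_pos hq).ne'
    have ht := (slab_time_pos X.hT hq).ne'
    rw [dirD_e0, dirD_comp (Real.hasDerivAt_log hN) (X.hu.smooth_N.mdiff hq), X.hu.eq_N q hq]
    field_simp
    ring
  have ht := (slab_time_pos X.hT hp).ne'
  have hti := (smoothOn_inv_time (S := X.S) X.hT).mdiff hp
  have h1 : dirD (eS X.E X.u I) (fun q : ℝ × X.S => q.1⁻¹) p = 0 := by
    rw [dirD_comp (h := fun t => t⁻¹) (f := Prod.fst) (hasDerivAt_inv ht)
      (contMDiff_fst.contMDiffAt.mdifferentiableAt (n := ∞) (by simp)), dirD_fst]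
    have : (eS X.E X.u I p).1 = 0 :=
      (Prod.fst_sum).trans (Finset.sum_eq_zero fun k _ => mul_zero _)
    exact (congrArg (_ * ·) this).trans (mul_zero _)
  have h2 := X.comm_zero hp X.smoothOn_log I
  rw [h0 p hp, dirD_congr X.isOpen_dom hp h0, dirD_mul ((SmoothOn.const _).mdiff hp)
    ((X.hu.smooth_theta.add ((SmoothOn.const _).mul ((smoothOn_inv_time X.hT).mul
      X.smoothOn_inv_N))).mdiff hp), dirD_const, dirD_add (X.hu.smooth_theta.mdiff hp)
    (((SmoothOn.const _).mul ((smoothOn_inv_time X.hT).mul X.smoothOn_inv_N)).mdiff hp),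
    dirD_mul ((SmoothOn.const _).mdiff hp) (((smoothOn_inv_time X.hT).mul
      X.smoothOn_inv_N).mdiff hp), dirD_const, dirD_mul hti (X.smoothOn_inv_N.mdiff hp), h1,
    dirD_comp (hasDerivAt_inv hN) (X.hu.smooth_N.mdiff hp)] at h2
  refine h2.trans ?_
  have h3 := X.dLog_eq hp I
  have h4 : dirD (eS X.E X.u I) X.u.N p = X.u.N p * dLog X.E X.u I p := by
    rw [h3, mul_inv_cancel_left₀ hN]
  rw [h4]
  change _ - ∑ J, X.u.k I J p * dLog X.E X.u J p = _
  field_simp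
  ring

/-- The momentum constraint. -/
def M (I : Fin 3) (p : ℝ × X.S) : ℝ :=
  ∑ J, dirD (eS X.E X.u J) (X.u.k J I) p - dirD (eS X.E X.u I) X.u.theta p
    - ∑ J, ∑ K, X.u.Gam J J K p * X.u.k K I p - ∑ J, ∑ K, X.u.Gam J I K p * X.u.k J K p
    - dirD (e0 X.u) X.u.phi p * dirD (eS X.E X.u I) X.u.phi p

theorem e0_phi (hp : p ∈ X.dom) : dirD (e0 X.u) X.u.phi p = (X.u.N p)⁻¹ * X.u.phit p := by
  rw [dirD_e0, X.hu.eq_phi p hp]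

theorem momC_eq (hp : p ∈ X.dom) (I : Fin 3) : momC X.E X.u I p = X.u.N p * X.M I p := by
  have hN := (X.N_pos hp).ne'
  rw [momC, M, X.e0_phi hp, X.hu.dphi_eq X.hd X.hδ hp]
  field_simp
  ring

theorem sum_dirD_shear (hp : p ∈ X.dom) (Y : VField X.S) :
    ∑ J, dirD Y (X.u.shear J J) p = 0 := by
  rw [← dirD_sum _ _ fun i _ => (X.hu.smooth_shear i i).mdiff hp, dirD_congr (g := fun _ => 0)
    X.isOpen_dom hp fun q hq => X.hu.shear_trace X.hd X.hδ hq, dirD_const]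

theorem e0_dN (hp : p ∈ X.dom) (I : Fin 3) : dirD (e0 X.u) (X.u.dN I) p =
    (a + 1) * dirD (eS X.E X.u I) X.u.theta p + (a + 1) * (X.u.theta p * X.u.dN I p)
      - ∑ J, X.u.k I J p * X.u.dN J p + alpha a ρ * X.M I p := by
  have hN := (X.N_pos hp).ne'
  rw [dirD_e0, X.hu.eq_dN p hp, X.sum_dirD_shear hp, X.momC_eq hp]
  field_simp
  ring

theorem e0_Gam (hp : p ∈ X.dom) (I J K : Fin 3) : dirD (e0 X.u) (X.u.Gam I J K) p =
    -∑ L, X.u.k I L p * X.u.Gam L J K p + dirD (eS X.E X.u J) (X.u.k K I) p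
    - dirD (eS X.E X.u K) (X.u.k J I) p + ∑ L, X.u.k K L p * X.u.Gam J L I p
    - ∑ L, X.u.k J L p * X.u.Gam K L I p - ∑ L, X.u.k I L p * X.u.Gam J K L p
    + ∑ L, X.u.k I L p * X.u.Gam K J L p + X.u.dN J p * X.u.k I K p - X.u.dN K p * X.u.k I J p
    + kd I K * X.M J p - kd I J * X.M K p := by
  have hN := (X.N_pos hp).ne'
  rw [dirD_e0, X.hu.eq_Gam p hp, X.sum_dirD_shear hp, X.sum_dirD_shear hp, X.momC_eq hp,
    X.momC_eq hp]
  field_simp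
  ring

/-- The right hand side of the evolution equation of the shear before symmetrization. -/
def rhs (I J : Fin 3) (p : ℝ × X.S) : ℝ :=
  -∑ K, dirD (eS X.E X.u K) (X.u.Gam I J K) p + ∑ K, dirD (eS X.E X.u I) (X.u.Gam K J K) p
    + dirD (eS X.E X.u I) (X.u.dN J) p - ∑ K, ∑ L, X.u.Gam I J L p * X.u.Gam K L K p
    + ∑ K, ∑ L, X.u.Gam K I L p * X.u.Gam L J K p + X.u.dN I p * X.u.dN J p
    - ∑ K, X.u.Gam I J K p * X.u.dN K p
    + dirD (eS X.E X.u I) X.u.phi p * dirD (eS X.E X.u J) X.u.phi p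

/-- The Hamiltonian constraint. -/
def H (p : ℝ × X.S) : ℝ :=
  2 * ∑ I, ∑ K, dirD (eS X.E X.u K) (X.u.Gam I I K) p
    + ∑ I, ∑ K, ∑ L, X.u.Gam I I L p * X.u.Gam K L K p
    - ∑ I, ∑ K, ∑ L, X.u.Gam K I L p * X.u.Gam L I K p + X.u.theta p ^ 2
    - ∑ I, ∑ J, X.u.k I J p * X.u.k I J p - dirD (e0 X.u) X.u.phi p ^ 2
    - ∑ I, dirD (eS X.E X.u I) X.u.phi p * dirD (eS X.E X.u I) X.u.phi p - 2 * X.V (X.u.phi p)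

theorem dirD_k (hp : p ∈ X.dom) (Y : VField X.S) (I J : Fin 3) : dirD Y (X.u.k I J) p =
    dirD Y (X.u.shear I J) p + kd I J / 3 * dirD Y X.u.theta p := by
  have e : X.u.k I J = fun q => X.u.shear I J q + (kd I J / 3) * X.u.theta q := by
    funext q; rw [Unknowns.k]; ring
  rw [e, dirD_add ((X.hu.smooth_shear I J).mdiff hp) (((SmoothOn.const _).mul
    X.hu.smooth_theta).mdiff hp), dirD_mul ((SmoothOn.const _).mdiff hp)
    (X.hu.smooth_theta.mdiff hp), dirD_const]
  ring

theorem Gam_div (hp : p ∈ X.dom) :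
    ∑ K, ∑ I, dirD (eS X.E X.u K) (X.u.Gam I K I) p =
    -∑ I, ∑ K, dirD (eS X.E X.u K) (X.u.Gam I I K) p := by
  have h : ∀ I K, dirD (eS X.E X.u K) (X.u.Gam I K I) p =
      -dirD (eS X.E X.u K) (X.u.Gam I I K) p := fun I K => by
    rw [dirD_congr (g := fun q => -1 * X.u.Gam I I K q) X.isOpen_dom hp fun q hq => by
      rw [X.hu.Gam_antisymm X.hd X.hδ hq]; ring, dirD_mul ((SmoothOn.const _).mdiff hp)
      ((X.hu.smooth_Gam _ _ _).mdiff hp), dirD_const]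
    ring
  rw [Finset.sum_comm, ← Finset.sum_neg_distrib]
  exact Finset.sum_congr rfl fun I _ => by
    rw [← Finset.sum_neg_distrib]; exact Finset.sum_congr rfl fun K _ => h I K

/-- Recombines the equation for the shear, which contains the trace-free part of `rhs`, with that
for θ, which contains its trace and the β-term. -/
theorem e0_k (hp : p ∈ X.dom) (I J : Fin 3) : dirD (e0 X.u) (X.u.k I J) p =
    -(X.u.theta p * X.u.k I J p) + 1 / 2 * (X.rhs I J p + X.rhs J I p) + kd I J * X.V (X.u.phi p)
    + kd I J * beta ρ / 3 * X.H p := by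
  have hN := (X.N_pos hp).ne'
  have hd := X.Gam_div hp
  have hφ := fun I => X.hu.dphi_eq X.hd X.hδ hp I
  have h1 : (X.u.N p)⁻¹ * dirD dt X.u.theta p = ∑ I, X.rhs I I p - X.u.theta p ^ 2
      + 3 * X.V (X.u.phi p) + beta ρ * X.H p := by
    rw [X.hu.eq_theta p hp]
    simp only [rhs, H, X.e0_phi hp, hφ, Fin.sum_univ_three] at hd ⊢
    field_simp
    linear_combination -X.u.N p ^ 2 * hd
  have h2 : (X.u.N p)⁻¹ * dirD dt (X.u.shear I J) p = -(X.u.theta p * X.u.shear I J p)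
      + 1 / 2 * (X.rhs I J p + X.rhs J I p) - kd I J / 3 * ∑ I, X.rhs I I p := by
    have e : ∀ x t1 t2 t3 t4 t5 t6 t7 t8 : ℝ, (X.u.N p)⁻¹ * (-X.u.N p * X.u.theta p * x
        - X.u.N p * t1 + X.u.N p * t2 + X.u.N p * t3 - X.u.N p * t4 + X.u.N p * t5 + X.u.N p * t6
        - X.u.N p * t7 + X.u.N p * t8) = -(X.u.theta p * x) - t1 + t2 + t3 - t4 + t5 + t6 - t7
        + t8 := fun x t1 t2 t3 t4 t5 t6 t7 t8 => by field_simp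
    rw [X.hu.eq_shear p hp, e]
    simp only [rhs, tfs, hφ, Finset.sum_add_distrib, Finset.sum_sub_distrib,
      Finset.sum_neg_distrib]
    ring
  rw [dirD_e0, X.dirD_k hp, mul_add, h2, mul_left_comm, h1, Unknowns.k]
  ring

/-- The term (𝔞 + 1)(Nθ - 1/t)φ_t in the equation for φ_t is exactly what the time derivative of 1/N
in e_0 φ = φ_t/N removes. -/
theorem wave (hp : p ∈ X.dom) : dirD (e0 X.u) (dirD (e0 X.u) X.u.phi) p =
    ∑ I, dirD (eS X.E X.u I) (dirD (eS X.E X.u I) X.u.phi) p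
    - X.u.theta p * dirD (e0 X.u) X.u.phi p
    - ∑ I, ∑ K, X.u.Gam I I K p * dirD (eS X.E X.u K) X.u.phi p
    + ∑ I, dirD (eS X.E X.u I) X.u.phi p * X.u.dN I p - deriv X.V (X.u.phi p) := by
  have hN := (X.N_pos hp).ne'
  have ht := (slab_time_pos X.hT hp).ne'
  have hφ := fun I => X.hu.dphi_eq X.hd X.hδ hp I
  have hφ2 : ∀ I, dirD (eS X.E X.u I) (X.u.dphi I) p =
      dirD (eS X.E X.u I) (dirD (eS X.E X.u I) X.u.phi) p := fun I =>
    dirD_congr X.isOpen_dom hp fun q hq => X.hu.dphi_eq X.hd X.hδ hq I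
  rw [dirD_congr X.isOpen_dom hp fun q hq => X.e0_phi hq, dirD_e0, dirD_mul
    (X.smoothOn_inv_N.mdiff hp) (X.hu.smooth_phit.mdiff hp),
    dirD_comp (hasDerivAt_inv hN) (X.hu.smooth_N.mdiff hp), X.hu.eq_phit p hp, X.hu.eq_N p hp,
    X.e0_phi hp]
  simp only [hφ, hφ2, Fin.sum_univ_three]
  field_simp
  ring

end Sol
end EinsteinScalar
end

/-! ### The modified system in the ring of coefficients -/

noncomputable section
namespace EinsteinScalar
universe v
namespace CoefRing
variable {a ρ : ℝ}

/-- Second fundamental form. -/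
def k (I J : Fin 3) : CoefRing.{v} a ρ := base (.shear I J) + (kd I J / 3) • base .theta

/-- Logarithmic derivative of the lapse. -/
def n (I : Fin 3) : CoefRing.{v} a ρ := base .invN * D I.succ (base .N)

variable (X : Sol.{v} a ρ) (p : X.dom)

theorem at_k (I J : Fin 3) : at' X p (k I J) = X.u.k I J p := by
  simp only [k, map_add, map_smul, at_base, CoefBase.val, Unknowns.k, smul_eq_mul]; ring

theorem at_D_k (α : Fin 4) (I J : Fin 3) :
    at' X p (D α (k I J)) = dirD (fr X.E X.u α) (X.u.k I J) p :=
  at_D α _ X p fun q => at_k X q I J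

theorem at_n (I : Fin 3) : at' X p (n I) = dLog X.E X.u I p := by
  rw [n, map_mul, at_base, at_D_base, X.dLog_eq p.2]; rfl

theorem at_D_n (α : Fin 4) (I : Fin 3) :
    at' X p (D α (n I)) = dirD (fr X.E X.u α) (dLog X.E X.u I) p :=
  at_D α _ X p fun q => at_n X q I

theorem at_D_fn (α : Fin 4) (x : CoefRing.{v} a ρ) :
    at' X p (D α x) = dirD (fr X.E X.u α) (fn x X) p :=
  at_D α _ X p fun q => at_eq_fn x X q

theorem at_D_D_fn (α β : Fin 4) (x : CoefRing.{v} a ρ) :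
    at' X p (D α (D β x)) = dirD (fr X.E X.u α) (dirD (fr X.E X.u β) (fn x X)) p :=
  at_D α _ X p fun q => at_D_fn X q β x

theorem at_c (I J K : Fin 3) : at' X p (∑ i, (D I.succ (base (.e J i)) - D J.succ (base (.e I i))
      + ∑ j, ∑ l, base (.e I j) * base (.e J l) * base (.struc j l i)) * base (.om K i)) =
    X.c I J K p := by
  simp only [map_sum, map_mul, map_add, map_sub, at_D_base, at_base]; rfl

open FrameCalculus in
/-- The modified system in the ring of coefficients. -/
def sys (a ρ : ℝ) : ConstraintSystem a ρ (CoefRing.{v} a ρ) where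
  D := D
  e I i := base (.e I i)
  om I i := base (.om I i)
  st i j l := base (.struc i j l)
  k := k
  Γ I J K := base (.Gam I J K)
  n := n
  ν I := base (.dN I)
  θ := base .theta
  φ := base .phi
  V0 := base (.pot 0)
  V1 := base (.pot 1)
  k_symm I J := ext_at fun X p => by rw [at_k, at_k, X.hu.k_symm X.hd X.hδ p.2]
  Γ_antisymm I J K := ext_at fun X p => by
    rw [map_neg, at_base, at_base]; exact X.hu.Gam_antisymm X.hd X.hδ p.2 I J K
  k_trace := ext_at fun X p => by
    have h := X.hu.shear_trace X.hd X.hδ p.2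
    rw [Fin.sum_univ_three] at h
    have hk : ∀ J, kd J J = 1 := by simp [kd]
    simp only [Fin.sum_univ_three, map_add, at_k, at_base, CoefBase.val, Unknowns.k, hk]
    linarith
  dual I J := ext_at fun X p => by
    have h := X.hu.dual X.hd X.hδ p.2 I J
    simp only [map_sum, map_mul, at_base, CoefBase.val, h, kd]
    split <;> simp
  D_e I i := ext_at fun X p => by
    have hN := (X.N_pos p.2).ne'
    simp only [map_neg, map_sum, map_mul, at_base, at_D_base, at_k, CoefBase.val, fr_zero, dirD_e0,
      X.hu.eq_e p p.2]
    field_simp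
  D_om I i := ext_at fun X p => by
    have hN := (X.N_pos p.2).ne'
    simp only [map_neg, map_sum, map_mul, at_base, at_D_base, at_k, CoefBase.val, fr_zero, dirD_e0,
      X.hu.eq_om p p.2]
    field_simp
  D_st i j l := ext_at fun X p => by
    simp only [at_D_base, CoefBase.val, fr_zero, dirD_e0, dirD_dt_struc, mul_zero, map_zero]
  comm_zero I x := ext_at fun X p => by
    simp only [map_add, map_sub, map_sum, map_mul, at_D_D_fn]
    simp only [at_D_fn, at_k, at_n, fr_zero, fr_succ]
    exact X.comm_zero p.2 (smoothOn_fn x X) I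
  comm I J x := ext_at fun X p => by
    simp only [map_sub, at_D_D_fn, fr_succ]
    rw [map_sum]
    simp only [map_mul _ (Finset.sum _ _), at_c, at_D_fn, fr_succ]
    exact X.comm p.2 (smoothOn_fn x X) I J
  -- The commutator is applied to ln N, which is not one of the basic functions of the ring; only
  -- its derivatives are.
  curl_n I J := ext_at fun X p => by
    simp only [map_sub, at_D_n, fr_succ]
    rw [map_sum]
    simp only [map_mul _ (Finset.sum _ _), at_c, at_n]
    exact X.comm p.2 X.smoothOn_log I J
  D_n I := ext_at fun X p => by
    simp only [map_add, map_sub, map_sum, map_mul, map_smul, at_D_n, at_D_base, at_base, at_k, at_n,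
      fr_zero, fr_succ, smul_eq_mul]
    exact X.e0_dLog p.2 I
  D_ν I := ext_at fun X p => by
    simp only [map_add, map_sub, map_sum, map_mul, map_smul, at_D_base, at_base, at_k, at_D_k,
      fr_zero, fr_succ, smul_eq_mul]
    exact X.e0_dN p.2 I
  D_Γ I J K := ext_at fun X p => by
    simp only [map_add, map_sub, map_neg, map_sum, map_mul, map_smul, at_D_base, at_base, at_k,
      at_D_k, fr_zero, fr_succ, smul_eq_mul]
    exact X.e0_Gam p.2 I J K
  X I J := -∑ K, D K.succ (base (.Gam I J K)) + ∑ K, D I.succ (base (.Gam K J K))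
    + D I.succ (base (.dN J)) - ∑ K, ∑ L, base (.Gam I J L) * base (.Gam K L K)
    + ∑ K, ∑ L, base (.Gam K I L) * base (.Gam L J K)
    + base (.dN I) * base (.dN J) - ∑ K, base (.Gam I J K) * base (.dN K)
    + D I.succ (base .phi) * D J.succ (base .phi)
  X_eq _ _ := rfl
  H := 2 * ∑ I, ∑ K : Fin 3, D K.succ (base (.Gam I I K))
    + ∑ I, ∑ K, ∑ L, base (.Gam I I L) * base (.Gam K L K)
    - ∑ I, ∑ K, ∑ L, base (.Gam K I L) * base (.Gam L I K) + base .theta ^ 2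
    - ∑ I, ∑ J, k I J * k I J - D 0 (base .phi) ^ 2
    - ∑ I : Fin 3, D I.succ (base .phi) * D I.succ (base .phi) - 2 * base (.pot 0)
  H_eq := rfl
  D_k I J := ext_at fun X p => by
    have h2 : at' X p 2 = 2 := map_ofNat _ 2
    simp only [map_add, map_sub, map_neg, map_sum, map_mul, map_smul, map_pow, h2, at_D_base,
      at_base, at_k, at_D_k, fr_zero, fr_succ, smul_eq_mul]
    have h := X.e0_k p.2 I J
    simp only [Sol.rhs, Sol.H] at h
    rw [h]
    simp only [CoefBase.val, iteratedDeriv_zero]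
  wave := ext_at fun X p => by
    simp only [map_add, map_sub, map_neg, map_sum, map_mul, at_D_D_base, at_D_base, at_base,
      fr_zero, fr_succ]
    have h := X.wave p.2
    simp only [CoefBase.val, iteratedDeriv_one]
    exact h
  D_V0 α := ext_at fun X p => by
    simp only [map_mul, at_D_base, at_base, CoefBase.val, iteratedDeriv_zero, iteratedDeriv_one]
    exact dirD_comp ((X.hV.differentiable (by simp)) _).hasDerivAt (X.hu.smooth_phi.mdiff p.2)

end CoefRing
end EinsteinScalar
end

/-! ### Geometric constraint quantities as ring elements -/

noncomputable section
namespace EinsteinScalar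
universe v

section
variable {S : Type*} [TopologicalSpace S] [ChartedSpace (EuclideanSpace ℝ (Fin 3)) S]
  [IsManifold (𝓡 3) ∞ S] (E : RefFrame S) (u : Unknowns S)

/-- The coframe as linear forms. -/
def cofrL (α : Fin 4) (p : ℝ × S) : TangentSpace stModel p →ₗ[ℝ] ℝ :=
  Fin.cases (motive := fun _ => TangentSpace stModel p →ₗ[ℝ] ℝ)
    { toFun := fun x => u.N p * dtForm p x
      map_add' := fun x y => by
        rw [← mul_add]
        exact congrArg (u.N p * ·)
          ((mfderiv stModel 𝓘(ℝ, ℝ) (Prod.fst : ℝ × S → ℝ) p).map_add x y)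
      map_smul' := fun r x => by
        have h : dtForm p (r • x) = r * dtForm p x :=
          (mfderiv stModel 𝓘(ℝ, ℝ) (Prod.fst : ℝ × S → ℝ) p).map_smul r x
        rw [h, RingHom.id_apply, smul_eq_mul]; ring }
    (fun I => ∑ i, u.om I i p • (E.basis p.2).coord i ∘ₗ
      (mfderiv stModel (𝓡 3) (Prod.snd : ℝ × S → S) p :
        TangentSpace stModel p →ₗ[ℝ] TangentSpace (𝓡 3) p.2)) α

theorem cofr_eq (α : Fin 4) (p : ℝ × S) (x : TangentSpace stModel p) :
    cofr E u α p x = cofrL E u α p x := by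
  refine Fin.cases ?_ (fun I => ?_) α
  · rfl
  · change omForm E u I p x = (∑ i, u.om I i p • (E.basis p.2).coord i ∘ₗ
      (mfderiv stModel (𝓡 3) (Prod.snd : ℝ × S → S) p :
        TangentSpace stModel p →ₗ[ℝ] TangentSpace (𝓡 3) p.2)) x
    rw [LinearMap.sum_apply]
    rfl

theorem metric_eq (p : ℝ × S) (x y : TangentSpace stModel p) :
    metric E u p x y = ∑ α, sgn α * (cofr E u α p x * cofr E u α p y) := by
  rw [Fin.sum_univ_succ]
  have h : ∀ I : Fin 3, sgn I.succ = 1 := fun I => by simp [sgn]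
  simp only [h, one_mul]
  change _ = sgn 0 * ((u.N p * dtForm p x) * (u.N p * dtForm p y)) +
    ∑ I, omForm E u I p x * omForm E u I p y
  have h0 : sgn 0 = -1 := by simp [sgn]
  rw [metric, h0]
  ring

theorem cofr_fr {p : ℝ × S} (hN : u.N p ≠ 0)
    (hd : ∀ I J, ∑ i, u.e I i p * u.om J i p = kd I J) (α β : Fin 4) :
    cofr E u α p (fr E u β p) = if α = β then 1 else 0 := by
  have t0 : dtForm p (e0 u p) = (u.N p)⁻¹ :=
    (mfderiv_fst_apply p (e0 u p)).trans (mul_one (u.N p)⁻¹ : (u.N p)⁻¹ * 1 = _)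
  have tS : ∀ I, dtForm p (eS E u I p) = 0 := fun I =>
    (mfderiv_fst_apply p (eS E u I p)).trans
      ((Prod.fst_sum).trans (Finset.sum_eq_zero fun k _ => (mul_zero (u.e I k p) : u.e I k p * 0 = 0)))
  have s0 : mfderiv stModel (𝓡 3) (Prod.snd : ℝ × S → S) p (e0 u p) = 0 :=
    (mfderiv_snd_apply p (e0 u p)).trans (smul_zero (u.N p)⁻¹ :
      (u.N p)⁻¹ • (0 : EuclideanSpace ℝ (Fin 3)) = 0)
  have sS : ∀ I, mfderiv stModel (𝓡 3) (Prod.snd : ℝ × S → S) p (eS E u I p) =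
      ∑ i, u.e I i p • E.basis p.2 i := fun I =>
    (mfderiv_snd_apply p (eS E u I p)).trans Prod.snd_sum
  refine Fin.cases ?_ (fun I => ?_) α <;> refine Fin.cases ?_ (fun J => ?_) β
  · change u.N p * dtForm p (e0 u p) = _
    rw [t0, mul_inv_cancel₀ hN, if_pos rfl]
  · change u.N p * dtForm p (eS E u J p) = _
    rw [tS, mul_zero, if_neg (Fin.succ_ne_zero J).symm]
  · change omForm E u I p (e0 u p) = _
    rw [omForm, if_neg (Fin.succ_ne_zero I)]
    exact Finset.sum_eq_zero fun i _ => by rw [s0, map_zero, mul_zero]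
  · change omForm E u I p (eS E u J p) = _
    have h1 : omForm E u I p (eS E u J p) = ∑ i, u.e J i p * u.om I i p := by
      rw [omForm]
      refine Finset.sum_congr rfl fun i _ => ?_
      rw [sS, map_sum]
      simp only [map_smul, Module.Basis.coord_apply, Module.Basis.repr_self, smul_eq_mul,
        Finsupp.single_apply, mul_ite, mul_one, mul_zero, Finset.sum_ite_eq', Finset.mem_univ,
        if_true]
      ring
    rw [h1, hd, kd]
    simp only [Fin.succ_inj, eq_comm]

end

namespace CoefRing
open FrameCalculus ConstraintSystem
variable {a ρ : ℝ} (X : Sol.{v} a ρ)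

theorem cofr_fr (p : X.dom) (α β : Fin 4) :
    cofr X.E X.u α p (fr X.E X.u β p) = if α = β then 1 else 0 :=
  EinsteinScalar.cofr_fr X.E X.u (X.N_pos p.2).ne' (X.hu.dual X.hd X.hδ p.2) α β

/-- The vector field `Y` has components `y` in the frame. -/
def IsRep (Y : VField X.S) (y : Fin 4 → CoefRing.{v} a ρ) : Prop :=
  ∀ p : X.dom, Y p = ∑ β, at' X p (y β) • fr X.E X.u β p

/-- Connection coefficients. -/
def G (α β γ : Fin 4) : CoefRing.{v} a ρ := ε _ γ * (sys a ρ).w α β γ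

/-- Covariant derivative in components. -/
def covD (z y : Fin 4 → CoefRing.{v} a ρ) (γ : Fin 4) : CoefRing.{v} a ρ :=
  ∑ α, z α * (D α (y γ) + ∑ β, y β * G α β γ)

variable {X} {Y Z : VField X.S} {y z : Fin 4 → CoefRing.{v} a ρ}

theorem IsRep.cofr (h : IsRep X Y y) (p : X.dom) (α : Fin 4) :
    cofr X.E X.u α p (Y p) = at' X p (y α) := by
  rw [cofr_eq, h p, map_sum]
  simp only [map_smul, ← cofr_eq, cofr_fr]
  simp

theorem IsRep.metric (h : IsRep X Y y) (p : X.dom) (ν : Fin 4) :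
    metric X.E X.u p (Y p) (fr X.E X.u ν p) = at' X p (ε _ ν * y ν) := by
  rw [metric_eq]
  simp only [h.cofr, cofr_fr]
  have h1 : sgn ν = at' X p (ε _ ν) := by
    refine Fin.cases ?_ (fun I => ?_) ν <;> simp [sgn]
  simp [h1]

theorem IsRep.sub (hZ : IsRep X Z z) (hY : IsRep X Y y) :
    IsRep X (fun q => Z q - Y q) (fun α => z α - y α) := fun p => by
  simp only [map_sub, sub_smul, Finset.sum_sub_distrib, ← hZ p, ← hY p]

theorem IsRep.add (hZ : IsRep X Z z) (hY : IsRep X Y y) :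
    IsRep X (fun q => Z q + Y q) (fun α => z α + y α) := fun p => by
  simp only [map_add, add_smul, Finset.sum_add_distrib, ← hZ p, ← hY p]

theorem IsRep.dirD (h : IsRep X Z z) (f : ℝ × X.S → ℝ) (p : X.dom) :
    dirD Z f p = ∑ α, at' X p (z α) * EinsteinScalar.dirD (fr X.E X.u α) f p := by
  have h1 := dirD_vf_sum (f := f) (p := (p : ℝ × X.S)) Finset.univ
    (fun α _ => at' X p (z α)) (fr X.E X.u)
  refine Eq.trans ?_ h1
  rw [EinsteinScalar.dirD, h p]
  rfl

theorem isRep_fr (β : Fin 4) : IsRep X (fr X.E X.u β) (fun γ => if γ = β then 1 else 0) :=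
  fun p => by simp [apply_ite (at' X p), ite_smul]

theorem connFr_eq (α β : Fin 4) (p : X.dom) :
    connFr X.E X.u α β p = ∑ γ, at' X p (G α β γ) • fr X.E X.u γ p := by
  have hw : ∀ α β γ, (G α β γ : CoefRing.{v} a ρ) = ε _ γ * (sys a ρ).w α β γ :=
    fun _ _ _ => rfl
  have hn : ∀ x : CoefRing.{v} a ρ, at' X p (-1 * -x) = at' X p x := fun x =>
    congrArg (at' X p) (by ring)
  rw [sum_four]
  refine Fin.cases ?_ (fun I => ?_) α <;> refine Fin.cases ?_ (fun J => ?_) β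
  · simp only [hw, ε_zero, ε_succ, w_000, w_00s, mul_zero, map_zero, zero_smul, zero_add, one_mul]
    change ∑ I, dLog X.E X.u I p • eS X.E X.u I p = _
    exact Finset.sum_congr rfl fun I _ => congrArg (· • eS X.E X.u I p) (at_n X p I).symm
  · simp only [hw, ε_zero, ε_succ, w_0s0, w_0ss, mul_zero, map_zero, zero_smul,
      Finset.sum_const_zero, add_zero, hn]
    exact congrArg (· • e0 X.u p) (at_n X p J).symm
  · simp only [hw, ε_zero, ε_succ, w_s00, w_s0s, mul_zero, map_zero, zero_smul, zero_add, one_mul]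
    change ∑ J, X.u.k I J p • eS X.E X.u J p = _
    exact Finset.sum_congr rfl fun J _ => congrArg (· • eS X.E X.u J p) (at_k X p I J).symm
  · simp only [hw, ε_zero, ε_succ, w_ss0, w_sss, one_mul, hn]
    change X.u.k I J p • e0 X.u p + ∑ K, X.u.Gam I J K p • eS X.E X.u K p = _
    exact congrArg₂ (· + ·) (congrArg (· • e0 X.u p) (at_k X p I J).symm)
      (Finset.sum_congr rfl fun K _ =>
        congrArg (· • eS X.E X.u K p) (at_base (.Gam I J K) X p).symm)

theorem IsRep.conn (hZ : IsRep X Z z) (hY : IsRep X Y y) :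
    IsRep X (conn X.E X.u Z Y) (covD z y) := fun p => by
  have h1 : ∀ β, EinsteinScalar.dirD Z (fun q => EinsteinScalar.cofr X.E X.u β q (Y q)) p =
      ∑ α, at' X p (z α) * at' X p (D α (y β)) := fun β => by
    rw [hZ.dirD]
    refine Finset.sum_congr rfl fun α _ => ?_
    rw [at_D α (y β) X p (f := fun q => EinsteinScalar.cofr X.E X.u β q (Y q))
      fun q => (hY.cofr q β).symm]
  rw [EinsteinScalar.conn]
  simp only [h1, hZ.cofr, hY.cofr, connFr_eq, covD, map_sum, map_mul, map_add, Finset.smul_sum,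
    smul_smul]
  have h2 : ∀ (c : Fin 4 → Fin 4 → Fin 4 → TangentSpace stModel (p : ℝ × X.S)),
      ∑ α, ∑ β, ∑ γ, c α β γ = ∑ γ, ∑ α, ∑ β, c α β γ := fun c => by
    rw [Finset.sum_congr rfl fun α _ => Finset.sum_comm, Finset.sum_comm]
  rw [h2, ← Finset.sum_add_distrib]
  refine Finset.sum_congr rfl fun γ _ => ?_
  simp only [← Finset.sum_smul, ← add_smul]
  congr 1
  rw [← Finset.sum_add_distrib]
  refine Finset.sum_congr rfl fun α _ => ?_
  rw [mul_add, Finset.mul_sum]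
  congr 1
  exact Finset.sum_congr rfl fun β _ => by ring

theorem covD_fr (α β γ : Fin 4) : covD (fun γ => if γ = α then 1 else 0)
    (fun γ => if γ = β then 1 else 0) γ = (G α β γ : CoefRing.{v} a ρ) := by
  have h : D α (if γ = β then 1 else 0 : CoefRing.{v} a ρ) = 0 := by
    split <;> simp
  simp [covD, h]

theorem isRep_conn_fr (α β : Fin 4) : IsRep X (EinsteinScalar.conn X.E X.u (fr X.E X.u α)
    (fr X.E X.u β)) (G α β) := by
  have := (isRep_fr (X := X) α).conn (isRep_fr β)
  rwa [funext (covD_fr α β)] at this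

theorem covD_single (α : Fin 4) (y : Fin 4 → CoefRing.{v} a ρ) (γ : Fin 4) :
    covD (fun γ => if γ = α then 1 else 0) y γ = D α (y γ) + ∑ β, y β * G α β γ := by
  simp [covD]

theorem covD_fr' (z : Fin 4 → CoefRing.{v} a ρ) (μ γ : Fin 4) :
    covD z (fun γ => if γ = μ then 1 else 0) γ = ∑ α, z α * G α μ γ := by
  have h : ∀ α, D α (if γ = μ then 1 else 0 : CoefRing.{v} a ρ) = 0 := fun α => by
    split <;> simp
  simp [covD, h]

/-- The geometric connection is expanded in frame components by `IsRep.conn`. The inner bracket is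
the torsion-free expression D_α e_β - D_β e_α, so its components are those of F. -/
theorem at_R (α β μ ν : Fin 4) (p : X.dom) :
    at' X p ((sys a ρ).R α β μ ν) = curvH X.E X.u α β μ ν p := by
  have h2 : (ε (CoefRing.{v} a ρ) ν) * ε _ ν = 1 := by
    refine Fin.cases ?_ (fun I => ?_) ν
    · rw [ε_zero]; ring
    · rw [ε_succ, one_mul]
  have h := ((((isRep_fr (X := X) α).conn (isRep_conn_fr β μ)).sub
    ((isRep_fr β).conn (isRep_conn_fr α μ))).sub
    (((isRep_conn_fr α β).sub (isRep_conn_fr β α)).conn (isRep_fr μ))).metric p ν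
  refine Eq.trans ?_ h.symm
  congr 1
  simp only [covD_single, covD_fr', R_eq, G, F, strucF, Derivation.leibniz, smul_eq_mul, D_ε]
  change D α _ - D β _ - _ + _ = _
  have hD : ∀ κ γ, D κ (ε (CoefRing.{v} a ρ) γ) = 0 := (sys a ρ).D_ε
  simp only [hD, mul_zero, add_zero, Fin.sum_univ_four]
  -- The connection with raised index carries ε_ν, and the metric pairing carries another; their
  -- product is 1.
  have key : ∀ x y : CoefRing.{v} a ρ, y = ε _ ν * ε _ ν * x → x = y := fun x y h => by
    rw [h, h2, one_mul]
  exact key _ _ (by ring)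

theorem sgn_eq (p : X.dom) (γ : Fin 4) : sgn γ = at' X p (ε _ γ) := by
  refine Fin.cases ?_ (fun I => ?_) γ <;> simp [sgn]

theorem at_Ric (α β : Fin 4) (p : X.dom) :
    at' X p ((sys a ρ).Ric α β) = ricH X.E X.u α β p := by
  rw [ricH]
  refine (map_sum (at' X p) _ _).trans (Finset.sum_congr rfl fun γ _ => ?_)
  rw [sgn_eq p, ← at_R, ← map_mul]

theorem at_E (α β : Fin 4) (p : X.dom) :
    at' X p ((sys a ρ).E α β) = errT X.E X.u X.V α β p := by
  have hg : EinsteinScalar.metric X.E X.u p (fr X.E X.u α p) (fr X.E X.u β p) =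
      at' X p (ConstraintSystem.g _ α β) := by
    rw [(isRep_fr α).metric p β]
    congr 1
    by_cases h : α = β <;> simp [ConstraintSystem.g, h, eq_comm]
  have hV : at' X p ((sys a ρ).V0) = X.V (X.u.phi p) := at_base _ X p
  rw [errT, hg, ← at_Ric, ← hV]
  have h1 : ∀ γ, EinsteinScalar.dirD (fr X.E X.u γ) X.u.phi p = at' X p (D γ (base .phi)) :=
    fun γ => (at_D_base γ .phi X p).symm
  rw [h1, h1, ← map_mul, ← map_mul, ← map_sub, ← map_sub]
  rfl

theorem at_rot (I J : Fin 3) (p : X.dom) :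
    at' X p ((1 / 2 : ℝ) • ((sys a ρ).E I.succ J.succ - (sys a ρ).E J.succ I.succ)) =
      errA X.E X.u X.V I J p := by
  rw [map_smul, map_sub, at_E, at_E, errA, smul_eq_mul]; ring

theorem at_lap (I : Fin 3) (p : X.dom) :
    at' X p ((sys a ρ).lap I) = lapC X.E X.u I p := by
  refine (map_sub (at' X p) _ _).trans ?_
  exact congrArg₂ (· - ·) (at_n X p I) (at_base (.dN I) X p)

theorem at_C (I J K : Fin 3) (p : X.dom) :
    at' X p ((sys a ρ).C I J K) = torsC X.E X.u I J K p := by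
  have hb : IsRep X (VectorField.mlieBracket stModel (eS X.E X.u I) (eS X.E X.u J))
      (fun γ => Fin.cases (motive := fun _ => CoefRing.{v} a ρ) 0 ((sys a ρ).c I J) γ) :=
    fun q => by
      refine (X.bracket q.2 I J).trans (Eq.trans ?_ (Fin.sum_univ_succ _).symm)
      simp only [Fin.cases_zero, Fin.cases_succ, map_zero, zero_smul, zero_add]
      exact Finset.sum_congr rfl fun K _ =>
        congrArg (· • eS X.E X.u K q) (at_c X q I J K).symm
  have h := ((hb.sub (isRep_conn_fr I.succ J.succ)).add (isRep_conn_fr J.succ I.succ)).metric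
    p K.succ
  refine Eq.trans ?_ h.symm
  simp [ConstraintSystem.C, G]

end CoefRing
end EinsteinScalar
end

/-! ### Principal part and universal lower-order terms -/

noncomputable section
namespace EinsteinScalar
universe v

/-- The labels of the constraint variables, grouped by kind. -/
def CVar.equivSum : CVar ≃ (Fin 3 × Fin 3 × Fin 3) ⊕ Fin 3 ⊕ (Fin 3 × Fin 3) ⊕ Unit ⊕ Unit ⊕
    Fin 3 ⊕ (Fin 3 × Fin 3) where
  toFun
    | .tors I J K => .inl (I, J, K)
    | .lap I => .inr (.inl I)
    | .dLap I J => .inr (.inr (.inl (I, J)))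
    | .trLap => .inr (.inr (.inr (.inl ())))
    | .ham => .inr (.inr (.inr (.inr (.inl ()))))
    | .mom I => .inr (.inr (.inr (.inr (.inr (.inl I)))))
    | .rot I J => .inr (.inr (.inr (.inr (.inr (.inr (I, J))))))
  invFun
    | .inl (I, J, K) => .tors I J K
    | .inr (.inl I) => .lap I
    | .inr (.inr (.inl (I, J))) => .dLap I J
    | .inr (.inr (.inr (.inl ()))) => .trLap
    | .inr (.inr (.inr (.inr (.inl ())))) => .ham
    | .inr (.inr (.inr (.inr (.inr (.inl I))))) => .mom I
    | .inr (.inr (.inr (.inr (.inr (.inr (I, J)))))) => .rot I J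
  left_inv c := by cases c <;> rfl
  right_inv := by rintro (x | x | x | x | x | x | x) <;> rfl

theorem CVar.sum_eq {M : Type*} [AddCommMonoid M] (f : CVar → M) : ∑ c, f c =
    (∑ I, ∑ J, ∑ K, f (.tors I J K)) + ((∑ I, f (.lap I)) + ((∑ I, ∑ J, f (.dLap I J)) +
      (f .trLap + (f .ham + ((∑ I, f (.mom I)) + ∑ I, ∑ J, f (.rot I J)))))) := by
  rw [Fintype.sum_equiv CVar.equivSum f (fun x => f (CVar.equivSum.symm x))
    fun c => by rw [Equiv.symm_apply_apply]]
  simp only [Fintype.sum_sum_type, Fintype.sum_prod_type, Finset.univ_unique, Finset.sum_singleton]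
  rfl

namespace CoefRing
open FrameCalculus ConstraintSystem
variable {a ρ : ℝ}

/-- The constraint variables as elements of the ring of coefficients. -/
def cons : CVar → CoefRing.{v} a ρ
  | .tors I J K => (sys a ρ).C I J K
  | .lap I => (sys a ρ).lap I
  | .dLap I J => D I.succ ((sys a ρ).lap J)
  | .trLap => ∑ I : Fin 3, D I.succ ((sys a ρ).lap I)
  | .ham => (sys a ρ).E 0 0
  | .mom I => (sys a ρ).E I.succ 0
  | .rot I J => (1 / 2 : ℝ) • ((sys a ρ).E I.succ J.succ - (sys a ρ).E J.succ I.succ)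

theorem at_cons (c : CVar) (X : Sol.{v} a ρ) (p : X.dom) :
    at' X p (cons c) = cvar X.E X.u X.V c p := by
  cases c with
  | tors I J K => exact at_C I J K p
  | lap I => exact at_lap I p
  | dLap I J => exact at_D _ _ X p fun q => at_lap J q
  | trLap =>
    exact (map_sum (at' X p) _ _).trans
      (Finset.sum_congr rfl fun I _ => at_D _ _ X p fun q => at_lap I q)
  | ham => exact at_E 0 0 p
  | mom I => exact at_E _ 0 p
  | rot I J => exact at_rot I J p

theorem at_D_cons (α : Fin 4) (c : CVar) (X : Sol.{v} a ρ) (p : X.dom) :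
    at' X p (D α (cons c)) = dirD (fr X.E X.u α) (cvar X.E X.u X.V c) p :=
  at_D α _ X p fun q => at_cons c X q

/-- The ideal of the constraints. -/
def consIdeal (a ρ : ℝ) : Ideal (CoefRing.{v} a ρ) :=
  Ideal.span (range fun c : {c : CVar // c ≠ .trLap} => cons c.1)

theorem cons_mem (c : CVar) (hc : c ≠ .trLap) : cons c ∈ consIdeal.{v} a ρ :=
  Ideal.subset_span ⟨⟨c, hc⟩, rfl⟩

theorem contains_consIdeal : (sys a ρ).Contains (consIdeal.{v} a ρ) where
  C I J K := cons_mem (.tors I J K) (by simp)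
  lap I := cons_mem (.lap I) (by simp)
  dlap I J := cons_mem (.dLap I J) (by simp)
  ham := cons_mem .ham (by simp)
  mom I := cons_mem (.mom I) (by simp)
  rot I J := cons_mem (.rot I J) (by simp)

/-- Turns ideal membership into explicit lower-order terms by lifting each coefficient to a
polynomial. The trace e_I𝒩_I is excluded from the generators, since it is a sum of the e_I𝒩_J, and
therefore gets coefficient zero. -/
theorem exists_poly {x : CoefRing.{v} a ρ} (hx : x ∈ consIdeal a ρ) :
    ∃ b : CVar → MvPolynomial CoefAtom ℝ, b .trLap = 0 ∧ x = ∑ c, mk (b c) * cons c := by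
  obtain ⟨f, hf⟩ := (Ideal.mem_span_range_iff_exists_fun).1 hx
  choose g hg using fun x : CoefRing.{v} a ρ => mk_surjective x
  refine ⟨fun c => if h : c ≠ .trLap then g (f ⟨c, h⟩) else 0, by simp, ?_⟩
  have hb : ∀ c : {c : CVar // c ≠ .trLap},
      mk (if h : c.1 ≠ .trLap then g (f ⟨c.1, h⟩) else 0) = f c := fun c => by
    rw [dif_pos c.2, hg]
  have h0 := Finset.sum_subtype (p := fun c : CVar => c ≠ .trLap) (F := inferInstance)
    (Finset.univ.filter fun c : CVar => c ≠ .trLap) (by simp)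
    fun c => mk (if h : c ≠ .trLap then g (f ⟨c, h⟩) else 0) * (cons c : CoefRing.{v} a ρ)
  rw [← hf]
  refine (Finset.sum_congr rfl fun c _ => by rw [hb c]).trans (h0.symm.trans ?_)
  refine Finset.sum_subset (Finset.filter_subset _ _) fun c _ hc => ?_
  have hc' : c = .trLap := by simpa using hc
  have hm : (mk 0 : CoefRing.{v} a ρ) = 0 := map_zero (evalAll a ρ).rangeRestrict
  rw [dif_neg (not_not.2 hc'), hm, zero_mul]

/-- The principal part of the evolution system. -/
def principal (r : CVar) : CoefRing.{v} a ρ :=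
  ∑ m, ∑ c, principalMatrix a ρ m r c • D m.succ (cons c)

theorem at_principal (r : CVar) (X : Sol.{v} a ρ) (p : X.dom) : at' X p (principal r) =
    ∑ m, ∑ c, principalMatrix a ρ m r c * dirD (eS X.E X.u m) (cvar X.E X.u X.V c) p := by
  simp only [principal, map_sum, map_smul, at_D_cons, fr_succ, smul_eq_mul]

theorem principal_tors (I J K : Fin 3) : principal (.tors I J K) = (0 : CoefRing.{v} a ρ) := by
  simp [principal, principalMatrix]

theorem principal_lap (I : Fin 3) : principal (.lap I) = (0 : CoefRing.{v} a ρ) := by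
  simp [principal, principalMatrix]

theorem principal_dLap (I J : Fin 3) : principal (.dLap I J) =
    -alpha a ρ • (D I.succ (cons (.mom J)) : CoefRing.{v} a ρ) := by
  simp [principal, principalMatrix, CVar.sum_eq, kd, ite_smul]

theorem principal_trLap : principal .trLap =
    -alpha a ρ • ∑ I : Fin 3, (D I.succ (cons (.mom I)) : CoefRing.{v} a ρ) := by
  simp [principal, principalMatrix, CVar.sum_eq, kd, ite_smul, Finset.smul_sum]

theorem principal_ham : principal .ham =
    (1 / (3 * ρ) - alpha a ρ) • ∑ I : Fin 3, (D I.succ (cons (.mom I)) : CoefRing.{v} a ρ) := by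
  simp [principal, principalMatrix, CVar.sum_eq, kd, ite_smul, Finset.smul_sum]

theorem principal_rot (I J : Fin 3) : principal (.rot I J) =
    (1 / 2 : ℝ) • (D J.succ (cons (.mom I)) - D I.succ (cons (.mom J)) : CoefRing.{v} a ρ) := by
  simp [principal, principalMatrix, CVar.sum_eq, kd, ite_smul, smul_sub, sub_smul, mul_sub,
    Finset.sum_sub_distrib]

theorem cons_rot_swap (I J : Fin 3) : (cons (.rot J I) : CoefRing.{v} a ρ) = -cons (.rot I J) := by
  rw [cons, cons, ← smul_neg, neg_sub]

theorem principal_mom (I : Fin 3) : principal (.mom I) =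
    (2 / 3 + ρ) • (D I.succ (cons .ham) : CoefRing.{v} a ρ)
      - (1 / 2 : ℝ) • ∑ m : Fin 3, D m.succ (cons (.dLap m I))
      - (1 / 6 * (1 + 6 * ρ)) • D I.succ (cons .trLap)
      + ∑ m : Fin 3, D m.succ (cons (.rot I m)) := by
  simp [principal, principalMatrix, CVar.sum_eq, kd, ite_smul, smul_sub, sub_smul, mul_sub,
    Finset.sum_sub_distrib]
  -- Antisymmetry merges the two halves of (1/2) e_K(E_[IK] - E_[KI]) into e_K E_[IK].
  have hr : ∀ x, (cons (.rot x I) : CoefRing.{v} a ρ) = -cons (.rot I x) := fun x =>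
    cons_rot_swap I x
  simp only [Finset.sum_add_distrib, Finset.sum_neg_distrib, Finset.sum_ite_eq',
    Finset.mem_univ, if_true, Finset.sum_sub_distrib, ← Finset.smul_sum, hr, map_neg]
  module

theorem D_cons (hρ : 0 < ρ) (r : CVar) :
    D 0 (cons r) - principal r ∈ consIdeal.{v} a ρ := by
  have h := contains_consIdeal.{v} (a := a) (ρ := ρ)
  cases r with
  | tors I J K => rw [principal_tors, sub_zero]; exact h.D_C I J K
  | lap I => rw [principal_lap, sub_zero]; exact h.D_lap I
  | dLap I J => rw [principal_dLap, neg_smul, sub_neg_eq_add]; exact h.D_dlap I J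
  | trLap =>
    rw [principal_trLap, neg_smul, sub_neg_eq_add, cons, map_sum, Finset.smul_sum,
      ← Finset.sum_add_distrib]
    exact Ideal.sum_mem _ fun I _ => h.D_dlap I I
  | ham => rw [principal_ham]; exact h.D_ham hρ
  | mom I =>
    rw [principal_mom]
    have := h.D_mom hρ I
    simp only [cons, map_sum] at this ⊢
    exact this
  | rot I J => rw [principal_rot]; exact h.D_rot hρ I J

end CoefRing
end EinsteinScalar
end

/-! ### The symmetrizer and the linear system -/

noncomputable section
namespace EinsteinScalar
universe v

/-- The diagonal of the symmetrizer. -/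
def symmDiag (a ρ : ℝ) : CVar → ℝ
  | .dLap _ _ => 1 / (2 * alpha a ρ)
  | .trLap => (1 / 6 + ρ) / alpha a ρ
  | .ham => (2 / 3 + ρ) / (1 / (3 * ρ) - alpha a ρ)
  | _ => 1

theorem alpha_pos {a ρ : ℝ} (ha : 0 < a) (hρ : 0 < ρ) : 0 < alpha a ρ := by
  unfold alpha; positivity

/-- Cross-multiplication reduces the claim to ρ + 2/3 > 3ρ(𝔞 + 1), which is ρ(9𝔞 + 6) < 2. -/
theorem alpha_lt {a ρ : ℝ} (ha : 0 < a) (hρ : 0 < ρ) (h : ρ < 2 / (9 * a + 6)) :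
    0 < 1 / (3 * ρ) - alpha a ρ := by
  rw [lt_div_iff₀ (by positivity)] at h
  rw [alpha, sub_pos, div_lt_div_iff₀ (by positivity) (by positivity)]
  linarith

theorem symmDiag_pos {a ρ : ℝ} (ha : 0 < a) (hρ : 0 < ρ) (h : ρ < 2 / (9 * a + 6)) (r : CVar) :
    0 < symmDiag a ρ r := by
  have h1 := alpha_pos ha hρ
  have h2 := alpha_lt ha hρ h
  cases r <;> simp only [symmDiag] <;> positivity

/-- Every nonzero entry pairs E_I0 with another variable. The diagonal entries are the ratios of
opposite coefficients: 1/2 to α, 1/6 + ρ to α, and 2/3 + ρ to 1/(3ρ) - α; the pair with E_[IJ] is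
already symmetric. -/
theorem symmDiag_mul {a ρ : ℝ} (ha : 0 < a) (hρ : 0 < ρ) (h : ρ < 2 / (9 * a + 6)) (m : Fin 3)
    (r c : CVar) : symmDiag a ρ r * principalMatrix a ρ m r c =
      symmDiag a ρ c * principalMatrix a ρ m c r := by
  have h1 := (alpha_pos ha hρ).ne'
  have h2 := (alpha_lt ha hρ h).ne'
  have hk : ∀ I J, kd I J = kd J I := fun I J => by simp only [kd, eq_comm]
  have e1 : 1 / (2 * alpha a ρ) * alpha a ρ = 1 / 2 := by field_simp
  have e2 : (1 / 6 + ρ) / alpha a ρ * alpha a ρ = 1 / 6 + ρ := by field_simp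
  have e3 : (2 / 3 + ρ) / (1 / (3 * ρ) - alpha a ρ) * (1 / (3 * ρ) - alpha a ρ) = 2 / 3 + ρ :=
    div_mul_cancel₀ _ h2
  cases r with
  | mom I =>
    cases c with
    | dLap K L =>
      simp only [symmDiag, principalMatrix, hk I L]
      linear_combination kd m K * kd L I * e1
    | trLap =>
      simp only [symmDiag, principalMatrix, hk I]
      linear_combination kd m I * e2
    | ham =>
      simp only [symmDiag, principalMatrix, hk I]
      linear_combination -kd m I * e3
    | rot K L =>
      simp only [symmDiag, principalMatrix, hk I, hk m]
      ring
    | _ => simp only [principalMatrix, mul_zero]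
  | dLap K L =>
    cases c with
    | mom I =>
      simp only [symmDiag, principalMatrix, hk I L]
      linear_combination -kd m K * kd L I * e1
    | _ => simp only [principalMatrix, mul_zero]
  | trLap =>
    cases c with
    | mom I =>
      simp only [symmDiag, principalMatrix, hk I]
      linear_combination -kd m I * e2
    | _ => simp only [principalMatrix, mul_zero]
  | ham =>
    cases c with
    | mom I =>
      simp only [symmDiag, principalMatrix, hk I]
      linear_combination kd m I * e3
    | _ => simp only [principalMatrix, mul_zero]
  | rot K L =>
    cases c with
    | mom I =>
      simp only [symmDiag, principalMatrix, hk I, hk m]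
      ring
    | _ => simp only [principalMatrix, mul_zero]
  | _ => cases c <;> simp only [principalMatrix, mul_zero]

theorem Sol.isSymmetrizableHyperbolic {a ρ : ℝ} (X : Sol.{v} a ρ) (ha : 0 < a) (hρ : 0 < ρ)
    (h : ρ < 2 / (9 * a + 6)) (B : CVar → CVar → MvPolynomial CoefAtom ℝ) :
    IsSymmetrizableHyperbolic X.T X.δ
      (fun i p => X.u.N p • ∑ I, X.u.e I i p • principalMatrix a ρ I)
      (fun p => X.u.N p • Matrix.of fun r c => coef X.E X.u X.V (B r c) p) where
  smooth_A i r c := by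
    simp only [Matrix.smul_apply, Matrix.sum_apply, smul_eq_mul]
    exact X.hu.smooth_N.mul (SmoothOn.sum fun I _ => (X.hu.smooth_e I i).mul (SmoothOn.const _))
  smooth_B r c := X.hu.smooth_N.mul (X.smoothOn_coef (B r c))
  symmetrizer := by
    refine ⟨fun _ => Matrix.diagonal (symmDiag a ρ), fun r c => SmoothOn.const _,
      fun _ _ => Matrix.isSymm_diagonal _, ?_, fun p _ i => ?_⟩
    · have : Nonempty CVar := ⟨.ham⟩
      -- The symmetrizer is constant, so its smallest diagonal entry is a uniform lower bound.
      obtain ⟨r, hr⟩ := Finite.exists_min (symmDiag a ρ)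
      refine ⟨symmDiag a ρ r, symmDiag_pos ha hρ h r, fun p _ w => ?_⟩
      simp only [dotProduct, Matrix.mulVec_diagonal, Finset.mul_sum]
      refine Finset.sum_le_sum fun c _ => ?_
      nlinarith [hr c, mul_self_nonneg (w c)]
    · refine Matrix.IsSymm.ext fun r c => ?_
      simp only [Matrix.diagonal_mul, Matrix.smul_apply, Matrix.sum_apply, smul_eq_mul]
      have : ∀ r c, symmDiag a ρ r * (X.u.N p * ∑ I, X.u.e I i p * principalMatrix a ρ I r c) =
          X.u.N p * ∑ I, X.u.e I i p * (symmDiag a ρ r * principalMatrix a ρ I r c) :=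
        fun r c => by
          rw [mul_left_comm, Finset.mul_sum]
          exact congrArg _ (Finset.sum_congr rfl fun I _ => by ring)
      rw [this, this]
      exact congrArg _ (Finset.sum_congr rfl fun I _ => by rw [symmDiag_mul ha hρ h I c r])

open CoefRing in
-- The polynomials are chosen from memberships in the universal ring, before any solution is given;
-- evaluation at a point then specializes them.
theorem exists_lowerOrder (a : ℝ) {ρ : ℝ} (hρ : 0 < ρ) :
    ∃ B : CVar → CVar → MvPolynomial CoefAtom ℝ, (∀ r, B r .trLap = 0) ∧
      ∀ (X : Sol.{v} a ρ) (p : X.dom) (r : CVar),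
        dirD (e0 X.u) (cvar X.E X.u X.V r) p =
          at' X p (principal r) + lowerOrder X.E X.u X.V B r p := by
  choose B hB hB' using fun r => exists_poly (D_cons.{v} (a := a) hρ r)
  refine ⟨B, hB, fun X p r => ?_⟩
  have h := congrArg (at' X p) (hB' r)
  simp only [map_sub, map_sum, map_mul, at_mk, at_cons, at_D_cons, fr_zero] at h
  rw [lowerOrder]
  linarith

open CoefRing in
theorem Sol.solvesLinear {a ρ : ℝ} (X : Sol.{v} a ρ)
    (B : CVar → CVar → MvPolynomial CoefAtom ℝ)
    (h : ∀ (p : X.dom) (r : CVar), dirD (e0 X.u) (cvar X.E X.u X.V r) p =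
      at' X p (principal r) + lowerOrder X.E X.u X.V B r p) :
    SolvesLinear X.E X.T X.δ
      (fun i p => X.u.N p • ∑ I, X.u.e I i p • principalMatrix a ρ I)
      (fun p => X.u.N p • Matrix.of fun r c => coef X.E X.u X.V (B r c) p)
      (cvar X.E X.u X.V) := fun p hp r => by
  have h1 := h ⟨p, hp⟩ r
  have hN := (X.N_pos hp).ne'
  rw [at_principal, dirD_e0, lowerOrder] at h1
  have h2 : dirD dt (cvar X.E X.u X.V r) p = X.u.N p * ((X.u.N p)⁻¹ *
      dirD dt (cvar X.E X.u X.V r) p) := by field_simp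
  rw [h2, h1]
  simp only [dirD_eS, Matrix.smul_apply, Matrix.sum_apply, smul_eq_mul, Matrix.of_apply, mul_add,
    Finset.mul_sum, Finset.sum_mul]
  congr 1
  · rw [Finset.sum_congr rfl fun i _ => Finset.sum_comm, Finset.sum_comm]
    refine Finset.sum_congr rfl fun m _ => ?_
    rw [Finset.sum_comm]
    exact Finset.sum_congr rfl fun i _ => Finset.sum_congr rfl fun c _ => by ring
  · exact Finset.sum_congr rfl fun c _ => by ring

end EinsteinScalar

end

theorem mainTheorem5 (a ρ : ℝ) (ha : 0 < a) (hρ : 0 < ρ) :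
    ∃ B : CVar → CVar → MvPolynomial CoefAtom ℝ,
      (∀ r, B r .trLap = 0) ∧
      ∀ (S : Type*) [TopologicalSpace S] [ChartedSpace (EuclideanSpace ℝ (Fin 3)) S]
        [IsManifold (𝓡 3) ∞ S] (E : RefFrame S) (V : ℝ → ℝ) (T δ : ℝ) (u : Unknowns S),
        ContDiff ℝ ∞ V → 0 < δ → δ ≤ T →
        IsModifiedSolution E u a ρ V T δ → HasAdmissibleData E u T →
        (∀ p ∈ slab S T δ,
          (∀ I J K, dirD (e0 u) (torsC E u I J K) p = lowerOrder E u V B (.tors I J K) p) ∧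
          (∀ I, dirD (e0 u) (lapC E u I) p = lowerOrder E u V B (.lap I) p) ∧
          (∀ I J, dirD (e0 u) (dirD (eS E u I) (lapC E u J)) p =
            -alpha a ρ * dirD (eS E u I) (errT E u V J.succ 0) p
              + lowerOrder E u V B (.dLap I J) p) ∧
          (dirD (e0 u) (fun q => ∑ I, dirD (eS E u I) (lapC E u I) q) p =
            -alpha a ρ * ∑ I, dirD (eS E u I) (errT E u V I.succ 0) p
              + lowerOrder E u V B .trLap p) ∧
          (∀ I, dirD (e0 u) (errT E u V I.succ 0) p =
            (2 / 3 + ρ) * dirD (eS E u I) (errT E u V 0 0) p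
              - 1 / 2 * ∑ K, dirD (eS E u K) (dirD (eS E u K) (lapC E u I)) p
              - 1 / 6 * (1 + 6 * ρ) * ∑ K, dirD (eS E u I) (dirD (eS E u K) (lapC E u K)) p
              + ∑ K, dirD (eS E u K) (errA E u V I K) p
              + lowerOrder E u V B (.mom I) p) ∧
          (dirD (e0 u) (errT E u V 0 0) p =
            (1 / (3 * ρ) - alpha a ρ) * ∑ K, dirD (eS E u K) (errT E u V K.succ 0) p
              + lowerOrder E u V B .ham p) ∧
          (∀ I J, dirD (e0 u) (errA E u V I J) p =
            1 / 2 * (dirD (eS E u J) (errT E u V I.succ 0) p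
              - dirD (eS E u I) (errT E u V J.succ 0) p)
              + lowerOrder E u V B (.rot I J) p)) ∧
        (ρ < 2 / (9 * a + 6) →
          IsSymmetrizableHyperbolic T δ
            (fun i p => u.N p • ∑ I, u.e I i p • principalMatrix a ρ I)
            (fun p => u.N p • Matrix.of fun r c => coef E u V (B r c) p) ∧
          SolvesLinear E T δ
            (fun i p => u.N p • ∑ I, u.e I i p • principalMatrix a ρ I)
            (fun p => u.N p • Matrix.of fun r c => coef E u V (B r c) p)
            (cvar E u V)) := by
  obtain ⟨B, hB, hB'⟩ := exists_lowerOrder a hρ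
  refine ⟨B, hB, fun S _ _ _ E V T δ u hV hδ hT hu hd => ?_⟩
  let X : Sol a ρ := ⟨S, E, u, V, T, δ, hV, hδ, hT, hu, hd⟩
  have h1 : ∀ (α : Fin 4) (c : CVar) (p : ℝ × S) (hp : p ∈ slab S T δ),
      CoefRing.at' X ⟨p, hp⟩ (CoefRing.D α (CoefRing.cons c)) = dirD (fr E u α) (cvar E u V c) p :=
    fun α c p hp => CoefRing.at_D_cons α c X ⟨p, hp⟩
  refine ⟨fun p hp => ?_, fun h => ⟨X.isSymmetrizableHyperbolic ha hρ h B,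
    X.solvesLinear B (hB' X)⟩⟩
  have h := hB' X ⟨p, hp⟩
  refine ⟨fun I J K => ?_, fun I => ?_, fun I J => ?_, ?_, fun I => ?_, ?_, fun I J => ?_⟩
  · refine (h (.tors I J K)).trans ?_
    rw [CoefRing.principal_tors, map_zero, zero_add]
  · refine (h (.lap I)).trans ?_
    rw [CoefRing.principal_lap, map_zero, zero_add]
  · refine (h (.dLap I J)).trans ?_
    rw [CoefRing.principal_dLap, map_smul, h1]; rfl
  · refine (h .trLap).trans ?_
    rw [CoefRing.principal_trLap, map_smul, map_sum]
    simp only [h1]; rfl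
  · refine (h (.mom I)).trans ?_
    -- The principal part differentiates the variable e_K𝒩_K as a whole, while the stated equation
    -- sums the second derivatives.
    have h2 : CoefRing.D I.succ (CoefRing.cons .trLap) = ∑ m : Fin 3, CoefRing.D I.succ (CoefRing.cons (.dLap m m) : CoefRing a ρ) :=
      map_sum _ _ _
    rw [CoefRing.principal_mom, h2]
    simp only [map_add, map_sub, map_smul, map_sum, h1]; rfl
  · refine (h .ham).trans ?_
    rw [CoefRing.principal_ham, map_smul, map_sum]
    simp only [h1]; rfl
  · refine (h (.rot I J)).trans ?_
    rw [CoefRing.principal_rot, map_smul, map_sub, h1, h1]; rfl
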